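/- Let $M$ be a compact (Hausdorff) smooth manifold of dimension $n\ge 2$ with smooth, possibly empty, boundary. A \emph{rough metric} $g$ on $M$ is a symmetric covariant two-tensor field whose coefficients are Lebesgue measurable in every chart and such that every $x\in M$ lies in some chart $(U,\psi)$ with a constant $C\ge 1$ for which $C^{-1}|d\psi(u)|\le \sqrt{g_y(u,u)}\le C|d\psi(u)|$ for almost every $y\in U$ and all $u\in T_yM$. Let $\mu_g$ be the Radon measure on $M$ given by $\sqrt{\det g_{ij}}\,dx$ in every chart, and let $L^2(M,\mu_g)$ and $L^2(T^*M,\mu_g)$ be the Hilbert spaces of square-integrable complex functions and complex covector fields, the latter with the scalar product $\int_M\langle\alpha,\beta\rangle_g\,d\mu_g$. The differential $d$, defined on the smooth functions on $M$, is closable as an operator from $L^2(M,\mu_g)$ to $L^2(T^*M,\mu_g)$. Denote its closure by $\nabla$ and put $H^1(M)=\mathsf D(\nabla)$, with norm $(\|u\|^2+\|\nabla u\|^2)^{1/2}$. Let $H^1_0(M)$ be the domain of the closure of the restriction of $d$ to the smooth functions with compact support in the interior of $M$. An \emph{admissible boundary condition} is a closed subspace $\mathcal W$ of $H^1(M)$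 that contains $H^1_0(M)$. The Laplacian $\Delta_{g,\mathcal W}$ is the operator in $L^2(M,\mu_g)$ associated with the Dirichlet form $\mathcal E_{g,\mathcal W}[u,v]=(\nabla u,\nabla v)_{L^2(T^*M,\mu_g)}$ on $\mathcal W$: $u\in\mathsf D(\Delta_{g,\mathcal W})$ and $\Delta_{g,\mathcal W}u=f$ if and only if $u\in\mathcal W$, $f\in L^2(M,\mu_g)$ and $\mathcal E_{g,\mathcal W}[u,v]=(f,v)_{L^2(M,\mu_g)}$ for all $v\in\mathcal W$. Proposition. For every rough metric $g$ on $M$ and every admissible boundary condition $\mathcal W$, the operator $\Delta_{g,\mathcal W}$ is self-adjoint and its spectrum is purely discrete: every point of the spectrum is an isolated point of the spectrum and an eigenvalue with finite-dimensional eigenspace. Moreover, the spectrum has no finite accumulation point, and every eigenspace of $\Delta_{g,\mathcal W}$ is finite-dimensional. -/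

import Mathlib

open MeasureTheory Set Filter Topology
open scoped Manifold ContDiff ENNReal ComplexConjugate

namespace RoughLaplacian

set_option linter.unusedSectionVars false

/-! ### Coordinate frames -/

section Frames

variable {n : ℕ} {H : Type*} [TopologicalSpace H]
  (I : ModelWithCorners ℝ (EuclideanSpace ℝ (Fin n)) H)
  {M : Type*} [TopologicalSpace M] [ChartedSpace H M]

/-- The coordinate vector field `∂ᵢ` of the chart `e`, at the point with coordinates `z`. -/
noncomputable def coordVec (e : OpenPartialHomeomorph M H) (z : EuclideanSpace ℝ (Fin n))
    (i : Fin n) : TangentSpace I ((e.extend I).symm z) :=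
  mfderivWithin 𝓘(ℝ, EuclideanSpace ℝ (Fin n)) I (e.extend I).symm (range I) z
    (EuclideanSpace.single i (1 : ℝ))

/-- A basis of `T_x M` (the tangent space is a copy of `ℝⁿ`). -/
noncomputable def stdFrame (x : M) (i : Fin n) : TangentSpace I x :=
  (EuclideanSpace.single i (1 : ℝ) : EuclideanSpace ℝ (Fin n))

/-- The differential `dψ(x) : T_x M → ℝⁿ` of the chart `ψ = e.extend I`. -/
noncomputable def coordDeriv (e : OpenPartialHomeomorph M H) (x : M) :
    TangentSpace I x →L[ℝ] EuclideanSpace ℝ (Fin n) :=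
  mfderiv I 𝓘(ℝ, EuclideanSpace ℝ (Fin n)) (e.extend I) x

/-- The Lebesgue measure on the image `ψ(U)` of the chart `ψ = e.extend I` with domain `U`. -/
noncomputable def chartLebesgue (e : OpenPartialHomeomorph M H) :
    Measure (EuclideanSpace ℝ (Fin n)) :=
  volume.restrict (e.extend I).target

end Frames

/-! ### Rough metrics -/

/-- A rough metric on `M`: a symmetric covariant two-tensor field whose coefficients are Lebesgue
measurable in every chart, and which, around every point, is comparable almost everywhere
in some chart to the pullback of the Euclidean scalar product. -/
structure RoughMetric {n : ℕ} {H : Type*} [TopologicalSpace H]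
    (I : ModelWithCorners ℝ (EuclideanSpace ℝ (Fin n)) H)
    (M : Type*) [TopologicalSpace M] [ChartedSpace H M] where
  /-- the bilinear form `g(x)` on `T_x M` -/
  toFun : ∀ x : M, TangentSpace I x →L[ℝ] TangentSpace I x →L[ℝ] ℝ
  symm : ∀ x u v, toFun x u v = toFun x v u
  measurable : ∀ e ∈ IsManifold.maximalAtlas I ∞ M, ∀ i j : Fin n,
    AEMeasurable (fun z => toFun ((e.extend I).symm z) (coordVec I e z i) (coordVec I e z j))
      (chartLebesgue I e)
  comparable : ∀ x : M, ∃ e ∈ IsManifold.maximalAtlas I ∞ M, x ∈ e.source ∧ ∃ C : ℝ, 1 ≤ C ∧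
    ∀ᵐ z ∂(chartLebesgue I e), ∀ u : TangentSpace I ((e.extend I).symm z),
      C⁻¹ * ‖coordDeriv I e ((e.extend I).symm z) u‖ ≤ √(toFun ((e.extend I).symm z) u u) ∧
      √(toFun ((e.extend I).symm z) u u) ≤ C * ‖coordDeriv I e ((e.extend I).symm z) u‖

section Metric

variable {n : ℕ} {H : Type*} [TopologicalSpace H]
  {I : ModelWithCorners ℝ (EuclideanSpace ℝ (Fin n)) H}
  {M : Type*} [TopologicalSpace M] [ChartedSpace H M]

/-- The matrix of `g(x)` with respect to tangent vectors `b₁, …, bₙ` at `x`. -/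
noncomputable def gram (g : RoughMetric I M) (x : M) (b : Fin n → TangentSpace I x) :
    Matrix (Fin n) (Fin n) ℝ :=
  Matrix.of fun i j => g.toFun x (b i) (b j)

/-- `∑ gⁱʲ α(bᵢ) conj(β(bⱼ))` for a basis `b` of `T_x M`. -/
noncomputable def dualForm (g : RoughMetric I M) (x : M) (b : Fin n → TangentSpace I x)
    (α β : TangentSpace I x →L[ℝ] ℂ) : ℂ :=
  ∑ i, ∑ j, (((gram g x b)⁻¹ i j : ℝ) : ℂ) * α (b i) * conj (β (b j))

/-- The Hermitian scalar product induced by `g(x)` on the (complexified) cotangent space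
`T*_x M`, linear in the first variable. By `cometric_eq_dualForm` below, it may be computed in
any chart. -/
noncomputable def cometric (g : RoughMetric I M) (x : M)
    (α β : TangentSpace I x →L[ℝ] ℂ) : ℂ :=
  dualForm g x (stdFrame I x) α β

section Volume

variable [MeasurableSpace M]

/-- The measure `√(det g) dψ^*𝓛` on the domain of the chart `ψ = e.extend I`, extended by zero
to `M`. -/
noncomputable def chartVolume (g : RoughMetric I M) (e : OpenPartialHomeomorph M H) :
    Measure M :=
  ((chartLebesgue I e).withDensity fun z =>
    ENNReal.ofReal (√(gram g ((e.extend I).symm z) (coordVec I e z)).det)).map (e.extend I).symm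

/-- The Radon measure `μ_g`. The measures `√(det g) dψ^*𝓛` transform consistently under changes
of coordinates, that is, they are the restrictions of one measure to the chart domains; that
measure is therefore their supremum. -/
noncomputable def vol (g : RoughMetric I M) : Measure M :=
  ⨆ e ∈ IsManifold.maximalAtlas I ∞ M, chartVolume g e

end Volume

/-! ### Algebra of the scalar product on covectors -/

theorem gram_isSymm (g : RoughMetric I M) (x : M) (b : Fin n → TangentSpace I x) :
    (gram g x b).transpose = gram g x b := by
  ext i j
  exact g.symm x _ _

theorem cometric_add_left (g : RoughMetric I M) (x : M) (α β γ : TangentSpace I x →L[ℝ] ℂ) :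
    cometric g x (α + β) γ = cometric g x α γ + cometric g x β γ := by
  simp only [cometric, dualForm, _root_.add_apply, mul_add, add_mul,
    Finset.sum_add_distrib]

theorem cometric_smul_left (g : RoughMetric I M) (x : M) (c : ℂ)
    (α β : TangentSpace I x →L[ℝ] ℂ) :
    cometric g x (c • α) β = c * cometric g x α β := by
  simp only [cometric, dualForm, _root_.smul_apply, Finset.mul_sum, smul_eq_mul]
  refine Finset.sum_congr rfl fun i _ => Finset.sum_congr rfl fun j _ => ?_
  ring

theorem cometric_conj (g : RoughMetric I M) (x : M) (α β : TangentSpace I x →L[ℝ] ℂ) :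
    conj (cometric g x α β) = cometric g x β α := by
  have hs : ∀ i j, (gram g x (stdFrame I x))⁻¹ i j = (gram g x (stdFrame I x))⁻¹ j i := by
    intro i j
    have h : ((gram g x (stdFrame I x))⁻¹).transpose = (gram g x (stdFrame I x))⁻¹ := by
      rw [Matrix.transpose_nonsing_inv, gram_isSymm]
    exact (congrFun (congrFun h j) i)
  simp only [cometric, dualForm, map_sum, map_mul, Complex.conj_ofReal, Complex.conj_conj]
  rw [Finset.sum_comm]
  refine Finset.sum_congr rfl fun i _ => Finset.sum_congr rfl fun j _ => ?_
  rw [hs j i]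
  ring

theorem cometric_self_nonneg (g : RoughMetric I M) (x : M)
    (hx : (gram g x (stdFrame I x)).PosDef) (α : TangentSpace I x →L[ℝ] ℂ) :
    0 ≤ (cometric g x α α).re := by
  have h := hx.inv.posSemidef
  set h' := (gram g x (stdFrame I x))⁻¹ with hh'
  have key : (cometric g x α α).re =
      (∑ i, ∑ j, h' i j * (α (stdFrame I x i)).re * (α (stdFrame I x j)).re) +
      ∑ i, ∑ j, h' i j * (α (stdFrame I x i)).im * (α (stdFrame I x j)).im := by
    simp only [cometric, dualForm, Complex.re_sum, ← Finset.sum_add_distrib]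
    refine Finset.sum_congr rfl fun i _ => Finset.sum_congr rfl fun j _ => ?_
    simp
    ring
  have hq : ∀ v : Fin n → ℝ, 0 ≤ ∑ i, ∑ j, h' i j * v i * v j := by
    intro v
    have := h.dotProduct_mulVec_nonneg v
    simp only [dotProduct, Matrix.mulVec, Finset.mul_sum, star_trivial] at this
    refine this.trans_eq (Finset.sum_congr rfl fun i _ => Finset.sum_congr rfl fun j _ => ?_)
    ring
  rw [key]
  exact add_nonneg (hq _) (hq _)

theorem cometric_add_right (g : RoughMetric I M) (x : M) (α β γ : TangentSpace I x →L[ℝ] ℂ) :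
    cometric g x α (β + γ) = cometric g x α β + cometric g x α γ := by
  rw [← cometric_conj, cometric_add_left, map_add, cometric_conj, cometric_conj]

theorem cometric_smul_right (g : RoughMetric I M) (x : M) (c : ℂ)
    (α β : TangentSpace I x →L[ℝ] ℂ) :
    cometric g x α (c • β) = conj c * cometric g x α β := by
  rw [← cometric_conj, cometric_smul_left, map_mul, cometric_conj]

theorem two_re_cometric_le (g : RoughMetric I M) (x : M)
    (hx : (gram g x (stdFrame I x)).PosDef) (α β : TangentSpace I x →L[ℝ] ℂ) :
    2 * (cometric g x α β).re ≤ (cometric g x α α).re + (cometric g x β β).re := by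
  have h := cometric_self_nonneg g x hx (α + (-1 : ℂ) • β)
  have h2 : (cometric g x β α).re = (cometric g x α β).re := by
    rw [← cometric_conj g x α β, Complex.conj_re]
  simp only [cometric_add_left, cometric_add_right, cometric_smul_left, cometric_smul_right,
    Complex.add_re, map_neg, map_one, neg_mul, one_mul, Complex.neg_re] at h
  linarith

theorem cometric_add_self_le (g : RoughMetric I M) (x : M)
    (hx : (gram g x (stdFrame I x)).PosDef) (α β : TangentSpace I x →L[ℝ] ℂ) :
    (cometric g x (α + β) (α + β)).re ≤
      2 * (cometric g x α α).re + 2 * (cometric g x β β).re := by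
  have h := two_re_cometric_le g x hx α β
  have h2 : (cometric g x β α).re = (cometric g x α β).re := by
    rw [← cometric_conj g x α β, Complex.conj_re]
  simp only [cometric_add_left, cometric_add_right, Complex.add_re]
  linarith

theorem norm_cometric_le (g : RoughMetric I M) (x : M)
    (hx : (gram g x (stdFrame I x)).PosDef) (α β : TangentSpace I x →L[ℝ] ℂ) :
    ‖cometric g x α β‖ ≤ (cometric g x α α).re + (cometric g x β β).re := by
  have hα := cometric_self_nonneg g x hx α
  have hβ := cometric_self_nonneg g x hx β
  set w := cometric g x α β with hw
  by_cases h0 : w = 0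
  · rw [h0, norm_zero]; linarith
  have hn : (‖w‖ : ℂ) ≠ 0 := by simpa using h0
  set c : ℂ := conj w / ‖w‖ with hc
  have hcc : c * conj c = 1 := by
    rw [hc, map_div₀, Complex.conj_conj, Complex.conj_ofReal, div_mul_div_comm, mul_comm (conj w),
      Complex.mul_conj, Complex.normSq_eq_norm_sq]
    push_cast
    field_simp
  have h := two_re_cometric_le g x hx (c • α) β
  rw [cometric_smul_left, cometric_smul_left, cometric_smul_right, ← mul_assoc, hcc, one_mul,
    ← hw] at h
  have hcw : c * w = ‖w‖ := by
    rw [hc, div_mul_eq_mul_div, mul_comm, Complex.mul_conj, Complex.normSq_eq_norm_sq]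
    push_cast
    field_simp
  rw [hcw, Complex.ofReal_re] at h
  have := norm_nonneg w
  linarith

end Metric

/-! ### Change of chart, null sets, measurability -/

section Charts

variable {n : ℕ} {H : Type*} [TopologicalSpace H]
  {I : ModelWithCorners ℝ (EuclideanSpace ℝ (Fin n)) H}
  {M : Type*} [TopologicalSpace M] [ChartedSpace H M]

theorem measurableSet_target (e : OpenPartialHomeomorph M H) :
    MeasurableSet (e.extend I).target := by
  rw [OpenPartialHomeomorph.extend_target]
  exact (e.open_target.preimage I.continuous_symm).measurableSet.inter
    I.isClosed_range.measurableSet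

theorem extend_symm_mem (e : OpenPartialHomeomorph M H) {z : EuclideanSpace ℝ (Fin n)}
    (hz : z ∈ (e.extend I).target) : (e.extend I).symm z ∈ e.source := by
  rw [← OpenPartialHomeomorph.extend_source (I := I) e]
  exact (e.extend I).map_target hz

theorem coordDeriv_comp [IsManifold I ∞ M] {e : OpenPartialHomeomorph M H}
    (he : e ∈ IsManifold.maximalAtlas I ∞ M) {z : EuclideanSpace ℝ (Fin n)}
    (hz : z ∈ (e.extend I).target) (v : EuclideanSpace ℝ (Fin n)) :
    coordDeriv I e ((e.extend I).symm z)
      (mfderivWithin 𝓘(ℝ, EuclideanSpace ℝ (Fin n)) I (e.extend I).symm (range I) z v) = v := by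
  have hzr : z ∈ range I := e.extend_target_subset_range hz
  have U : UniqueMDiffWithinAt 𝓘(ℝ, EuclideanSpace ℝ (Fin n)) (range I) z := I.uniqueMDiffOn z hzr
  have hs := extend_symm_mem e hz
  have hnhds : (e.extend I).target ∈ 𝓝[range I] z := by
    have := e.extend_target_mem_nhdsWithin (I := I) hs
    rwa [(e.extend I).right_inv hz] at this
  have h1 : MDifferentiableAt I 𝓘(ℝ, EuclideanSpace ℝ (Fin n)) (e.extend I)
      ((e.extend I).symm z) :=
    (e.contMDiffAt_extend he hs).mdifferentiableAt (by simp)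
  have h2 : MDifferentiableWithinAt 𝓘(ℝ, EuclideanSpace ℝ (Fin n)) I (e.extend I).symm
      (range I) z := by
    have := (contMDiffOn_extend_symm he).mdifferentiableOn (by simp) z
      (by rw [← OpenPartialHomeomorph.extend_target']; exact hz)
    rw [← OpenPartialHomeomorph.extend_target'] at this
    exact this.mono_of_mem_nhdsWithin hnhds
  have h3 := mfderiv_comp_mfderivWithin z h1 h2 U
  have h4 : mfderivWithin 𝓘(ℝ, EuclideanSpace ℝ (Fin n)) 𝓘(ℝ, EuclideanSpace ℝ (Fin n))
      ((e.extend I) ∘ (e.extend I).symm) (range I) z = ContinuousLinearMap.id _ _ := by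
    rw [← mfderivWithin_id U]
    apply Filter.EventuallyEq.mfderivWithin_eq
    · filter_upwards [hnhds] with w hw
      simp only [Function.comp_def, PartialEquiv.right_inv (e.extend I) hw, id_eq]
    · simp only [Function.comp_def, PartialEquiv.right_inv (e.extend I) hz, id_eq]
  rw [h4] at h3
  exact (DFunLike.congr_fun h3 v).symm

theorem coordDeriv_injective [IsManifold I ∞ M] {e : OpenPartialHomeomorph M H}
    (he : e ∈ IsManifold.maximalAtlas I ∞ M) {z : EuclideanSpace ℝ (Fin n)}
    (hz : z ∈ (e.extend I).target) :
    Function.Injective (coordDeriv I e ((e.extend I).symm z)) := by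
  have hsurj : Function.Surjective (coordDeriv I e ((e.extend I).symm z)) :=
    fun v => ⟨_, coordDeriv_comp he hz v⟩
  have key : ∀ f : EuclideanSpace ℝ (Fin n) →ₗ[ℝ] EuclideanSpace ℝ (Fin n),
      Function.Surjective f → Function.Injective f :=
    fun f hf => LinearMap.injective_iff_surjective.2 hf
  exact key (coordDeriv I e ((e.extend I).symm z)).toLinearMap hsurj

/-- The matrix of the coordinate frame of a chart in the standard frame. -/
noncomputable def frameMatrix (I : ModelWithCorners ℝ (EuclideanSpace ℝ (Fin n)) H)
    (e : OpenPartialHomeomorph M H) (z : EuclideanSpace ℝ (Fin n)) :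
    Matrix (Fin n) (Fin n) ℝ :=
  Matrix.of fun k i => WithLp.ofLp (p := 2) (V := Fin n → ℝ) (coordVec I e z i) k

theorem coordVec_eq (e : OpenPartialHomeomorph M H) (z : EuclideanSpace ℝ (Fin n)) (i : Fin n) :
    coordVec I e z i = ∑ k, frameMatrix I e z k i • stdFrame I ((e.extend I).symm z) k := by
  have h := (EuclideanSpace.basisFun (Fin n) ℝ).sum_repr
    (coordVec I e z i : EuclideanSpace ℝ (Fin n))
  simp only [EuclideanSpace.basisFun_apply] at h
  exact h.symm

theorem isUnit_frameMatrix [IsManifold I ∞ M] {e : OpenPartialHomeomorph M H}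
    (he : e ∈ IsManifold.maximalAtlas I ∞ M) {z : EuclideanSpace ℝ (Fin n)}
    (hz : z ∈ (e.extend I).target) : IsUnit (frameMatrix I e z).det := by
  set A : Matrix (Fin n) (Fin n) ℝ := Matrix.of fun i k =>
    coordDeriv I e ((e.extend I).symm z) (stdFrame I _ k) i with hA
  have h : A * frameMatrix I e z = 1 := by
    ext i j
    have h1 := coordDeriv_comp he hz (EuclideanSpace.single j (1 : ℝ))
    change coordDeriv I e _ (coordVec I e z j) = _ at h1
    rw [coordVec_eq, map_sum] at h1
    have h2 := congrArg (fun w : EuclideanSpace ℝ (Fin n) => w i) h1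
    simp only [map_smul, WithLp.ofLp_sum, Finset.sum_apply, PiLp.smul_apply, smul_eq_mul] at h2
    rw [Matrix.mul_apply, Matrix.one_apply]
    simp only [PiLp.single_apply] at h2
    rw [← h2]
    refine Finset.sum_congr rfl fun k _ => ?_
    rw [mul_comm]
    rfl
  have := Matrix.isUnit_det_of_left_inverse h
  exact this

theorem gram_coordVec (g : RoughMetric I M) (e : OpenPartialHomeomorph M H)
    (z : EuclideanSpace ℝ (Fin n)) :
    gram g ((e.extend I).symm z) (coordVec I e z) =
      (frameMatrix I e z).transpose * gram g ((e.extend I).symm z) (stdFrame I _) *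
        frameMatrix I e z := by
  ext i j
  simp only [gram, Matrix.of_apply, Matrix.mul_apply, Matrix.transpose_apply]
  rw [coordVec_eq, coordVec_eq]
  simp only [map_sum, map_smul, _root_.sum_apply, _root_.smul_apply, smul_eq_mul,
    Finset.mul_sum, Finset.sum_mul]
  refine Finset.sum_congr rfl fun k _ => Finset.sum_congr rfl fun l _ => ?_
  ring

theorem dualForm_eq_dotProduct (g : RoughMetric I M) (x : M) (b : Fin n → TangentSpace I x)
    (α β : TangentSpace I x →L[ℝ] ℂ) :
    dualForm g x b α β = (fun i => α (b i)) ⬝ᵥ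
      Matrix.mulVec ((gram g x b)⁻¹.map Complex.ofReal) (fun j => conj (β (b j))) := by
  simp only [dualForm, dotProduct, Matrix.mulVec, Finset.mul_sum, Matrix.map_apply]
  refine Finset.sum_congr rfl fun i _ => Finset.sum_congr rfl fun j _ => ?_
  ring

/-- The scalar product on covectors can be computed in the coordinates of any chart. -/
theorem cometric_eq_dualForm [IsManifold I ∞ M] (g : RoughMetric I M)
    {e : OpenPartialHomeomorph M H}
    (he : e ∈ IsManifold.maximalAtlas I ∞ M) {z : EuclideanSpace ℝ (Fin n)}
    (hz : z ∈ (e.extend I).target)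
    (α β : TangentSpace I ((e.extend I).symm z) →L[ℝ] ℂ) :
    cometric g ((e.extend I).symm z) α β =
      dualForm g ((e.extend I).symm z) (coordVec I e z) α β := by
  set P := frameMatrix I e z with hP
  set PC : Matrix (Fin n) (Fin n) ℂ := P.map Complex.ofReal with hPC
  set G := gram g ((e.extend I).symm z) (stdFrame I _) with hG
  have hu : IsUnit P.det := isUnit_frameMatrix he hz
  have hc : ∀ (γ : TangentSpace I ((e.extend I).symm z) →L[ℝ] ℂ) (i : Fin n),
      γ (coordVec I e z i) = ∑ k, (P k i : ℂ) * γ (stdFrame I _ k) := by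
    intro γ i
    rw [coordVec_eq, map_sum]
    refine Finset.sum_congr rfl fun k _ => ?_
    rw [map_smul, Complex.real_smul]
  have hα : (fun i => α (coordVec I e z i)) =
      Matrix.mulVec PC.transpose (fun i => α (stdFrame I _ i)) := by
    funext i
    rw [hc]
    rfl
  have hβ : (fun i => conj (β (coordVec I e z i))) =
      Matrix.mulVec PC.transpose (fun i => conj (β (stdFrame I _ i))) := by
    funext i
    rw [hc, map_sum]
    simp only [map_mul, Complex.conj_ofReal]
    rfl
  rw [cometric, dualForm_eq_dotProduct, dualForm_eq_dotProduct, hα, hβ, gram_coordVec,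
    Matrix.mul_inv_rev, Matrix.mul_inv_rev, ← hG, ← hP]
  have h1 : P * P⁻¹ = 1 := Matrix.mul_nonsing_inv _ hu
  have h2 : P.transpose⁻¹ * P.transpose = 1 :=
    Matrix.nonsing_inv_mul _ (by rwa [Matrix.det_transpose])
  have key : PC * ((P⁻¹ * (G⁻¹ * P.transpose⁻¹)).map Complex.ofReal) * PC.transpose =
      G⁻¹.map Complex.ofReal := by
    have h3 : P * (P⁻¹ * (G⁻¹ * P.transpose⁻¹)) * P.transpose = G⁻¹ := by
      rw [← Matrix.mul_assoc, h1, Matrix.one_mul, Matrix.mul_assoc, h2, Matrix.mul_one]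
    have h4 := congrArg (fun A : Matrix (Fin n) (Fin n) ℝ => A.map Complex.ofRealHom) h3
    simp only [Matrix.map_mul] at h4
    rw [Matrix.transpose_map] at h4
    rw [← Matrix.map_mul, ← Matrix.map_mul] at h4
    exact h4
  rw [← key]
  rw [← Matrix.mulVec_mulVec, ← Matrix.mulVec_mulVec, Matrix.dotProduct_mulVec, Matrix.mulVec_transpose PC (fun i => α _)]
end Charts

section Null

variable {n : ℕ} {H : Type*} [TopologicalSpace H]
  {I : ModelWithCorners ℝ (EuclideanSpace ℝ (Fin n)) H}
  {M : Type*} [TopologicalSpace M] [ChartedSpace H M] [IsManifold I ∞ M]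

/-- Null sets are preserved under changes of charts. -/
theorem volume_chart_null {e e' : OpenPartialHomeomorph M H}
    (he : e ∈ IsManifold.maximalAtlas I ∞ M) (he' : e' ∈ IsManifold.maximalAtlas I ∞ M)
    {S : Set M} (hS : ∀ᵐ z ∂(chartLebesgue I e), (e.extend I).symm z ∉ S) :
    volume {z | z ∈ (e'.extend I).target ∧ (e'.extend I).symm z ∈ e.source ∧
      (e'.extend I).symm z ∈ S} = 0 := by
  rw [chartLebesgue, ae_restrict_iff' (measurableSet_target e), ae_iff] at hS
  set A := {z | z ∈ (e.extend I).target ∧ (e.extend I).symm z ∈ e'.source ∧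
    (e.extend I).symm z ∈ S} with hA
  have hA0 : volume A = 0 := by
    refine measure_mono_null ?_ hS
    rintro z ⟨h1, -, h3⟩
    rw [mem_ofPred_eq]
    exact fun h => h h1 h3
  have hd : DifferentiableOn ℝ (I.extendCoordChange e e') A := by
    refine ((I.contDiffOn_extendCoordChange he he').differentiableOn (by simp)).mono ?_
    rintro z ⟨h1, h2, -⟩
    simp only [ModelWithCorners.extendCoordChange, PartialEquiv.trans_source, mem_inter_iff,
      mem_preimage, PartialEquiv.symm_source, OpenPartialHomeomorph.extend_source]
    exact ⟨h1, h2⟩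
  refine measure_mono_null ?_
    (addHaar_image_eq_zero_of_differentiableOn_of_addHaar_eq_zero volume hd hA0)
  rintro w ⟨h1, h2, h3⟩
  have h4 : (e.extend I).symm (e.extend I ((e'.extend I).symm w)) = (e'.extend I).symm w :=
    e.extend_left_inv h2
  refine ⟨e.extend I ((e'.extend I).symm w), ⟨?_, ?_, ?_⟩, ?_⟩
  · refine (e.extend I).map_source ?_
    rwa [OpenPartialHomeomorph.extend_source]
  · rw [h4]; exact extend_symm_mem e' h1
  · rw [h4]; exact h3
  · change e'.extend I ((e.extend I).symm _) = w
    rw [h4, (e'.extend I).right_inv h1]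

/-- A property that holds almost everywhere in charts covering `M` holds off a Borel set which is
a null set in every chart. -/
theorem exists_null_superset [CompactSpace M] [MeasurableSpace M] [BorelSpace M] {P : M → Prop}
    (hP : ∀ x, ∃ e ∈ IsManifold.maximalAtlas I ∞ M, x ∈ e.source ∧
      ∀ᵐ z ∂(chartLebesgue I e), P ((e.extend I).symm z)) :
    ∃ T : Set M, MeasurableSet T ∧ (∀ x ∉ T, P x) ∧
      ∀ e ∈ IsManifold.maximalAtlas I ∞ M,
        ∀ᵐ z ∂(chartLebesgue I e), (e.extend I).symm z ∉ T := by
  choose c hc hxc hcP using hP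
  obtain ⟨t, ht⟩ := isCompact_univ.elim_finite_subcover (fun x => (c x).source)
    (fun x => (c x).open_source) (fun x _ => mem_iUnion.2 ⟨x, hxc x⟩)
  -- a Borel null set in the chart `c x` containing the exceptional points
  set B : M → Set (EuclideanSpace ℝ (Fin n)) := fun x =>
    toMeasurable volume {z | z ∈ ((c x).extend I).target ∧ ¬ P (((c x).extend I).symm z)} with hB
  have hB0 : ∀ x, volume (B x) = 0 := by
    intro x
    rw [hB, measure_toMeasurable]
    have := hcP x
    rw [chartLebesgue, ae_restrict_iff' (measurableSet_target (c x)), ae_iff] at this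
    refine measure_mono_null ?_ this
    rintro z ⟨h1, h2⟩
    rw [mem_ofPred_eq]
    exact fun h => h2 (h h1)
  set T : M → Set M := fun x => (c x).source ∩ (c x).extend I ⁻¹' B x with hT
  have hTm : ∀ x, MeasurableSet (T x) := by
    intro x
    have h1 : ContinuousOn ((c x).extend I) (c x).source := by
      have := (c x).continuousOn_extend (I := I)
      rwa [OpenPartialHomeomorph.extend_source] at this
    have h2 := h1.domRestrict.measurable (measurableSet_toMeasurable volume
      {z | z ∈ ((c x).extend I).target ∧ ¬ P (((c x).extend I).symm z)})
    have h3 := (MeasurableEmbedding.subtype_coe (c x).open_source.measurableSet).measurableSet_image'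
      h2
    convert! h3 using 1
    ext y
    simp [hT, hB, and_comm]
  have hTnull : ∀ x, ∀ e ∈ IsManifold.maximalAtlas I ∞ M,
      ∀ᵐ z ∂(chartLebesgue I e), (e.extend I).symm z ∉ T x := by
    intro x e he
    have h1 : ∀ᵐ z ∂(chartLebesgue I (c x)), ((c x).extend I).symm z ∉ T x := by
      rw [chartLebesgue, ae_restrict_iff' (measurableSet_target (c x)), ae_iff]
      refine measure_mono_null ?_ (hB0 x)
      intro z hz
      simp only [mem_ofPred_eq, Classical.not_imp, not_not] at hz
      have := hz.2.2
      rwa [mem_preimage, ((c x).extend I).right_inv hz.1] at this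
    have h2 := volume_chart_null (hc x) he h1
    rw [chartLebesgue, ae_restrict_iff' (measurableSet_target e), ae_iff]
    refine measure_mono_null ?_ h2
    intro z hz
    simp only [mem_ofPred_eq, Classical.not_imp, not_not] at hz
    exact ⟨hz.1, hz.2.1, hz.2⟩
  refine ⟨⋃ x ∈ t, T x, Finset.measurableSet_biUnion t fun x _ => hTm x, ?_, ?_⟩
  · intro y hy
    obtain ⟨x, hx, hyx⟩ := mem_iUnion₂.1 (ht (mem_univ y))
    by_contra hPy
    refine hy (mem_iUnion₂.2 ⟨x, hx, hyx, ?_⟩)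
    apply subset_toMeasurable
    refine ⟨((c x).extend I).map_source ?_, ?_⟩
    · rwa [OpenPartialHomeomorph.extend_source]
    · rwa [(c x).extend_left_inv hyx]
  · intro e he
    have := (Filter.eventually_all_finset t).2 fun x _ => hTnull x e he
    filter_upwards [this] with z hz
    simpa using hz

theorem aemeasurable_extend_symm [MeasurableSpace M] [BorelSpace M]
    (e : OpenPartialHomeomorph M H) : AEMeasurable (e.extend I).symm (chartLebesgue I e) :=
  (e.continuousOn_extend_symm).aemeasurable (measurableSet_target e)

/-- A property that holds almost everywhere in charts covering `M` holds `μ_g`-almost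
everywhere. -/
theorem ae_vol_of_charts [CompactSpace M] [MeasurableSpace M] [BorelSpace M]
    (g : RoughMetric I M) {P : M → Prop}
    (hP : ∀ x, ∃ e ∈ IsManifold.maximalAtlas I ∞ M, x ∈ e.source ∧
      ∀ᵐ z ∂(chartLebesgue I e), P ((e.extend I).symm z)) :
    ∀ᵐ x ∂(vol g), P x := by
  obtain ⟨T, hTm, hTP, hT⟩ := exists_null_superset hP
  have h0 : ∀ e ∈ IsManifold.maximalAtlas I ∞ M, chartVolume g e T = 0 := by
    intro e he
    have hac := withDensity_absolutelyContinuous (chartLebesgue I e) fun z =>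
      ENNReal.ofReal (√(gram g ((e.extend I).symm z) (coordVec I e z)).det)
    rw [chartVolume, Measure.map_apply_of_aemeasurable
      ((aemeasurable_extend_symm e).mono_ac hac) hTm]
    have h1 := hac.ae_le (hT e he)
    replace h1 := mem_ae_iff.1 h1
    refine measure_mono_null ?_ h1
    intro z hz
    simpa using hz
  have hle : vol g ≤ (vol g).restrict Tᶜ := by
    refine iSup₂_le fun e he => ?_
    have h1 : chartVolume g e = (chartVolume g e).restrict Tᶜ := by
      refine (Measure.restrict_eq_self_of_ae_mem ?_).symm
      rw [ae_iff]
      simpa using h0 e he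
    rw [h1]
    exact Measure.restrict_mono le_rfl (le_iSup₂ (f := fun e _ => chartVolume g e) e he)
  have h2 : vol g T = 0 := by
    refine le_antisymm ?_ zero_le
    calc vol g T ≤ (vol g).restrict Tᶜ T := hle T
      _ = 0 := by rw [Measure.restrict_apply hTm, inter_compl_self, measure_empty]
  rw [ae_iff]
  refine measure_mono_null ?_ h2
  intro x hx
  by_contra hxT
  exact hx (hTP x hxT)

theorem exists_chart_of_forall {Q : OpenPartialHomeomorph M H → Prop}
    (hQ : ∀ e ∈ IsManifold.maximalAtlas I ∞ M, Q e) (x : M) :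
    ∃ e ∈ IsManifold.maximalAtlas I ∞ M, x ∈ e.source ∧ Q e :=
  ⟨chartAt H x, IsManifold.chart_mem_maximalAtlas x, mem_chart_source H x,
    hQ _ (IsManifold.chart_mem_maximalAtlas x)⟩

/-- A function which is Lebesgue measurable in every chart is `μ_g`-measurable. -/
theorem aestronglyMeasurable_of_charts [CompactSpace M] [MeasurableSpace M] [BorelSpace M]
    (g : RoughMetric I M) {f : M → ℂ}
    (hf : ∀ e ∈ IsManifold.maximalAtlas I ∞ M,
      AEMeasurable (fun z => f ((e.extend I).symm z)) (chartLebesgue I e)) :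
    AEStronglyMeasurable f (vol g) := by
  obtain ⟨t, ht⟩ := isCompact_univ.elim_finite_subcover (fun x : M => (chartAt H x).source)
    (fun x => (chartAt H x).open_source) (fun x _ => mem_iUnion.2 ⟨x, mem_chart_source H x⟩)
  have hcov : (⋃ x : t, (chartAt H (x : M)).source) = univ := by
    refine eq_univ_of_forall fun y => ?_
    obtain ⟨x, hx, hy⟩ := mem_iUnion₂.1 (ht (mem_univ y))
    exact mem_iUnion.2 ⟨⟨x, hx⟩, hy⟩
  rw [← Measure.restrict_univ (μ := vol g), ← hcov, aestronglyMeasurable_iUnion_iff]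
  rintro ⟨x, hx⟩
  set e := chartAt H x with he
  have hem : e ∈ IsManifold.maximalAtlas I ∞ M := IsManifold.chart_mem_maximalAtlas x
  set h := (hf e hem).mk with hh
  have hhm : Measurable h := (hf e hem).measurable_mk
  have hc : ContinuousOn (e.extend I) e.source := by
    have := e.continuousOn_extend (I := I)
    rwa [OpenPartialHomeomorph.extend_source] at this
  have h1 : AEMeasurable (fun y => h (e.extend I y)) ((vol g).restrict e.source) :=
    hhm.comp_aemeasurable (hc.aemeasurable e.open_source.measurableSet)
  refine (h1.congr ?_).aestronglyMeasurable
  rw [Filter.EventuallyEq, ae_restrict_iff' e.open_source.measurableSet]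
  have hae : ∀ᵐ z ∂(chartLebesgue I e), ((e.extend I).symm z ∈ e.source →
      h (e.extend I ((e.extend I).symm z)) = f ((e.extend I).symm z)) := by
    have h2 := (hf e hem).ae_eq_mk
    have h3 : ∀ᵐ z ∂(chartLebesgue I e), z ∈ (e.extend I).target :=
      ae_restrict_mem (measurableSet_target e)
    filter_upwards [h2, h3] with z hz hz' _
    rw [(e.extend I).right_inv hz']
    exact hz.symm
  refine ae_vol_of_charts g (exists_chart_of_forall (I := I) fun e' he' => ?_)
  have h4 := volume_chart_null (S := {y | ¬ (y ∈ e.source → h (e.extend I y) = f y)}) hem he'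
    (by filter_upwards [hae] with z hz; simpa using hz)
  rw [chartLebesgue, ae_restrict_iff' (measurableSet_target e'), ae_iff]
  refine measure_mono_null ?_ h4
  intro z hz
  simp only [mem_ofPred_eq, Classical.not_imp] at hz ⊢
  exact ⟨hz.1, hz.2.1, hz.2⟩

/-- A rough metric is positive definite almost everywhere. -/
theorem ae_posDef [CompactSpace M] [MeasurableSpace M] [BorelSpace M] (g : RoughMetric I M) :
    ∀ᵐ x ∂(vol g), (gram g x (stdFrame I x)).PosDef := by
  refine ae_vol_of_charts g fun x => ?_
  obtain ⟨e, he, hx, C, hC, h⟩ := g.comparable x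
  refine ⟨e, he, hx, ?_⟩
  have h3 : ∀ᵐ z ∂(chartLebesgue I e), z ∈ (e.extend I).target :=
    ae_restrict_mem (measurableSet_target e)
  filter_upwards [h, h3] with z hz hzt
  have hpos : ∀ u : TangentSpace I ((e.extend I).symm z), u ≠ 0 →
      0 < g.toFun ((e.extend I).symm z) u u := by
    intro u hu
    by_contra hneg
    have h4 := (hz u).1
    rw [Real.sqrt_eq_zero_of_nonpos (not_lt.1 hneg)] at h4
    have h5 : coordDeriv I e ((e.extend I).symm z) u ≠ 0 := by
      intro h0
      exact hu (coordDeriv_injective he hzt (by rw [h0, map_zero]))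
    have h6 : 0 < C⁻¹ * ‖coordDeriv I e ((e.extend I).symm z) u‖ := by
      have := norm_pos_iff.2 h5
      positivity
    linarith
  refine Matrix.PosDef.of_dotProduct_mulVec_pos ?_ ?_
  · ext i j
    simp only [Matrix.conjTranspose_apply, star_trivial]
    exact g.symm _ _ _
  · intro v hv
    have h7 := hpos (∑ i, v i • stdFrame I _ i) (by
      intro h0
      apply hv
      funext k
      have h8 : (∑ i, v i • (EuclideanSpace.single i (1 : ℝ) : EuclideanSpace ℝ (Fin n))) = 0 := h0
      have h9 := congrArg (fun w : EuclideanSpace ℝ (Fin n) => w k) h8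
      simpa [PiLp.single_apply, Finset.sum_apply, Pi.single_apply] using h9)
    refine h7.trans_eq ?_
    simp only [map_sum, map_smul, _root_.sum_apply, _root_.smul_apply, smul_eq_mul,
      dotProduct, Matrix.mulVec, gram, Matrix.of_apply, star_trivial, Finset.mul_sum]
    rw [Finset.sum_comm]
    refine Finset.sum_congr rfl fun i _ => Finset.sum_congr rfl fun j _ => ?_
    ring

end Null

/-! ### The Hilbert space of square-integrable covector fields -/

section CovectorFields

variable {n : ℕ} {H : Type*} [TopologicalSpace H]
  {I : ModelWithCorners ℝ (EuclideanSpace ℝ (Fin n)) H}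
  {M : Type*} [TopologicalSpace M] [ChartedSpace H M]

/-- A complex covector field is measurable if its coefficients are Lebesgue measurable in every
chart. -/
def MeasurableCovectorField (I : ModelWithCorners ℝ (EuclideanSpace ℝ (Fin n)) H)
    (θ : ∀ x : M, TangentSpace I x →L[ℝ] ℂ) : Prop :=
  ∀ e ∈ IsManifold.maximalAtlas I ∞ M, ∀ i : Fin n,
    AEMeasurable (fun z => θ ((e.extend I).symm z) (coordVec I e z i)) (chartLebesgue I e)

/-- `θ` is measurable and `∫ |θ|²_g dμ_g < ∞`. -/
def SqIntegrable [MeasurableSpace M] (g : RoughMetric I M)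
    (θ : ∀ x : M, TangentSpace I x →L[ℝ] ℂ) : Prop :=
  MeasurableCovectorField I θ ∧
    ∫⁻ x, ENNReal.ofReal (cometric g x (θ x) (θ x)).re ∂(vol g) < (⊤ : ℝ≥0∞)

variable [IsManifold I ∞ M] [CompactSpace M] [MeasurableSpace M] [BorelSpace M]

theorem MeasurableCovectorField.add {θ η : ∀ x : M, TangentSpace I x →L[ℝ] ℂ}
    (hθ : MeasurableCovectorField I θ) (hη : MeasurableCovectorField I η) :
    MeasurableCovectorField I (θ + η) :=
  fun e he i => (hθ e he i).add (hη e he i)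

theorem MeasurableCovectorField.smul (c : ℂ) {θ : ∀ x : M, TangentSpace I x →L[ℝ] ℂ}
    (hθ : MeasurableCovectorField I θ) : MeasurableCovectorField I (c • θ) :=
  fun e he i => (hθ e he i).const_smul c

theorem aestronglyMeasurable_cometric (g : RoughMetric I M)
    {θ η : ∀ x : M, TangentSpace I x →L[ℝ] ℂ}
    (hθ : MeasurableCovectorField I θ) (hη : MeasurableCovectorField I η) :
    AEStronglyMeasurable (fun x => cometric g x (θ x) (η x)) (vol g) := by
  refine aestronglyMeasurable_of_charts g fun e he => ?_
  set G : EuclideanSpace ℝ (Fin n) → Fin n → Fin n → ℝ := fun z i j =>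
    g.toFun ((e.extend I).symm z) (coordVec I e z i) (coordVec I e z j) with hG
  have hGm : AEMeasurable G (chartLebesgue I e) :=
    aemeasurable_pi_lambda _ fun i => aemeasurable_pi_lambda _ fun j => g.measurable e he i j
  have hinv : ∀ i j, AEMeasurable (fun z => (Matrix.of (G z))⁻¹ i j) (chartLebesgue I e) := by
    intro i j
    have hd : Continuous fun A : Fin n → Fin n → ℝ => (Matrix.of A).det :=
      Continuous.matrix_det continuous_id
    have ha : Continuous fun A : Fin n → Fin n → ℝ => (Matrix.of A).adjugate i j :=
      (Continuous.matrix_adjugate continuous_id).matrix_elem i j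
    have h1 : Measurable fun A : Fin n → Fin n → ℝ => (Matrix.of A).det⁻¹ :=
      hd.measurable.inv
    have h2 : Measurable fun A : Fin n → Fin n → ℝ => (Matrix.of A).adjugate i j :=
      ha.measurable
    have h3 : (fun z => (Matrix.of (G z))⁻¹ i j) =
        (fun A : Fin n → Fin n → ℝ => (Matrix.of A).det⁻¹ * (Matrix.of A).adjugate i j) ∘ G := by
      funext z
      simp [Matrix.inv_def, Matrix.smul_apply]
    rw [h3]
    exact (h1.mul h2).comp_aemeasurable hGm
  have hsum : AEMeasurable (fun z => dualForm g ((e.extend I).symm z) (coordVec I e z)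
      (θ ((e.extend I).symm z)) (η ((e.extend I).symm z))) (chartLebesgue I e) := by
    refine Finset.aemeasurable_fun_sum _ fun i _ => Finset.aemeasurable_fun_sum _ fun j _ => ?_
    exact ((Complex.measurable_ofReal.comp_aemeasurable (hinv i j)).mul (hθ e he i)).mul
      (Complex.continuous_conj.measurable.comp_aemeasurable (hη e he j))
  refine hsum.congr ?_
  have h3 : ∀ᵐ z ∂(chartLebesgue I e), z ∈ (e.extend I).target :=
    ae_restrict_mem (measurableSet_target e)
  filter_upwards [h3] with z hz
  exact (cometric_eq_dualForm g he hz _ _).symm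

theorem SqIntegrable.integrable_self {g : RoughMetric I M}
    {θ : ∀ x : M, TangentSpace I x →L[ℝ] ℂ} (hθ : SqIntegrable g θ) :
    Integrable (fun x => (cometric g x (θ x) (θ x)).re) (vol g) := by
  refine ⟨Complex.continuous_re.comp_aestronglyMeasurable
    (aestronglyMeasurable_cometric g hθ.1 hθ.1), ?_⟩
  rw [hasFiniteIntegral_iff_ofReal]
  · exact hθ.2
  · filter_upwards [ae_posDef g] with x hx using cometric_self_nonneg g x hx _

theorem SqIntegrable.integrable {g : RoughMetric I M}
    {θ η : ∀ x : M, TangentSpace I x →L[ℝ] ℂ} (hθ : SqIntegrable g θ) (hη : SqIntegrable g η) :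
    Integrable (fun x => cometric g x (θ x) (η x)) (vol g) := by
  refine (hθ.integrable_self.add hη.integrable_self).mono'
    (aestronglyMeasurable_cometric g hθ.1 hη.1) ?_
  filter_upwards [ae_posDef g] with x hx using norm_cometric_le g x hx _ _

theorem sqIntegrable_of_integrable {g : RoughMetric I M}
    {θ : ∀ x : M, TangentSpace I x →L[ℝ] ℂ} (hθ : MeasurableCovectorField I θ)
    (h : Integrable (fun x => (cometric g x (θ x) (θ x)).re) (vol g)) : SqIntegrable g θ := by
  refine ⟨hθ, ?_⟩
  rw [← hasFiniteIntegral_iff_ofReal]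
  · exact h.2
  · filter_upwards [ae_posDef g] with x hx using cometric_self_nonneg g x hx _

theorem SqIntegrable.add {g : RoughMetric I M}
    {θ η : ∀ x : M, TangentSpace I x →L[ℝ] ℂ} (hθ : SqIntegrable g θ) (hη : SqIntegrable g η) :
    SqIntegrable g (θ + η) := by
  refine sqIntegrable_of_integrable (hθ.1.add hη.1) ?_
  refine ((hθ.integrable_self.const_mul 2).add (hη.integrable_self.const_mul 2)).mono'
    (Complex.continuous_re.comp_aestronglyMeasurable
      (aestronglyMeasurable_cometric g (hθ.1.add hη.1) (hθ.1.add hη.1))) ?_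
  filter_upwards [ae_posDef g] with x hx
  rw [Real.norm_of_nonneg (cometric_self_nonneg g x hx _)]
  exact cometric_add_self_le g x hx _ _

theorem SqIntegrable.smul {g : RoughMetric I M} (c : ℂ)
    {θ : ∀ x : M, TangentSpace I x →L[ℝ] ℂ} (hθ : SqIntegrable g θ) :
    SqIntegrable g (c • θ) := by
  refine sqIntegrable_of_integrable (hθ.1.smul c) ?_
  refine (hθ.integrable_self.const_mul (‖c‖ ^ 2)).congr (ae_of_all _ fun x => ?_)
  simp only [Pi.smul_apply]
  rw [cometric_smul_left, cometric_smul_right, ← mul_assoc, Complex.mul_conj,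
    Complex.normSq_eq_norm_sq, Complex.re_ofReal_mul]

theorem sqIntegrable_zero (g : RoughMetric I M) :
    SqIntegrable g (0 : ∀ x : M, TangentSpace I x →L[ℝ] ℂ) := by
  refine ⟨fun e he i => aemeasurable_const (b := (0 : ℂ)), ?_⟩
  simp [cometric, dualForm]

/-- The square-integrable covector fields, before identifying fields that agree almost
everywhere. -/
def sqIntegrableFields (g : RoughMetric I M) :
    Submodule ℂ (∀ x : M, TangentSpace I x →L[ℝ] ℂ) where
  carrier := {θ | SqIntegrable g θ}
  add_mem' hθ hη := SqIntegrable.add hθ hη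
  zero_mem' := sqIntegrable_zero g
  smul_mem' c _ hθ := SqIntegrable.smul c hθ

/-- The same space, as a type of its own (which carries the `L²` seminorm). -/
def PreL2Cotangent (g : RoughMetric I M) : Type _ := ↥(sqIntegrableFields g)

noncomputable instance (g : RoughMetric I M) : AddCommGroup (PreL2Cotangent g) :=
  inferInstanceAs (AddCommGroup ↥(sqIntegrableFields g))

noncomputable instance (g : RoughMetric I M) : Module ℂ (PreL2Cotangent g) :=
  inferInstanceAs (Module ℂ ↥(sqIntegrableFields g))

/-- The `L²` scalar product `(η, θ) = ∫ ⟨η, θ⟩_g dμ_g`. In Mathlib's convention `inner θ η` is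
conjugate-linear in `θ`, so that it denotes `(η, θ)`. -/
@[reducible] noncomputable def l2Core (g : RoughMetric I M) :
    PreInnerProductSpace.Core ℂ (PreL2Cotangent g) where
  inner θ η := ∫ x, cometric g x (η.1 x) (θ.1 x) ∂(vol g)
  conj_inner_symm θ η := by
    rw [← integral_conj]
    exact integral_congr_ae (ae_of_all _ fun x => cometric_conj g x _ _)
  re_inner_nonneg θ := by
    have h := SqIntegrable.integrable θ.2 θ.2
    have h2 : RCLike.re (∫ x, cometric g x (θ.1 x) (θ.1 x) ∂(vol g)) =
        ∫ x, RCLike.re (cometric g x (θ.1 x) (θ.1 x)) ∂(vol g) := (integral_re h).symm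
    rw [h2]
    refine integral_nonneg_of_ae ?_
    filter_upwards [ae_posDef g] with x hx using cometric_self_nonneg g x hx _
  add_left θ η κ := by
    rw [← integral_add (SqIntegrable.integrable κ.2 θ.2) (SqIntegrable.integrable κ.2 η.2)]
    exact integral_congr_ae (ae_of_all _ fun x => cometric_add_right g x _ _ _)
  smul_left θ η c := by
    rw [← integral_const_mul]
    exact integral_congr_ae (ae_of_all _ fun x => cometric_smul_right g x _ _ _)

noncomputable instance (g : RoughMetric I M) : SeminormedAddCommGroup (PreL2Cotangent g) :=
  @InnerProductSpace.Core.toSeminormedAddCommGroup ℂ _ _ _ _ (l2Core g)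

noncomputable instance (g : RoughMetric I M) : InnerProductSpace ℂ (PreL2Cotangent g) :=
  InnerProductSpace.ofCore (l2Core g)

/-- `L²(T*M, μ_g)`: square-integrable complex covector fields, two fields being identified if
their difference has norm zero, that is, if they agree `μ_g`-almost everywhere. -/
abbrev L2Cotangent (g : RoughMetric I M) : Type _ := SeparationQuotient (PreL2Cotangent g)

/-- The class in `L²(T*M, μ_g)` of a square-integrable covector field. -/
noncomputable def L2Cotangent.mk (g : RoughMetric I M)
    (θ : ∀ x : M, TangentSpace I x →L[ℝ] ℂ) (hθ : SqIntegrable g θ) : L2Cotangent g :=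
  SeparationQuotient.mk (⟨θ, hθ⟩ : ↥(sqIntegrableFields g))

theorem L2Cotangent.inner_mk (g : RoughMetric I M) {θ η : ∀ x : M, TangentSpace I x →L[ℝ] ℂ}
    (hθ : SqIntegrable g θ) (hη : SqIntegrable g η) :
    inner ℂ (L2Cotangent.mk g θ hθ) (L2Cotangent.mk g η hη) =
      ∫ x, cometric g x (η x) (θ x) ∂(vol g) :=
  rfl

/-! ### The differential, Sobolev spaces and the Laplacian -/

/-- `L²(M, μ_g)`, with complex-valued functions. -/
abbrev L2 (g : RoughMetric I M) : Type _ := Lp ℂ 2 (vol g)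

/-- The differential `dφ` of a complex-valued function. -/
noncomputable def differential (I : ModelWithCorners ℝ (EuclideanSpace ℝ (Fin n)) H)
    (φ : M → ℂ) (x : M) : TangentSpace I x →L[ℝ] ℂ :=
  mfderiv I 𝓘(ℝ, ℂ) φ x

theorem differential_add {φ ψ : M → ℂ} (hφ : ContMDiff I 𝓘(ℝ, ℂ) ∞ φ)
    (hψ : ContMDiff I 𝓘(ℝ, ℂ) ∞ ψ) :
    differential I (φ + ψ) = differential I φ + differential I ψ := by
  funext x
  exact mfderiv_add ((hφ x).mdifferentiableAt (by simp)) ((hψ x).mdifferentiableAt (by simp))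

theorem differential_smul (c : ℂ) {φ : M → ℂ} (hφ : ContMDiff I 𝓘(ℝ, ℂ) ∞ φ) :
    differential I (c • φ) = c • differential I φ := by
  funext x
  have h1 := ((hφ x).mdifferentiableAt (by simp)).hasMFDerivAt
  have h2 : HasMFDerivAt 𝓘(ℝ, ℂ) 𝓘(ℝ, ℂ) (fun w : ℂ => c • w) (φ x)
      (c • ContinuousLinearMap.id ℝ ℂ) :=
    ((hasFDerivAt_id (𝕜 := ℝ) (φ x)).const_smul c).hasMFDerivAt
  exact (h2.comp x h1).mfderiv

/-- The graph `{(φ, dφ)}` in `L²(M, μ_g) × L²(T*M, μ_g)` of the differential on the smooth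
functions `φ` with support in `p` such that `φ` and `dφ` are square-integrable. -/
noncomputable def smoothGraph (g : RoughMetric I M) (p : Set M) :
    Submodule ℂ (L2 g × L2Cotangent g) where
  carrier := {w | ∃ φ : M → ℂ, ContMDiff I 𝓘(ℝ, ℂ) ∞ φ ∧ tsupport φ ⊆ p ∧
    w.1 =ᵐ[vol g] φ ∧ ∃ h : SqIntegrable g (differential I φ),
      w.2 = L2Cotangent.mk g (differential I φ) h}
  zero_mem' := by
    have h0 : differential I (0 : M → ℂ) = 0 := by
      funext x
      exact mfderiv_const (c := (0 : ℂ))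
    refine ⟨0, contMDiff_const, ?_, Lp.coeFn_zero _ _ _, by rw [h0]; exact sqIntegrable_zero g, ?_⟩
    · simp [tsupport]
    · simp only [h0]
      rfl
  add_mem' := by
    rintro w w' ⟨φ, hφ, hp, hw, h, hw2⟩ ⟨ψ, hψ, hp', hw', h', hw2'⟩
    refine ⟨φ + ψ, hφ.add hψ, ?_, ?_, by rw [differential_add hφ hψ]; exact h.add h', ?_⟩
    · exact (tsupport_add φ ψ).trans (union_subset hp hp')
    · exact (Lp.coeFn_add w.1 w'.1).trans (hw.add hw')
    · simp only [differential_add hφ hψ, Prod.snd_add, hw2, hw2']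
      rfl
  smul_mem' := by
    rintro c w ⟨φ, hφ, hp, hw, h, hw2⟩
    have hc : ContMDiff I 𝓘(ℝ, ℂ) ∞ (c • φ) := by
      have : ContMDiff 𝓘(ℝ, ℂ) 𝓘(ℝ, ℂ) ∞ (fun w : ℂ => c • w) :=
        (contDiff_const_smul c).contMDiff
      exact this.comp hφ
    refine ⟨c • φ, hc, ?_, ?_, by rw [differential_smul c hφ]; exact h.smul c, ?_⟩
    · exact (closure_mono (Function.support_const_smul_subset c φ)).trans hp
    · exact (Lp.coeFn_smul c w.1).trans (hw.const_smul c)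
    · simp only [differential_smul c hφ, Prod.smul_snd, hw2]
      rfl

/-- The differential `∇₂` from `L²(M, μ_g)` to `L²(T*M, μ_g)`, defined on the smooth functions. -/
noncomputable def gradSmooth (g : RoughMetric I M) : L2 g →ₗ.[ℂ] L2Cotangent g :=
  (smoothGraph g univ).toLinearPMap

/-- Its restriction `∇_c` to the smooth functions with compact support in the interior of `M`
(a closed subset of the compact space `M` is compact). -/
noncomputable def gradCompact (g : RoughMetric I M) : L2 g →ₗ.[ℂ] L2Cotangent g :=
  (smoothGraph g (I.interior M)).toLinearPMap

/-- The closed operator `∇`, the closure of `∇₂`. -/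
noncomputable def grad (g : RoughMetric I M) : L2 g →ₗ.[ℂ] L2Cotangent g :=
  (gradSmooth g).closure

/-- `H¹(M)`, the domain of the closure of `∇₂`. -/
noncomputable def H1 (g : RoughMetric I M) : Submodule ℂ (L2 g) := (grad g).domain

/-- `H¹₀(M)`, the domain of the closure of `∇_c`. -/
noncomputable def H10 (g : RoughMetric I M) : Submodule ℂ (L2 g) :=
  (gradCompact g).closure.domain

/-- The norm `(‖u‖² + ‖∇u‖²)^{1/2}` of `H¹(M)`. -/
noncomputable def h1Norm (g : RoughMetric I M) (u : H1 g) : ℝ :=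
  √(‖(u : L2 g)‖ ^ 2 + ‖grad g u‖ ^ 2)

/-- An admissible boundary condition: a subspace `W` of `H¹(M)` that contains `H¹₀(M)` and is
closed in the norm of `H¹(M)`. -/
structure AdmissibleBC (g : RoughMetric I M) where
  /-- the subspace `W` -/
  W : Submodule ℂ (L2 g)
  H10_le : H10 g ≤ W
  le_H1 : W ≤ H1 g
  closed : ∀ (u : ℕ → H1 g) (v : H1 g), (∀ k, (u k : L2 g) ∈ W) →
    Tendsto (fun k => h1Norm g (u k - v)) atTop (𝓝 0) → (v : L2 g) ∈ W

/-- The Dirichlet form `𝓔_{g,W}[u,v] = (∇u, ∇v)` on `W`, linear in `u`. -/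
noncomputable def dirichletForm (g : RoughMetric I M) (B : AdmissibleBC g) (u v : B.W) : ℂ :=
  inner ℂ (grad g ⟨v, B.le_H1 v.2⟩) (grad g ⟨u, B.le_H1 u.2⟩)

theorem dirichletForm_add_left (g : RoughMetric I M) (B : AdmissibleBC g) (u u' v : B.W) :
    dirichletForm g B (u + u') v = dirichletForm g B u v + dirichletForm g B u' v := by
  simp only [dirichletForm]
  rw [← inner_add_right, ← LinearPMap.map_add]
  rfl

theorem dirichletForm_smul_left (g : RoughMetric I M) (B : AdmissibleBC g) (c : ℂ) (u v : B.W) :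
    dirichletForm g B (c • u) v = c * dirichletForm g B u v := by
  simp only [dirichletForm]
  rw [← inner_smul_right, ← LinearPMap.map_smul]
  rfl

/-- The graph of the Laplacian: the pairs `(u, f)` with `u ∈ W`, `f ∈ L²(M, μ_g)` and
`𝓔_{g,W}[u,v] = (f, v)` for all `v ∈ W`. -/
noncomputable def laplacianGraph (g : RoughMetric I M) (B : AdmissibleBC g) :
    Submodule ℂ (L2 g × L2 g) where
  carrier := {w | ∃ h : w.1 ∈ B.W, ∀ v : B.W,
    dirichletForm g B ⟨w.1, h⟩ v = inner ℂ (v : L2 g) w.2}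
  zero_mem' := by
    refine ⟨B.W.zero_mem, fun v => ?_⟩
    have h := dirichletForm_smul_left g B 0 0 v
    rw [zero_smul, zero_mul] at h
    rw [Prod.snd_zero, inner_zero_right]
    exact h
  add_mem' := by
    rintro w w' ⟨h, hw⟩ ⟨h', hw'⟩
    refine ⟨B.W.add_mem h h', fun v => ?_⟩
    rw [Prod.snd_add, inner_add_right, ← hw v, ← hw' v, ← dirichletForm_add_left]
    rfl
  smul_mem' := by
    rintro c w ⟨h, hw⟩
    refine ⟨B.W.smul_mem c h, fun v => ?_⟩
    rw [Prod.smul_snd, inner_smul_right, ← hw v, ← dirichletForm_smul_left]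
    rfl

/-- The Laplacian `Δ_{g,W}`, the operator associated with the Dirichlet form. -/
noncomputable def laplacian (g : RoughMetric I M) (B : AdmissibleBC g) : L2 g →ₗ.[ℂ] L2 g :=
  (laplacianGraph g B).toLinearPMap

end CovectorFields

/-! ### Spectra of unbounded operators -/

section Spectrum

variable {X : Type*} [NormedAddCommGroup X] [NormedSpace ℂ X]

/-- `ζ` is in the resolvent set of `T` if `ζ - T` has a bounded everywhere defined inverse `R`. -/
def unboundedResolventSet (T : X →ₗ.[ℂ] X) : Set ℂ :=
  {ζ | ∃ R : X →L[ℂ] X,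
    (∀ f : X, ∃ h : R f ∈ T.domain, ζ • R f - T ⟨R f, h⟩ = f) ∧
    ∀ u : T.domain, R (ζ • (u : X) - T u) = u}

/-- The spectrum of an unbounded operator. -/
def unboundedSpectrum (T : X →ₗ.[ℂ] X) : Set ℂ := (unboundedResolventSet T)ᶜ

/-- The eigenspace `{u ∈ D(T) : T u = ζ u}`. -/
def unboundedEigenspace (T : X →ₗ.[ℂ] X) (ζ : ℂ) : Submodule ℂ X where
  carrier := {u | ∃ h : u ∈ T.domain, T ⟨u, h⟩ = ζ • u}
  zero_mem' := ⟨T.domain.zero_mem, by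
    rw [smul_zero]
    exact T.map_zero⟩
  add_mem' := by
    rintro u v ⟨hu, hu'⟩ ⟨hv, hv'⟩
    refine ⟨T.domain.add_mem hu hv, ?_⟩
    rw [smul_add, ← hu', ← hv', ← LinearPMap.map_add]
    rfl
  smul_mem' := by
    rintro c u ⟨hu, hu'⟩
    refine ⟨T.domain.smul_mem c hu, ?_⟩
    rw [smul_comm, ← hu', ← LinearPMap.map_smul]
    rfl

/-- Purely discrete spectrum: every point of the spectrum is an isolated point of the spectrum
and an eigenvalue whose eigenspace is finite-dimensional. -/
def HasPurelyDiscreteSpectrum (T : X →ₗ.[ℂ] X) : Prop :=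
  ∀ ζ ∈ unboundedSpectrum T,
    (∃ U ∈ 𝓝 ζ, U ∩ unboundedSpectrum T = {ζ}) ∧
    unboundedEigenspace T ζ ≠ ⊥ ∧ FiniteDimensional ℂ (unboundedEigenspace T ζ)

end Spectrum

end RoughLaplacian

/-! Give `W` the norm of `H¹(M)` and let `j : W → L²(M, μ_g)` be the inclusion. Adding `(u, v)` to
both sides of `𝓔[u, v] = (f, v)` turns the definition of the Laplacian into `(u, v)_{H¹} = (f + u, j
v)` for all `v ∈ W`, that is, `u = j j* (f + u)`. Hence `K = j j*` is the inverse of `Δ + 1`. The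
operator `K` is symmetric, it is injective as soon as `j` has dense range, and it is compact as soon
as `j` is. The spectral theory of compact symmetric operators then yields every claim: points of the
spectrum of `Δ` come from eigenvalues `(ζ + 1)⁻¹` of `K`, and these cannot accumulate away from `0`.
This abstract part is `spectral_of_compact_form`.

Three analytic facts remain.

Completeness of `W`: the space `L²(T*M, μ_g)` is complete (`completeSpace_L2Cotangent`) and the
differential is closable (`snd_eq_zero_of_mem_closure_smoothGraph`). Closability comes from
integrating by parts against Lebesgue measure in a chart, so that the merely measurable coefficients
of `g` are never differentiated.

Density of the range of `j`: already `H¹₀(M)` is dense (`dense_H10`), because the boundary is a null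
set.

Compactness of `j`: it suffices that for every `ε > 0` the inequality `‖u‖² ≤ ε ‖∇u‖² + ∑ |(p_q,
u)|²` holds with finitely many `p_q ∈ L²` (`isCompactOperator_of_norm_sq_le`), because then `j` is a
norm limit of finite rank operators. The inequality (`exists_rellich`) follows by cutting chart
images into small cubes and applying the Poincaré inequality on each piece; the `p_q` are multiples
of indicator functions of the pieces.

The metric enters only through adapted charts (`IsAdapted`): the image is bounded and convex, and
`g` lies between `c⁻¹` and `c` times the Euclidean metric almost everywhere. Then `μ_g` is
comparable to Lebesgue measure and `|dφ|_g` to the Euclidean norm of the derivative, and finitely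
many such charts cover `M`. Convexity persists at the boundary, since a half-space intersected with
a ball or a cube is convex; no extension operator or partition of unity is needed for the
compactness of `j`. -/

namespace RoughLaplacian

set_option linter.unusedSectionVars false

/-! ### Operators whose shifted inverse is compact -/

section CompactResolvent

variable {X : Type*} [NormedAddCommGroup X] [InnerProductSpace ℂ X] {K : X →L[ℂ] X}
  {G : Submodule ℂ (X × X)}

/-- The condition `hG` says that `G` is the graph of `K⁻¹ - 1`. Injectivity of `K` makes `G`
single-valued, without which `toLinearPMap` would not have `G` as its graph. -/
theorem toLinearPMap_graph_of_shiftedInverse (hinj : ∀ x, K x = 0 → x = 0)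
    (hG : ∀ w : X × X, w ∈ G ↔ w.1 = K (w.2 + w.1)) : G.toLinearPMap.graph = G := by
  refine G.toLinearPMap_graph_eq ?_
  rintro ⟨u, f⟩ hw rfl
  have := (hG _).1 hw
  simp only [add_zero] at this
  exact hinj f this.symm

theorem mem_unboundedEigenspace_iff {T : X →ₗ.[ℂ] X} {ζ : ℂ} {u : X} :
    u ∈ unboundedEigenspace T ζ ↔ (u, ζ • u) ∈ T.graph := by
  rw [LinearPMap.mem_graph_iff]
  constructor
  · rintro ⟨h, hu⟩
    exact ⟨⟨u, h⟩, rfl, hu⟩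
  · rintro ⟨⟨y, hy⟩, rfl, h2⟩
    exact ⟨hy, h2⟩

theorem mem_unboundedEigenspace_of_shiftedInverse (hinj : ∀ x, K x = 0 → x = 0)
    (hG : ∀ w : X × X, w ∈ G ↔ w.1 = K (w.2 + w.1)) {ζ : ℂ} {u : X} :
    u ∈ unboundedEigenspace G.toLinearPMap ζ ↔ u = (ζ + 1) • K u := by
  rw [mem_unboundedEigenspace_iff, toLinearPMap_graph_of_shiftedInverse hinj hG, hG]
  simp only [map_add, map_smul, add_smul, one_smul]

/-- With `T = K⁻¹ - 1` one has `ζ - T = -(1 - (ζ + 1) K) K⁻¹`. If `S` inverts `1 - (ζ + 1) K`, it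
commutes with `K`, and the resolvent is `-K S = -S K`. -/
theorem mem_unboundedResolventSet_of_shiftedInverse (hinj : ∀ x, K x = 0 → x = 0)
    (hG : ∀ w : X × X, w ∈ G ↔ w.1 = K (w.2 + w.1)) {ζ : ℂ} {S : X →L[ℂ] X}
    (h1 : ∀ x, S x - (ζ + 1) • K (S x) = x) (h2 : ∀ x, S (x - (ζ + 1) • K x) = x) :
    ζ ∈ unboundedResolventSet G.toLinearPMap := by
  have hgr := toLinearPMap_graph_of_shiftedInverse hinj hG
  refine ⟨-(S ∘L K), fun f => ?_, fun u => ?_⟩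
  · set r : X := -(S (K f)) with hr
    have hrG : (r, ζ • r - f) ∈ G.toLinearPMap.graph := by
      rw [hgr, hG]
      have := h1 (K f)
      simp only [map_add, map_sub, map_smul, hr, map_neg, smul_neg, add_smul, one_smul] at this ⊢
      linear_combination (norm := module) -this
    obtain ⟨⟨y, hy⟩, hy1, hy2⟩ := (LinearPMap.mem_graph_iff _).1 hrG
    simp only at hy1 hy2
    subst hy1
    refine ⟨hy, ?_⟩
    change ζ • r - _ = f
    have : G.toLinearPMap ⟨(-(S ∘L K)) f, hy⟩ = ζ • r - f := hy2
    rw [this]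
    abel
  · have hu := LinearPMap.mem_graph G.toLinearPMap u
    rw [hgr, hG] at hu
    simp only at hu
    have h3 := h2 (u : X)
    change -(S (K (ζ • (u : X) - G.toLinearPMap u))) = u
    rw [← map_neg]
    convert h3 using 2
    rw [map_add] at hu
    simp only [map_sub, map_smul, add_smul, one_smul]
    linear_combination (norm := module) -hu

variable [CompleteSpace X]

/-- The domain is the range of `K`, which is dense because its orthogonal complement is the kernel
of the symmetric operator `K`. A pair `(x, y)` in the graph of the adjoint, tested against the
elements `(K k, k - K k)` of `G`, satisfies `x = K (y + x)`, so it lies in `G`. -/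
theorem isSelfAdjoint_of_shiftedInverse (hsa : ∀ x y, inner ℂ (K x) y = inner ℂ x (K y))
    (hinj : ∀ x, K x = 0 → x = 0)
    (hG : ∀ w : X × X, w ∈ G ↔ w.1 = K (w.2 + w.1)) : IsSelfAdjoint G.toLinearPMap := by
  have hgr := toLinearPMap_graph_of_shiftedInverse hinj hG
  have hdom : ∀ h : X, K h ∈ G.toLinearPMap.domain := by
    intro h
    rw [Submodule.toLinearPMap_domain]
    exact ⟨(K h, h - K h), by simp [hG], rfl⟩
  have hd : Dense (G.toLinearPMap.domain : Set X) := by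
    rw [Submodule.dense_iff_topologicalClosure_eq_top,
      Submodule.topologicalClosure_eq_top_iff, Submodule.eq_bot_iff]
    intro x hx
    refine hinj x (ext_inner_left ℂ fun y => ?_)
    rw [← hsa, inner_zero_right]
    exact (Submodule.mem_orthogonal _ _).1 hx _ (hdom y)
  rw [LinearPMap.isSelfAdjoint_def]
  refine LinearPMap.eq_of_eq_graph ?_
  rw [LinearPMap.adjoint_graph_eq_graph_adjoint hd, hgr]
  ext ⟨x, y⟩
  rw [Submodule.mem_adjoint_iff, hG]
  constructor
  · intro h
    refine ext_inner_left ℂ fun k => ?_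
    have := h (K k) (k - K k) (by simp [hG])
    simp only [inner_sub_left, hsa] at this
    simp only [map_add, inner_add_right]
    linear_combination this
  · intro h a b hab
    have hab' := (hG _).1 hab
    simp only at hab' h ⊢
    have h1 : K b = a - K a := by
      rw [map_add] at hab'
      linear_combination (norm := module) -hab'
    have h2 : inner ℂ b x = inner ℂ (K b) (y + x) := by rw [hsa, ← h]
    rw [h2, h1, inner_sub_left, hsa a, ← h, inner_add_right]
    ring

/-- Fredholm alternative for `K`: since `1 - (ζ + 1) K = (ζ + 1) ((ζ + 1)⁻¹ - K)`, invertibility of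
the last factor would put `ζ` in the resolvent set. For `ζ = -1` the operator `1 - (ζ + 1) K` is the
identity, so `-1` is never in the spectrum. -/
theorem hasEigenvalue_of_mem_unboundedSpectrum (hK : IsCompactOperator K)
    (hinj : ∀ x, K x = 0 → x = 0) (hG : ∀ w : X × X, w ∈ G ↔ w.1 = K (w.2 + w.1)) {ζ : ℂ}
    (hζ : ζ ∈ unboundedSpectrum G.toLinearPMap) :
    ζ + 1 ≠ 0 ∧ Module.End.HasEigenvalue (K : Module.End ℂ X) (ζ + 1)⁻¹ := by
  have h0 : ζ + 1 ≠ 0 := by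
    intro h0
    exact hζ (mem_unboundedResolventSet_of_shiftedInverse hinj hG
      (S := ContinuousLinearMap.id ℂ X) (by simp [h0]) (by simp [h0]))
  refine ⟨h0, (hK.hasEigenvalue_or_mem_resolventSet (inv_ne_zero h0)).resolve_right fun hr => ?_⟩
  obtain ⟨U, hU⟩ := spectrum.mem_resolventSet_iff.1 hr
  have hUx : ∀ x, (U : X →L[ℂ] X) x = (ζ + 1)⁻¹ • x - K x := by
    intro x
    rw [hU]
    simp [Algebra.algebraMap_eq_smul_one]
  have hfac : ∀ x, x - (ζ + 1) • K x = (ζ + 1) • (U : X →L[ℂ] X) x := by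
    intro x
    rw [hUx, smul_sub, smul_inv_smul₀ h0]
  refine hζ (mem_unboundedResolventSet_of_shiftedInverse hinj hG
    (S := (ζ + 1)⁻¹ • ((U⁻¹ : (X →L[ℂ] X)ˣ) : X →L[ℂ] X)) (fun x => ?_) fun x => ?_)
  · rw [hfac, _root_.smul_apply, map_smul, smul_inv_smul₀ h0]
    change ((U : X →L[ℂ] X) * ((U⁻¹ : (X →L[ℂ] X)ˣ) : X →L[ℂ] X)) x = x
    rw [Units.mul_inv]; rfl
  · rw [hfac, _root_.smul_apply, map_smul, inv_smul_smul₀ h0]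
    change (((U⁻¹ : (X →L[ℂ] X)ˣ) : X →L[ℂ] X) * (U : X →L[ℂ] X)) x = x
    rw [Units.inv_mul]; rfl

/-- On the eigenspace the identity coincides with the compact operator `(ζ + 1) K`, and a complete
space with compact identity is finite-dimensional. -/
theorem finiteDimensional_unboundedEigenspace (hK : IsCompactOperator K)
    (hinj : ∀ x, K x = 0 → x = 0) (hG : ∀ w : X × X, w ∈ G ↔ w.1 = K (w.2 + w.1)) (ζ : ℂ) :
    FiniteDimensional ℂ (unboundedEigenspace G.toLinearPMap ζ) := by
  set E := unboundedEigenspace G.toLinearPMap ζ with hE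
  have hmem : ∀ u, u ∈ E ↔ u = (ζ + 1) • K u := fun u =>
    mem_unboundedEigenspace_of_shiftedInverse hinj hG
  have hcl : IsClosed (E : Set X) := by
    have : (E : Set X) = {u | u = (ζ + 1) • K u} := by ext u; exact hmem u
    rw [this]
    exact isClosed_eq continuous_id (K.continuous.const_smul _)
  have : CompleteSpace E := hcl.completeSpace_coe
  have hc : IsCompactOperator fun u : X => (ζ + 1) • K u := hK.smul (ζ + 1)
  have hc2 : IsCompactOperator fun u : E => (ζ + 1) • K (u : X) := hc.comp_clm E.subtypeL
  have hc3 := hc2.codRestrict (V := E) (fun u => by rw [← (hmem u).1 u.2]; exact u.2) hcl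
  refine FiniteDimensional.of_isCompactOperator_id (𝕜 := ℂ) (E := E) ?_
  have hid : (id : E → E) = Set.codRestrict (fun u : E => (ζ + 1) • K (u : X)) E
      (fun u => by rw [← (hmem u).1 u.2]; exact u.2) :=
    funext fun u => Subtype.ext ((hmem u).1 u.2)
  rw [hid]
  exact hc3

/-- Infinitely many points `z k` of the spectrum in the unit ball around `ζ` would give orthonormal
eigenvectors `u k` of `K`. The vectors `K (u k)` are orthogonal and of norm `|z k + 1|⁻¹ ≥ (|ζ| +
2)⁻¹`, so they stay a fixed distance apart, although they lie in a compact set. -/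
theorem not_accPt_unboundedSpectrum (hK : IsCompactOperator K)
    (hsa : ∀ x y, inner ℂ (K x) y = inner ℂ x (K y))
    (hinj : ∀ x, K x = 0 → x = 0) (hG : ∀ w : X × X, w ∈ G ↔ w.1 = K (w.2 + w.1)) (ζ : ℂ) :
    ¬ AccPt ζ (𝓟 (unboundedSpectrum G.toLinearPMap)) := by
  intro hacc
  set S := unboundedSpectrum G.toLinearPMap with hS
  have hinf : (Metric.ball ζ 1 ∩ S).Infinite :=
    .of_accPt (hacc.nhds_inter (Metric.ball_mem_nhds ζ one_pos))
  set z : ℕ → ℂ := fun k => (hinf.natEmbedding _ k : ℂ) with hz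
  have hzi : Function.Injective z := Subtype.val_injective.comp (hinf.natEmbedding _).injective
  have hzm : ∀ k, z k ∈ Metric.ball ζ 1 ∩ S := fun k => (hinf.natEmbedding _ k).2
  have hev := fun k => hasEigenvalue_of_mem_unboundedSpectrum hK hinj hG (hzm k).2
  have hsym : (K : X →ₗ[ℂ] X).IsSymmetric := hsa
  have hu : ∀ k, ∃ u : X, ‖u‖ = 1 ∧ K u = (z k + 1)⁻¹ • u := by
    intro k
    obtain ⟨v, hv⟩ := (hev k).2.exists_hasEigenvector
    have hv0 : ‖v‖ ≠ 0 := norm_ne_zero_iff.2 hv.2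
    have hKv : K v = (z k + 1)⁻¹ • v := hv.apply_eq_smul
    refine ⟨((‖v‖ : ℂ)⁻¹) • v, ?_, ?_⟩
    · rw [norm_smul, norm_inv, Complex.norm_real, norm_norm, inv_mul_cancel₀ hv0]
    · rw [map_smul, hKv, smul_comm]
  choose u hu1 hu2 using hu
  have horth : ∀ k l, k ≠ l → inner ℂ (u k) (u l) = 0 := by
    intro k l hkl
    have hne : (z k + 1)⁻¹ ≠ (z l + 1)⁻¹ := fun h =>
      hkl (hzi (add_right_cancel (inv_injective h)))
    exact hsym.orthogonalFamily_eigenspaces hne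
      ⟨u k, Module.End.mem_eigenspace_iff.2 (hu2 k)⟩ ⟨u l, Module.End.mem_eigenspace_iff.2 (hu2 l)⟩
  set c : ℝ := (‖ζ‖ + 2)⁻¹ with hc
  have hcpos : 0 < c := by positivity
  have hKu : ∀ k, c ≤ ‖K (u k)‖ := by
    intro k
    rw [hu2, norm_smul, hu1, mul_one, norm_inv]
    refine inv_anti₀ (norm_pos_iff.2 (hev k).1) ?_
    have h1 : ‖z k - ζ‖ < 1 := by simpa [dist_eq_norm] using (hzm k).1
    calc ‖z k + 1‖ = ‖(z k - ζ) + ζ + 1‖ := by ring_nf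
      _ ≤ ‖z k - ζ‖ + ‖ζ‖ + ‖(1 : ℂ)‖ := norm_add₃_le
      _ ≤ ‖ζ‖ + 2 := by rw [norm_one]; linarith
  have hsep : ∀ k l, k ≠ l → c ≤ ‖K (u k) - K (u l)‖ := by
    intro k l hkl
    have h0 : inner ℂ (K (u k)) (K (u l)) = 0 := by
      rw [hu2, hu2, inner_smul_left, inner_smul_right, horth k l hkl]
      simp
    have h1 := @norm_sub_sq ℂ X _ _ _ (K (u k)) (K (u l))
    rw [h0, map_zero, mul_zero, sub_zero] at h1
    refine le_of_sq_le_sq ?_ (norm_nonneg _)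
    rw [h1]
    nlinarith [hKu k, sq_nonneg ‖K (u l)‖, norm_nonneg (K (u k))]
  obtain ⟨C, hC, hC'⟩ := hK.image_closedBall_subset_compact 1
  obtain ⟨y, hyC, ψ, hψ, hψy⟩ := hC.tendsto_subseq fun k => hC' ⟨u k, by simp [hu1], rfl⟩
  have hcau := hψy.cauchySeq
  rw [Metric.cauchySeq_iff'] at hcau
  obtain ⟨N, hN⟩ := hcau c hcpos
  have h1 := hN (N + 1) (Nat.le_succ N)
  rw [dist_eq_norm] at h1
  exact absurd (hsep _ _ (hψ.injective.ne (Nat.succ_ne_self N))) (not_le.2 h1)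

theorem hasPurelyDiscreteSpectrum_of_shiftedInverse (hK : IsCompactOperator K)
    (hsa : ∀ x y, inner ℂ (K x) y = inner ℂ x (K y))
    (hinj : ∀ x, K x = 0 → x = 0) (hG : ∀ w : X × X, w ∈ G ↔ w.1 = K (w.2 + w.1)) :
    HasPurelyDiscreteSpectrum G.toLinearPMap := by
  intro ζ hζ
  refine ⟨?_, ?_, finiteDimensional_unboundedEigenspace hK hinj hG ζ⟩
  · have h := not_accPt_unboundedSpectrum hK hsa hinj hG ζ
    rw [accPt_iff_nhds] at h
    push Not at h
    obtain ⟨U, hU, h⟩ := h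
    refine ⟨U, hU, Subset.antisymm (fun y hy => h y hy) ?_⟩
    rintro _ rfl
    exact ⟨mem_of_mem_nhds hU, hζ⟩
  · obtain ⟨h0, hev⟩ := hasEigenvalue_of_mem_unboundedSpectrum hK hinj hG hζ
    obtain ⟨v, hv⟩ := hev.exists_hasEigenvector
    have hKv : K v = (ζ + 1)⁻¹ • v := hv.apply_eq_smul
    refine (Submodule.ne_bot_iff _).2 ⟨v, ?_, hv.2⟩
    rw [mem_unboundedEigenspace_of_shiftedInverse hinj hG, hKv, smul_inv_smul₀ h0]

end CompactResolvent

/-! ### Forms with compactly and densely embedded domain. -/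

section FormEmbedding

variable {X V : Type*} [NormedAddCommGroup X] [InnerProductSpace ℂ X]
  [NormedAddCommGroup V] [InnerProductSpace ℂ V]

/-- An operator that is bounded by an arbitrarily small multiple of the norm, up to finitely many
linear functionals, is compact. -/
theorem isCompactOperator_of_norm_sq_le [CompleteSpace V] [CompleteSpace X] (j : V →L[ℂ] X)
    (h : ∀ ε : ℝ, 0 < ε → ∃ (ι : Type) (_ : Fintype ι) (p : ι → X), ∀ v : V,
      ‖j v‖ ^ 2 ≤ ε * ‖v‖ ^ 2 + ∑ q, ‖(inner ℂ (p q) (j v) : ℂ)‖ ^ 2) : IsCompactOperator j := by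
  have hcl := isClosed_setOfPred_isCompactOperator (σ₁₂ := RingHom.id ℂ) (M₁ := V) (M₂ := X)
  refine hcl.closure_subset (Metric.mem_closure_iff.2 fun ε hε => ?_)
  -- The inequality concerns squares, and `ε / 2` leaves room for the strict bound on the distance.
  obtain ⟨ι, _, p, hp⟩ := h ((ε / 2) ^ 2) (by positivity)
  -- On the orthogonal complement of `F` all functionals `v ↦ (p q, j v)` vanish, so there `‖j w‖ ≤
  -- (ε / 2) ‖w‖`. Hence the finite rank operator obtained by projecting onto `F` first is within `ε
  -- / 2` of `j`.
  set F := Submodule.span ℂ (Set.range fun q => ContinuousLinearMap.adjoint j (p q)) with hF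
  have : FiniteDimensional ℂ F := FiniteDimensional.span_of_finite ℂ (finite_range _)
  refine ⟨j ∘L F.starProjection, ?_, ?_⟩
  · have hcF : IsCompactOperator (j ∘L F.subtypeL) :=
      (isCompactOperator_id.clm_comp (j ∘L F.subtypeL) :)
    exact hcF.comp_clm F.orthogonalProjectionOnto
  · rw [dist_eq_norm]
    refine lt_of_le_of_lt (ContinuousLinearMap.opNorm_le_bound _ (by positivity : 0 ≤ ε / 2)
      fun v => ?_) (half_lt_self hε)
    set w := v - F.starProjection v with hw
    have hjw : (j - j ∘L F.starProjection) v = j w := by simp [hw]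
    rw [hjw]
    have hwF : w ∈ Fᗮ := F.sub_starProjection_mem_orthogonal v
    have h0 : ∀ q, (inner ℂ (p q) (j w) : ℂ) = 0 := by
      intro q
      rw [← ContinuousLinearMap.adjoint_inner_left]
      exact (Submodule.mem_orthogonal _ _).1 hwF _ (Submodule.subset_span ⟨q, rfl⟩)
    have h1 := hp w
    simp only [h0, norm_zero, ne_eq, OfNat.ofNat_ne_zero, not_false_eq_true, zero_pow,
      Finset.sum_const_zero, add_zero, ← mul_pow] at h1
    have h2 : ‖w‖ ≤ ‖v‖ := by
      have := F.norm_sq_eq_add_norm_sq_starProjection v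
      rw [F.starProjection_orthogonal_val] at this
      refine le_of_sq_le_sq ?_ (norm_nonneg _)
      nlinarith [sq_nonneg ‖F.starProjection v‖]
    exact (le_of_sq_le_sq h1 (by positivity)).trans (by gcongr)

/-- The spectral theory of the operator associated with a form whose domain `V` is compactly and
densely embedded. -/
theorem spectral_of_compact_form [CompleteSpace V] [CompleteSpace X] {j : V →L[ℂ] X}
    (hj : IsCompactOperator j) (hd : DenseRange j) {G : Submodule ℂ (X × X)}
    (hG : ∀ w : X × X, w ∈ G ↔
      ∃ v, j v = w.1 ∧ ∀ v', (inner ℂ v' v : ℂ) = inner ℂ (j v') (w.2 + w.1)) :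
    IsSelfAdjoint G.toLinearPMap ∧ HasPurelyDiscreteSpectrum G.toLinearPMap ∧
    (∀ ζ : ℂ, ¬ AccPt ζ (𝓟 (unboundedSpectrum G.toLinearPMap))) ∧
    ∀ ζ : ℂ, FiniteDimensional ℂ (unboundedEigenspace G.toLinearPMap ζ) := by
  -- In `hG` the vector `v` is the Riesz representative of `v' ↦ (j v', w.2 + w.1)`, that is, `v =
  -- j* (w.2 + w.1)`. So `w ∈ G` means `w.1 = j j* (w.2 + w.1)`.
  set K : X →L[ℂ] X := j ∘L ContinuousLinearMap.adjoint j with hKdef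
  have hK : IsCompactOperator K := hj.comp_clm (ContinuousLinearMap.adjoint j)
  have hKin : ∀ x y, inner ℂ (K x) y =
      inner ℂ (ContinuousLinearMap.adjoint j x) (ContinuousLinearMap.adjoint j y) := fun x y =>
    (ContinuousLinearMap.adjoint_inner_right j _ _).symm
  have hsa : ∀ x y, inner ℂ (K x) y = inner ℂ x (K y) := fun x y => by
    rw [hKin, ContinuousLinearMap.adjoint_inner_left]
    rfl
  have hinj : ∀ x, K x = 0 → x = 0 := by
    intro x hx
    have h0 : ContinuousLinearMap.adjoint j x = 0 := by
      rw [← inner_self_eq_zero (𝕜 := ℂ), ← hKin, hx, inner_zero_left]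
    refine hd.eq_zero_of_inner_left ℂ fun v => ?_
    rw [← ContinuousLinearMap.adjoint_inner_left, h0, inner_zero_left]
  have hGK : ∀ w : X × X, w ∈ G ↔ w.1 = K (w.2 + w.1) := by
    intro w
    rw [hG]
    constructor
    · rintro ⟨v, hv, h⟩
      have : v = ContinuousLinearMap.adjoint j (w.2 + w.1) := ext_inner_left ℂ fun v' => by
        rw [h, ContinuousLinearMap.adjoint_inner_right]
      exact hv.symm.trans (congrArg j this)
    · intro h
      exact ⟨_, h.symm, fun v' => ContinuousLinearMap.adjoint_inner_right _ _ _⟩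
  exact ⟨isSelfAdjoint_of_shiftedInverse hsa hinj hGK,
    hasPurelyDiscreteSpectrum_of_shiftedInverse hK hsa hinj hGK,
    not_accPt_unboundedSpectrum hK hsa hinj hGK,
    finiteDimensional_unboundedEigenspace hK hinj hGK⟩

end FormEmbedding

/-! ### The Poincaré inequality on convex sets -/

section Poincare

theorem sq_lintegral_le {α : Type*} [MeasurableSpace α] {μ : Measure α} {h : α → ℝ≥0∞}
    (hh : AEMeasurable h μ) : (∫⁻ x, h x ∂μ) ^ 2 ≤ μ univ * ∫⁻ x, h x ^ 2 ∂μ := by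
  have h1 := ENNReal.lintegral_mul_le_Lp_mul_Lq μ Real.HolderConjugate.two_two
    (aemeasurable_const (b := (1 : ℝ≥0∞))) hh
  simp only [Pi.mul_apply, one_mul, lintegral_const, ENNReal.rpow_two, one_pow] at h1
  calc (∫⁻ x, h x ∂μ) ^ 2
      ≤ ((μ univ) ^ (1 / 2 : ℝ) * (∫⁻ x, h x ^ 2 ∂μ) ^ (1 / 2 : ℝ)) ^ 2 := by gcongr
    _ = _ := by
      rw [mul_pow, ← ENNReal.rpow_two, ← ENNReal.rpow_two, ← ENNReal.rpow_mul,
        ← ENNReal.rpow_mul]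
      norm_num

variable {E : Type*} [NormedAddCommGroup E] [NormedSpace ℝ E] 

/-- Fundamental theorem of calculus along the segment, which convexity keeps inside `Q`, followed by
Cauchy–Schwarz in `t`. Derivatives are taken within `Q`, so that `Q` may touch the boundary of a
chart image. -/
theorem enorm_sub_sq_le_lintegral_segment {Q : Set E} (hQ : Convex ℝ Q) {f : E → ℂ}
    {f' : E → E →L[ℝ] ℂ} (hf : ∀ x ∈ Q, HasFDerivWithinAt f (f' x) Q x)
    (hf' : ContinuousOn f' Q) {x y : E} (hx : x ∈ Q) (hy : y ∈ Q) :
    ‖f y - f x‖ₑ ^ 2 ≤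
      ‖y - x‖ₑ ^ 2 * ∫⁻ t in Icc (0 : ℝ) 1, ‖f' ((1 - t) • x + t • y)‖ₑ ^ 2 := by
  set γ : ℝ → E := fun t => (1 - t) • x + t • y with hγ
  have hγQ : MapsTo γ (Icc 0 1) Q := fun t ht =>
    hQ hx hy (by linarith [ht.2]) ht.1 (by ring)
  have hγc : Continuous γ := by fun_prop
  have hγd : ∀ t, HasDerivAt γ (y - x) t := by
    intro t
    have h1 : HasDerivAt (fun t : ℝ => (1 - t) • x) ((-1 : ℝ) • x) t :=
      ((hasDerivAt_id t).const_sub 1).smul_const x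
    have h2 : HasDerivAt (fun t : ℝ => t • y) ((1 : ℝ) • y) t :=
      (hasDerivAt_id t).smul_const y
    have := h1.add h2
    rw [neg_one_smul, one_smul, neg_add_eq_sub] at this
    exact this
  have hD : ∀ t ∈ Icc (0 : ℝ) 1, HasDerivWithinAt (f ∘ γ) (f' (γ t) (y - x)) (Icc 0 1) t :=
    fun t ht => (hf _ (hγQ ht)).comp_hasDerivWithinAt t (hγd t).hasDerivWithinAt hγQ
  have hcd : ContinuousOn (fun t => f' (γ t) (y - x)) (Icc 0 1) :=
    (hf'.comp hγc.continuousOn hγQ).clm_apply continuousOn_const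
  have hftc : ∫ t in (0 : ℝ)..1, f' (γ t) (y - x) = f y - f x := by
    rw [intervalIntegral.integral_eq_sub_of_hasDerivAt_of_le zero_le_one
      (f := f ∘ γ) (fun t ht => (hD t ht).continuousWithinAt)
      (fun t ht => (hD t (Ioo_subset_Icc_self ht)).hasDerivAt (Icc_mem_nhds ht.1 ht.2))
      (hcd.intervalIntegrable_of_Icc zero_le_one)]
    simp [hγ]
  rw [← hftc, intervalIntegral.integral_of_le zero_le_one, ← integral_Icc_eq_integral_Ioc]
  have hm : AEMeasurable (fun t => ‖f' (γ t) (y - x)‖ₑ) (volume.restrict (Icc 0 1)) :=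
    (hcd.aemeasurable measurableSet_Icc).enorm
  calc ‖∫ t in Icc (0 : ℝ) 1, f' (γ t) (y - x)‖ₑ ^ 2
      ≤ (∫⁻ t in Icc (0 : ℝ) 1, ‖f' (γ t) (y - x)‖ₑ) ^ 2 := by
        gcongr
        exact enorm_integral_le_lintegral_enorm _
    _ ≤ ∫⁻ t in Icc (0 : ℝ) 1, ‖f' (γ t) (y - x)‖ₑ ^ 2 := by
        refine (sq_lintegral_le hm).trans_eq ?_
        simp
    _ ≤ ∫⁻ t in Icc (0 : ℝ) 1, ‖y - x‖ₑ ^ 2 * ‖f' (γ t)‖ₑ ^ 2 := by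
        refine lintegral_mono fun t => ?_
        rw [← mul_pow, mul_comm]
        gcongr
        exact ContinuousLinearMap.le_opENorm _ _
    _ = _ := by
        rw [lintegral_const_mul' _ _ (by finiteness)]

variable [MeasurableSpace E] [BorelSpace E] [FiniteDimensional ℝ E] (μ : Measure E)
  [μ.IsAddHaarMeasure]

/-- The substitution `y ↦ x + t y` has Jacobian factor `t ^ (-dim E)`, which the restriction `t ≥ 1
/ 2` keeps below `2 ^ dim E`. -/
theorem lintegral_add_smul_le {G : E → ℝ≥0∞} (hG : Measurable G) {t : ℝ} (ht : 1 / 2 ≤ t) (x : E) :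
    ∫⁻ y, G (x + t • y) ∂μ ≤ 2 ^ Module.finrank ℝ E * ∫⁻ y, G y ∂μ := by
  have ht0 : 0 < t := by linarith
  have h1 : ∫⁻ y, G (x + t • y) ∂μ = ∫⁻ y, G (x + y) ∂(μ.map (t • ·)) :=
    (lintegral_map (hG.comp (measurable_const_add x)) (measurable_const_smul t)).symm
  rw [h1, Measure.map_addHaar_smul μ ht0.ne', lintegral_smul_measure,
    lintegral_add_left_eq_self G x, smul_eq_mul]
  gcongr
  rw [show (2 : ℝ≥0∞) = ENNReal.ofReal 2 by simp, ← ENNReal.ofReal_pow zero_le_two]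
  refine ENNReal.ofReal_le_ofReal ?_
  rw [abs_of_pos (by positivity), ← inv_pow]
  refine pow_le_pow_left₀ (by positivity) ?_ _
  exact inv_le_of_inv_le₀ two_pos (by rwa [inv_eq_one_div])

/-- The **Poincaré inequality** on a convex set, as a bound for the mean square oscillation. -/
theorem lintegral_lintegral_enorm_sub_sq_le [SFinite μ] {Q : Set E} (hQ : Convex ℝ Q)
    (hQm : MeasurableSet Q) {d : ℝ≥0∞} (hd : ∀ x ∈ Q, ∀ y ∈ Q, ‖y - x‖ₑ ≤ d) {f : E → ℂ}
    {f' : E → E →L[ℝ] ℂ} (hf : ∀ x ∈ Q, HasFDerivWithinAt f (f' x) Q x)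
    (hf' : ContinuousOn f' Q) :
    ∫⁻ x in Q, ∫⁻ y in Q, ‖f y - f x‖ₑ ^ 2 ∂μ ∂μ ≤
      d ^ 2 * (2 ^ Module.finrank ℝ E * μ Q * ∫⁻ x in Q, ‖f' x‖ₑ ^ 2 ∂μ) := by
  classical
  -- Extension by zero allows an inner integral over `Q` to be enlarged to all of `E` before
  -- changing variables.
  set G : E → ℝ≥0∞ := Q.indicator fun x => ‖f' x‖ₑ ^ 2 with hG
  have hGm : Measurable G := by
    have : ContinuousOn (fun x => ‖f' x‖ₑ ^ 2) Q :=
      (ENNReal.continuous_pow 2).comp_continuousOn hf'.enorm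
    exact this.measurable_piecewise continuousOn_const hQm
  have hGint : ∫⁻ x, G x ∂μ = ∫⁻ x in Q, ‖f' x‖ₑ ^ 2 ∂μ := lintegral_indicator hQm _
  have hjm : Measurable fun p : (E × E) × ℝ => G ((1 - p.2) • p.1.1 + p.2 • p.1.2) :=
    hGm.comp (by fun_prop)
  have hA : ∀ t ∈ Icc (0 : ℝ) 1,
      ∫⁻ x in Q, ∫⁻ y in Q, G ((1 - t) • x + t • y) ∂μ ∂μ ≤
        2 ^ Module.finrank ℝ E * μ Q * ∫⁻ x, G x ∂μ := by
    have hB : ∀ t : ℝ, 1 / 2 ≤ t → ∫⁻ x in Q, ∫⁻ y in Q, G ((1 - t) • x + t • y) ∂μ ∂μ ≤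
        2 ^ Module.finrank ℝ E * μ Q * ∫⁻ x, G x ∂μ := by
      intro t ht
      calc ∫⁻ x in Q, ∫⁻ y in Q, G ((1 - t) • x + t • y) ∂μ ∂μ
          ≤ ∫⁻ x in Q, 2 ^ Module.finrank ℝ E * ∫⁻ y, G y ∂μ ∂μ := lintegral_mono fun x =>
            (setLIntegral_le_lintegral _ _).trans (lintegral_add_smul_le μ hGm ht _)
        _ = _ := by
            rw [setLIntegral_const]
            ring
    intro t ht
    -- The change of variables in `y` degenerates as `t → 0`. For `t ≤ 1 / 2` the roles of `x` and
    -- `y` are exchanged, which replaces `t` by `1 - t ≥ 1 / 2`.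
    rcases le_total (1 / 2) t with h | h
    · exact hB t h
    · have hm2 : Measurable fun p : E × E => G ((1 - t) • p.1 + t • p.2) :=
        hGm.comp (by fun_prop)
      rw [lintegral_lintegral_swap hm2.aemeasurable]
      have := hB (1 - t) (by linarith)
      simp only [sub_sub_cancel] at this
      refine le_trans (le_of_eq ?_) this
      refine lintegral_congr fun x => lintegral_congr fun y => ?_
      rw [add_comm]
  calc ∫⁻ x in Q, ∫⁻ y in Q, ‖f y - f x‖ₑ ^ 2 ∂μ ∂μ
      ≤ ∫⁻ x in Q, ∫⁻ y in Q,
          d ^ 2 * ∫⁻ t in Icc (0 : ℝ) 1, G ((1 - t) • x + t • y) ∂volume ∂μ ∂μ := by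
        refine setLIntegral_mono' hQm fun x hx => setLIntegral_mono' hQm fun y hy => ?_
        refine (enorm_sub_sq_le_lintegral_segment hQ hf hf' hx hy).trans ?_
        gcongr ?_ ^ 2 * ?_
        · exact hd x hx y hy
        · refine setLIntegral_mono' measurableSet_Icc fun t ht => ?_
          rw [hG, indicator_of_mem (hQ hx hy (by linarith [ht.2]) ht.1 (by ring))]
    _ = d ^ 2 * ∫⁻ x in Q, ∫⁻ y in Q,
          ∫⁻ t in Icc (0 : ℝ) 1, G ((1 - t) • x + t • y) ∂volume ∂μ ∂μ := by
        have h1 : Measurable fun p : E × E =>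
            ∫⁻ t in Icc (0 : ℝ) 1, G ((1 - t) • p.1 + t • p.2) := hjm.lintegral_prod_right'
        rw [← lintegral_const_mul _ h1.lintegral_prod_right']
        refine lintegral_congr fun x => ?_
        rw [lintegral_const_mul]
        exact h1.comp measurable_prodMk_left
    _ = d ^ 2 * ∫⁻ t in Icc (0 : ℝ) 1, ∫⁻ x in Q, ∫⁻ y in Q,
          G ((1 - t) • x + t • y) ∂μ ∂μ := by
        congr 1
        have h2 : ∀ x, ∫⁻ y in Q, ∫⁻ t in Icc (0 : ℝ) 1, G ((1 - t) • x + t • y) ∂volume ∂μ =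
            ∫⁻ t in Icc (0 : ℝ) 1, ∫⁻ y in Q, G ((1 - t) • x + t • y) ∂μ := fun x =>
          lintegral_lintegral_swap (Measurable.aemeasurable (hGm.comp (by fun_prop :
            Measurable fun p : E × ℝ => (1 - p.2) • x + p.2 • p.1)))
        simp only [h2]
        refine lintegral_lintegral_swap (Measurable.aemeasurable ?_)
        have : Measurable fun p : (E × ℝ) × E => G ((1 - p.1.2) • p.1.1 + p.1.2 • p.2) :=
          hGm.comp (by fun_prop)
        exact this.lintegral_prod_right'
    _ ≤ d ^ 2 * ∫⁻ t in Icc (0 : ℝ) 1, 2 ^ Module.finrank ℝ E * μ Q * ∫⁻ x, G x ∂μ := by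
        refine mul_le_mul_right ?_ _
        exact setLIntegral_mono' measurableSet_Icc hA
    _ = _ := by
        rw [setLIntegral_const, hGint]
        simp

/-- The variance of a function, in terms of its mean square oscillation. -/
theorem measure_mul_lintegral_enorm_sq_le {α : Type*} [MeasurableSpace α] {ν : Measure α}
    [IsFiniteMeasure ν] {f : α → ℂ} (hf : Integrable f ν) :
    ν univ * ∫⁻ x, ‖f x‖ₑ ^ 2 ∂ν ≤
      2 * (‖∫ x, f x ∂ν‖ₑ ^ 2 + ∫⁻ x, ∫⁻ y, ‖f y - f x‖ₑ ^ 2 ∂ν ∂ν) := by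
  rcases eq_or_ne (ν univ) 0 with h0 | h0
  · simp [h0]
  -- Pointwise, `ν univ • f x` is the integral of `f` minus the integral of `f y - f x` over `y`;
  -- then `(a + b)² ≤ 2 (a² + b²)` and Cauchy–Schwarz. Integrating over `x` leaves a superfluous
  -- factor `ν univ`, cancelled at the end.
  have hx : ∀ x, ν univ ^ 2 * ‖f x‖ₑ ^ 2 ≤
      2 * (‖∫ x, f x ∂ν‖ₑ ^ 2 + ν univ * ∫⁻ y, ‖f y - f x‖ₑ ^ 2 ∂ν) := by
    intro x
    have h1 : ν.real univ • f x = ∫ y, f y ∂ν - ∫ y, (f y - f x) ∂ν := by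
      rw [integral_sub hf (integrable_const _), integral_const]
      ring
    have h2 : ν univ * ‖f x‖ₑ ≤ ‖∫ y, f y ∂ν‖ₑ + ∫⁻ y, ‖f y - f x‖ₑ ∂ν := by
      calc ν univ * ‖f x‖ₑ = ‖ν.real univ • f x‖ₑ := by
            rw [enorm_smul, Real.enorm_eq_ofReal measureReal_nonneg,
              ofReal_measureReal (measure_ne_top _ _)]
        _ ≤ _ := by
            rw [h1]
            exact enorm_sub_le.trans (add_le_add_right (enorm_integral_le_lintegral_enorm _) _)
    calc ν univ ^ 2 * ‖f x‖ₑ ^ 2 = (ν univ * ‖f x‖ₑ) ^ 2 := (mul_pow _ _ _).symm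
      _ ≤ (‖∫ y, f y ∂ν‖ₑ + ∫⁻ y, ‖f y - f x‖ₑ ∂ν) ^ 2 := by gcongr
      _ ≤ 2 * (‖∫ y, f y ∂ν‖ₑ ^ 2 + (∫⁻ y, ‖f y - f x‖ₑ ∂ν) ^ 2) := by
          have := ENNReal.rpow_add_le_mul_rpow_add_rpow ‖∫ y, f y ∂ν‖ₑ
            (∫⁻ y, ‖f y - f x‖ₑ ∂ν) one_le_two
          norm_num at this
          exact this
      _ ≤ _ := by
          gcongr
          exact sq_lintegral_le (hf.1.sub aestronglyMeasurable_const).aemeasurable.enorm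
  have hint : ν univ ^ 2 * ∫⁻ x, ‖f x‖ₑ ^ 2 ∂ν ≤ ν univ *
      (2 * (‖∫ x, f x ∂ν‖ₑ ^ 2 + ∫⁻ x, ∫⁻ y, ‖f y - f x‖ₑ ^ 2 ∂ν ∂ν)) := by
    rw [← lintegral_const_mul' _ _ (by finiteness)]
    refine (lintegral_mono hx).trans_eq ?_
    rw [lintegral_const_mul' _ _ (by finiteness), lintegral_add_left' aemeasurable_const,
      lintegral_const, lintegral_const_mul' _ _ (by finiteness)]
    ring
  rwa [sq, mul_assoc, ENNReal.mul_le_mul_iff_right h0 (measure_ne_top _ _)] at hint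

end Poincare

/-! ### Matrices comparable to the identity -/

section Matrices

open Matrix

variable {n : ℕ} {G : Matrix (Fin n) (Fin n) ℝ} {c : ℝ}

/-- Testing the form on unit eigenvectors places every eigenvalue in `[c⁻¹, c]`, and the determinant
is their product. -/
theorem det_mem_Icc_of_comparable (hG : Gᵀ = G) (hc : 0 < c)
    (h : ∀ v : Fin n → ℝ, c⁻¹ * (v ⬝ᵥ v) ≤ v ⬝ᵥ G *ᵥ v ∧ v ⬝ᵥ G *ᵥ v ≤ c * (v ⬝ᵥ v)) :
    G.det ∈ Icc ((c ^ n)⁻¹) (c ^ n) := by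
  have hH : G.IsHermitian := by
    rw [Matrix.IsHermitian, conjTranspose_eq_transpose_of_trivial, hG]
  have hev : ∀ i, c⁻¹ ≤ hH.eigenvalues i ∧ hH.eigenvalues i ≤ c := by
    intro i
    set v : Fin n → ℝ := (hH.eigenvectorBasis i).ofLp with hv
    have h1 : v ⬝ᵥ v = 1 := by
      have := (hH.eigenvectorBasis).orthonormal.1 i
      have h2 := EuclideanSpace.real_norm_sq_eq (hH.eigenvectorBasis i)
      rw [this, one_pow] at h2
      rw [h2, dotProduct]
      exact Finset.sum_congr rfl fun j _ => (sq _).symm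
    have h2 : v ⬝ᵥ G *ᵥ v = hH.eigenvalues i := by
      rw [hv, hH.mulVec_eigenvectorBasis i, dotProduct_smul, ← hv, h1, smul_eq_mul, mul_one]
    have h3 := h v
    rwa [h1, h2, mul_one, mul_one] at h3
  have hdet : G.det = ∏ i, hH.eigenvalues i := by
    simpa using hH.det_eq_prod_eigenvalues
  rw [hdet, ← inv_pow]
  constructor
  · calc c⁻¹ ^ n = ∏ _i : Fin n, c⁻¹ := by simp
      _ ≤ _ := Finset.prod_le_prod (fun _ _ => by positivity) fun i _ => (hev i).1
  · calc _ ≤ ∏ _i : Fin n, c :=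
        Finset.prod_le_prod (fun i _ => le_trans (by positivity) (hev i).1) fun i _ => (hev i).2
      _ = c ^ n := by simp

/-- Both bounds complete a square, with `v = G⁻¹ w`. The lower one expands `0 ≤ (v - c⁻¹ w) · G (v -
c⁻¹ w)` and uses `w · G w ≤ c |w|²`; the upper one combines `0 ≤ |c w - v|²` with `|v|² ≤ c (v · G
v) = c (w · v)`. -/
theorem inv_comparable (hG : Gᵀ = G) (hc : 0 < c)
    (h : ∀ v : Fin n → ℝ, c⁻¹ * (v ⬝ᵥ v) ≤ v ⬝ᵥ G *ᵥ v ∧ v ⬝ᵥ G *ᵥ v ≤ c * (v ⬝ᵥ v))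
    (w : Fin n → ℝ) :
    c⁻¹ * (w ⬝ᵥ w) ≤ w ⬝ᵥ G⁻¹ *ᵥ w ∧ w ⬝ᵥ G⁻¹ *ᵥ w ≤ c * (w ⬝ᵥ w) := by
  have hu : IsUnit G.det := by
    have h1 := (det_mem_Icc_of_comparable hG hc h).1
    have h2 : 0 < (c ^ n)⁻¹ := by positivity
    exact (lt_of_lt_of_le h2 h1).ne'.isUnit
  set v := G⁻¹ *ᵥ w with hv
  have hGv : G *ᵥ v = w := by rw [hv, mulVec_mulVec, mul_nonsing_inv _ hu, one_mulVec]
  have hs : v ⬝ᵥ G *ᵥ v = w ⬝ᵥ v := by rw [hGv, dotProduct_comm]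
  constructor
  · have h1 := (h (v - c⁻¹ • w)).1
    have h2 := (h w).2
    have h3 : 0 ≤ (v - c⁻¹ • w) ⬝ᵥ (v - c⁻¹ • w) :=
      Finset.sum_nonneg fun i _ => mul_self_nonneg _
    have h4 : 0 ≤ (v - c⁻¹ • w) ⬝ᵥ G *ᵥ (v - c⁻¹ • w) := le_trans (by positivity) h1
    have h5 : v ⬝ᵥ G *ᵥ w = w ⬝ᵥ w := by
      rw [dotProduct_mulVec, ← mulVec_transpose, hG, hGv]
    rw [mulVec_sub, mulVec_smul, dotProduct_sub, sub_dotProduct, sub_dotProduct, hs, hGv] at h4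
    simp only [smul_dotProduct, dotProduct_smul, smul_eq_mul, h5] at h4
    have h6 : c⁻¹ * (c⁻¹ * (w ⬝ᵥ G *ᵥ w)) ≤ c⁻¹ * (w ⬝ᵥ w) := by
      gcongr
      rw [inv_mul_le_iff₀ hc]
      exact h2
    linarith
  · have h1 := (h v).1
    rw [hs] at h1
    have h3 : 0 ≤ (c • w - v) ⬝ᵥ (c • w - v) :=
      Finset.sum_nonneg fun i _ => mul_self_nonneg _
    simp only [sub_dotProduct, dotProduct_sub, smul_dotProduct, dotProduct_smul, smul_eq_mul] at h3
    rw [dotProduct_comm v w] at h3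
    rw [inv_mul_le_iff₀ hc] at h1
    nlinarith

end Matrices

/-! ### Adapted charts -/

section Adapted

variable {n : ℕ} {H : Type*} [TopologicalSpace H]
  {I : ModelWithCorners ℝ (EuclideanSpace ℝ (Fin n)) H}
  {M : Type*} [TopologicalSpace M] [ChartedSpace H M]

/-- A chart with bounded convex range in which `g` is comparable to the Euclidean metric. -/
structure IsAdapted (g : RoughMetric I M) (e : OpenPartialHomeomorph M H) (c : ℝ) : Prop where
  mem : e ∈ IsManifold.maximalAtlas I ∞ M
  convex : Convex ℝ (e.extend I).target
  bounded : Bornology.IsBounded (e.extend I).target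
  pos : 0 < c
  comparable : ∀ᵐ z ∂(chartLebesgue I e), ∀ v : Fin n → ℝ,
    c⁻¹ * (v ⬝ᵥ v) ≤ v ⬝ᵥ (gram g ((e.extend I).symm z) (coordVec I e z)).mulVec v ∧
    v ⬝ᵥ (gram g ((e.extend I).symm z) (coordVec I e z)).mulVec v ≤ c * (v ⬝ᵥ v)

theorem gram_dotProduct_mulVec (g : RoughMetric I M) (x : M) (b : Fin n → TangentSpace I x)
    (v : Fin n → ℝ) :
    v ⬝ᵥ (gram g x b).mulVec v = g.toFun x (∑ i, v i • b i) (∑ i, v i • b i) := by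
  simp only [map_sum, map_smul, _root_.sum_apply, _root_.smul_apply, smul_eq_mul,
    dotProduct, Matrix.mulVec, gram, Matrix.of_apply, Finset.mul_sum]
  rw [Finset.sum_comm]
  refine Finset.sum_congr rfl fun i _ => Finset.sum_congr rfl fun j _ => ?_
  ring

variable [IsManifold I ∞ M]

theorem extend_restr_target (e : OpenPartialHomeomorph M H) {s : Set M} (hs : IsOpen s) :
    ((e.restr s).extend I).target = (e.extend I).target ∩ (e.extend I).symm ⁻¹' s := by
  ext z
  simp only [OpenPartialHomeomorph.extend_target, OpenPartialHomeomorph.restr_target,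
    hs.interior_eq, mem_inter_iff, mem_preimage]
  constructor
  · rintro ⟨⟨h1, h2⟩, h3⟩
    exact ⟨⟨h1, h3⟩, h2⟩
  · rintro ⟨⟨h1, h3⟩, h2⟩
    exact ⟨⟨h1, h2⟩, h3⟩

theorem sum_smul_coordVec (e : OpenPartialHomeomorph M H) (z v : EuclideanSpace ℝ (Fin n)) :
    mfderivWithin 𝓘(ℝ, EuclideanSpace ℝ (Fin n)) I (e.extend I).symm (range I) z v =
      ∑ i, v i • coordVec I e z i := by
  have h : v = ∑ i, v i • EuclideanSpace.single i (1 : ℝ) := by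
    have := (EuclideanSpace.basisFun (Fin n) ℝ).sum_repr v
    simpa using this.symm
  have key : ∀ L : EuclideanSpace ℝ (Fin n) →L[ℝ] EuclideanSpace ℝ (Fin n),
      L v = ∑ i, v i • L (EuclideanSpace.single i (1 : ℝ)) := by
    intro L
    conv_lhs => rw [h]
    simp only [map_sum, map_smul]
  exact key _

theorem comparable_gram (g : RoughMetric I M) {e : OpenPartialHomeomorph M H}
    (he : e ∈ IsManifold.maximalAtlas I ∞ M) {C : ℝ} (hC : 1 ≤ C)
    {z : EuclideanSpace ℝ (Fin n)} (hz : z ∈ (e.extend I).target)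
    (h : ∀ u : TangentSpace I ((e.extend I).symm z),
      C⁻¹ * ‖coordDeriv I e ((e.extend I).symm z) u‖ ≤ √(g.toFun ((e.extend I).symm z) u u) ∧
      √(g.toFun ((e.extend I).symm z) u u) ≤ C * ‖coordDeriv I e ((e.extend I).symm z) u‖)
    (v : Fin n → ℝ) :
    (C ^ 2)⁻¹ * (v ⬝ᵥ v) ≤ v ⬝ᵥ (gram g ((e.extend I).symm z) (coordVec I e z)).mulVec v ∧
    v ⬝ᵥ (gram g ((e.extend I).symm z) (coordVec I e z)).mulVec v ≤ C ^ 2 * (v ⬝ᵥ v) := by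
  have hC0 : 0 < C := by linarith
  rw [gram_dotProduct_mulVec]
  set w : EuclideanSpace ℝ (Fin n) := WithLp.toLp 2 v with hw
  have hu : ∑ i, v i • coordVec I e z i =
      mfderivWithin 𝓘(ℝ, EuclideanSpace ℝ (Fin n)) I (e.extend I).symm (range I) z w :=
    (sum_smul_coordVec e z w).symm
  have hv : v ⬝ᵥ v = ‖w‖ ^ 2 := by
    rw [EuclideanSpace.real_norm_sq_eq, dotProduct]
    exact Finset.sum_congr rfl fun j _ => (sq _).symm
  set u : TangentSpace I ((e.extend I).symm z) := ∑ i, v i • coordVec I e z i with hudef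
  have h1 := h u
  have h2 : coordDeriv I e ((e.extend I).symm z) u = w := by
    rw [hu]
    exact coordDeriv_comp he hz w
  rw [h2] at h1
  rw [hv]
  constructor
  -- The real square root is `0` on negative numbers, so a lower bound for it can be squared only if
  -- the bound is positive; `w = 0` is treated apart.
  · rcases eq_or_ne w 0 with h0 | h0
    · have : u = 0 := coordDeriv_injective he hz (by rw [h2, h0, map_zero])
      rw [this, h0, map_zero]
      simp
    · have hpos : 0 < C⁻¹ * ‖w‖ := by
        have := norm_pos_iff.2 h0
        positivity
      have := (Real.le_sqrt' hpos).1 h1.1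
      rwa [mul_pow, inv_pow] at this
  · have := (Real.sqrt_le_iff.1 h1.2).2
    rwa [mul_pow] at this

/-- Restrict a comparison chart to the preimage of a ball so small that its part in `range I` lies
in the chart image. The new image is a ball intersected with the convex set `range I`. The constant
becomes `C ^ 2` because `RoughMetric` compares lengths and `IsAdapted` compares quadratic forms. -/
theorem exists_isAdapted (g : RoughMetric I M) (x : M) :
    ∃ (e : OpenPartialHomeomorph M H) (c : ℝ), x ∈ e.source ∧ IsAdapted g e c := by
  obtain ⟨e, he, hx, C, hC, h⟩ := g.comparable x
  obtain ⟨r, hr, hrt⟩ := Metric.mem_nhdsWithin_iff.1 (e.extend_target_mem_nhdsWithin (I := I) hx)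
  set s : Set M := e.source ∩ e ⁻¹' (I ⁻¹' Metric.ball (e.extend I x) r) with hs
  have hso : IsOpen s :=
    e.continuousOn.isOpen_inter_preimage e.open_source (Metric.isOpen_ball.preimage I.continuous)
  have htar : ((e.restr s).extend I).target = Metric.ball (e.extend I x) r ∩ range I := by
    rw [extend_restr_target e hso]
    refine Subset.antisymm ?_ ?_
    · rintro z ⟨hz, hz2⟩
      refine ⟨?_, e.extend_target_subset_range hz⟩
      have : e.extend I ((e.extend I).symm z) ∈ Metric.ball (e.extend I x) r := hz2.2
      rwa [(e.extend I).right_inv hz] at this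
    · intro z hz
      have hz1 := hrt hz
      refine ⟨hz1, extend_symm_mem e hz1, ?_⟩
      change e.extend I ((e.extend I).symm z) ∈ Metric.ball (e.extend I x) r
      rw [(e.extend I).right_inv hz1]
      exact hz.1
  refine ⟨e.restr s, C ^ 2, ?_, ?_, ?_, ?_, by positivity, ?_⟩
  · rw [OpenPartialHomeomorph.restr_source' _ _ hso]
    exact ⟨hx, hx, Metric.mem_ball_self hr⟩
  · exact restr_mem_maximalAtlas (contDiffGroupoid ∞ I) he hso
  · rw [htar]
    exact (convex_ball _ _).inter I.convex_range
  · rw [htar]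
    exact Metric.isBounded_ball.subset inter_subset_left
  · have hsub : ((e.restr s).extend I).target ⊆ (e.extend I).target := by
      rw [extend_restr_target e hso]
      exact inter_subset_left
    have hle : chartLebesgue I (e.restr s) ≤ chartLebesgue I e :=
      Measure.restrict_mono hsub le_rfl
    have h3 : ∀ᵐ z ∂(chartLebesgue I e), z ∈ (e.extend I).target :=
      ae_restrict_mem (measurableSet_target e)
    filter_upwards [ae_mono hle h, ae_mono hle h3] with z hz hzt
    exact comparable_gram g he hC hzt hz

theorem IsAdapted.det_mem {g : RoughMetric I M} {e : OpenPartialHomeomorph M H} {c : ℝ}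
    (h : IsAdapted g e c) : ∀ᵐ z ∂(chartLebesgue I e),
      (gram g ((e.extend I).symm z) (coordVec I e z)).det ∈ Icc ((c ^ n)⁻¹) (c ^ n) := by
  filter_upwards [h.comparable] with z hz
  exact det_mem_Icc_of_comparable (gram_isSymm g _ _) h.pos hz

/-- The scalar product on covectors has the inverse Gram matrix, so `inv_comparable` applies,
separately to the real and imaginary parts of the components. -/
theorem IsAdapted.dualForm_comparable {g : RoughMetric I M} {e : OpenPartialHomeomorph M H} {c : ℝ}
    (h : IsAdapted g e c) : ∀ᵐ z ∂(chartLebesgue I e),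
      ∀ α : TangentSpace I ((e.extend I).symm z) →L[ℝ] ℂ,
        c⁻¹ * ∑ i, ‖α (coordVec I e z i)‖ ^ 2 ≤ (cometric g ((e.extend I).symm z) α α).re ∧
        (cometric g ((e.extend I).symm z) α α).re ≤ c * ∑ i, ‖α (coordVec I e z i)‖ ^ 2 := by
  have h3 : ∀ᵐ z ∂(chartLebesgue I e), z ∈ (e.extend I).target :=
    ae_restrict_mem (measurableSet_target e)
  filter_upwards [h.comparable, h3] with z hz hzt α
  have hinv := inv_comparable (gram_isSymm g _ _) h.pos hz
  rw [cometric_eq_dualForm g h.mem hzt]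
  set b := coordVec I e z with hb
  set A := (gram g ((e.extend I).symm z) b)⁻¹ with hA
  have key : (dualForm g ((e.extend I).symm z) b α α).re =
      (fun i => (α (b i)).re) ⬝ᵥ A.mulVec (fun i => (α (b i)).re) +
      (fun i => (α (b i)).im) ⬝ᵥ A.mulVec (fun i => (α (b i)).im) := by
    simp only [dualForm, ← hA, Complex.re_sum, dotProduct, Matrix.mulVec, Finset.mul_sum,
      ← Finset.sum_add_distrib]
    refine Finset.sum_congr rfl fun i _ => Finset.sum_congr rfl fun j _ => ?_
    simp
    ring
  have hsum : ∑ i, ‖α (b i)‖ ^ 2 = (fun i => (α (b i)).re) ⬝ᵥ (fun i => (α (b i)).re) +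
      (fun i => (α (b i)).im) ⬝ᵥ (fun i => (α (b i)).im) := by
    simp only [dotProduct, ← Finset.sum_add_distrib]
    refine Finset.sum_congr rfl fun i _ => ?_
    rw [← Complex.normSq_eq_norm_sq, Complex.normSq_apply]
  have h1 := hinv fun i => (α (b i)).re
  have h2 := hinv fun i => (α (b i)).im
  rw [key, hsum, mul_add, mul_add]
  exact ⟨add_le_add h1.1 h2.1, add_le_add h1.2 h2.2⟩

end Adapted

/-! ### The measure `μ_g` in a chart -/

section ChartMeasure

variable {n : ℕ} {H : Type*} [TopologicalSpace H]
  {I : ModelWithCorners ℝ (EuclideanSpace ℝ (Fin n)) H}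
  {M : Type*} [TopologicalSpace M] [ChartedSpace H M]

/-- The derivative of the inverse of a chart, as an endomorphism of `ℝⁿ`. -/
noncomputable def symmDeriv (I : ModelWithCorners ℝ (EuclideanSpace ℝ (Fin n)) H)
    (e : OpenPartialHomeomorph M H) (z : EuclideanSpace ℝ (Fin n)) :
    EuclideanSpace ℝ (Fin n) →L[ℝ] EuclideanSpace ℝ (Fin n) :=
  mfderivWithin 𝓘(ℝ, EuclideanSpace ℝ (Fin n)) I (e.extend I).symm (range I) z

theorem det_frameMatrix (e : OpenPartialHomeomorph M H) (z : EuclideanSpace ℝ (Fin n)) :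
    (frameMatrix I e z).det = (symmDeriv I e z).det := by
  have h : frameMatrix I e z =
      LinearMap.toMatrix (EuclideanSpace.basisFun (Fin n) ℝ).toBasis
        (EuclideanSpace.basisFun (Fin n) ℝ).toBasis (symmDeriv I e z).toLinearMap := by
    ext i j
    rw [LinearMap.toMatrix_apply]
    simp
    rfl
  rw [h, LinearMap.det_toMatrix]

/-- Splits the density into the Jacobian of the inverse chart and a factor depending only on the
point of `M`, which is the same for any two charts. -/
theorem sqrt_det_gram_coordVec (g : RoughMetric I M) (e : OpenPartialHomeomorph M H)
    (z : EuclideanSpace ℝ (Fin n)) :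
    √(gram g ((e.extend I).symm z) (coordVec I e z)).det =
      |(symmDeriv I e z).det| * √(gram g ((e.extend I).symm z) (stdFrame I _)).det := by
  rw [gram_coordVec, Matrix.det_mul, Matrix.det_mul, Matrix.det_transpose, det_frameMatrix,
    mul_right_comm, ← sq, Real.sqrt_mul (sq_nonneg _), Real.sqrt_sq_eq_abs]

variable [IsManifold I ∞ M]

theorem mdifferentiableWithinAt_extend_symm {e : OpenPartialHomeomorph M H}
    (he : e ∈ IsManifold.maximalAtlas I ∞ M) {z : EuclideanSpace ℝ (Fin n)}
    (hz : z ∈ (e.extend I).target) :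
    MDifferentiableWithinAt 𝓘(ℝ, EuclideanSpace ℝ (Fin n)) I (e.extend I).symm (range I) z := by
  have hnhds : (e.extend I).target ∈ 𝓝[range I] z := by
    have := e.extend_target_mem_nhdsWithin (I := I) (extend_symm_mem e hz)
    rwa [(e.extend I).right_inv hz] at this
  have := (contMDiffOn_extend_symm he).mdifferentiableOn (by simp) z
    (by rw [← OpenPartialHomeomorph.extend_target']; exact hz)
  rw [← OpenPartialHomeomorph.extend_target'] at this
  exact this.mono_of_mem_nhdsWithin hnhds

/-- Chain rule for `ψ⁻¹ = ψ'⁻¹ ∘ τ`, where `τ` is the coordinate change. It is carried out within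
`range I`, where derivatives are unique also at boundary points. -/
theorem symmDeriv_eq_comp {e e' : OpenPartialHomeomorph M H}
    (he : e ∈ IsManifold.maximalAtlas I ∞ M) (he' : e' ∈ IsManifold.maximalAtlas I ∞ M)
    {z : EuclideanSpace ℝ (Fin n)} (hz : z ∈ (I.extendCoordChange e e').source) :
    symmDeriv I e z = (symmDeriv I e' (I.extendCoordChange e e' z)).comp
      (fderivWithin ℝ (I.extendCoordChange e e') (range I) z) := by
  have hzt : z ∈ (e.extend I).target := hz.1
  have hzr : z ∈ range I := e.extend_target_subset_range hzt
  have U : UniqueMDiffWithinAt 𝓘(ℝ, EuclideanSpace ℝ (Fin n)) (range I) z := I.uniqueMDiffOn z hzr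
  have hτt : I.extendCoordChange e e' z ∈ (e'.extend I).target :=
    ((I.extendCoordChange e e').map_source hz).1
  have hd : DifferentiableWithinAt ℝ (I.extendCoordChange e e') (range I) z :=
    (I.contDiffWithinAt_extendCoordChange he he' hz).differentiableWithinAt (by simp)
  have h1 := mfderivWithin_comp z (mdifferentiableWithinAt_extend_symm he' hτt)
    hd.mdifferentiableWithinAt (fun w _ => mem_range_self _) U
  rw [mfderivWithin_eq_fderivWithin] at h1
  have h2 : mfderivWithin 𝓘(ℝ, EuclideanSpace ℝ (Fin n)) I
      ((e'.extend I).symm ∘ I.extendCoordChange e e') (range I) z =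
      mfderivWithin 𝓘(ℝ, EuclideanSpace ℝ (Fin n)) I (e.extend I).symm (range I) z := by
    have heq : ∀ w ∈ (I.extendCoordChange e e').source,
        ((e'.extend I).symm ∘ I.extendCoordChange e e') w = (e.extend I).symm w := by
      rintro w ⟨-, hw⟩
      exact (e'.extend I).left_inv hw
    refine Filter.EventuallyEq.mfderivWithin_eq ?_ (heq z hz)
    filter_upwards [I.extendCoordChange_source_mem_nhdsWithin hz] with w hw using heq w hw
  exact h2.symm.trans h1

theorem measurableSet_target_inter_preimage [MeasurableSpace M] [BorelSpace M]
    (e : OpenPartialHomeomorph M H) {S : Set M} (hS : MeasurableSet S) :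
    MeasurableSet ((e.extend I).target ∩ (e.extend I).symm ⁻¹' S) := by
  have h2 := (e.continuousOn_extend_symm (I := I)).domRestrict.measurable hS
  have h3 := (MeasurableEmbedding.subtype_coe (measurableSet_target (I := I) e)).measurableSet_image'
    h2
  convert! h3 using 1
  ext y
  simp [and_comm]

section

variable [MeasurableSpace M] [BorelSpace M]

theorem chartVolume_apply (g : RoughMetric I M) (e : OpenPartialHomeomorph M H) {S : Set M}
    (hS : MeasurableSet S) :
    chartVolume g e S = ∫⁻ z in (e.extend I).target ∩ (e.extend I).symm ⁻¹' S,
      ENNReal.ofReal √(gram g ((e.extend I).symm z) (coordVec I e z)).det := by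
  rw [chartVolume, Measure.map_apply_of_aemeasurable ((aemeasurable_extend_symm e).mono_ac
    (withDensity_absolutelyContinuous _ _)) hS, chartLebesgue, withDensity_apply',
    Measure.restrict_restrict' (measurableSet_target e), inter_comm]

theorem chartVolume_compl_source (g : RoughMetric I M) (e : OpenPartialHomeomorph M H) :
    chartVolume g e e.sourceᶜ = 0 := by
  rw [chartVolume_apply g e e.open_source.measurableSet.compl]
  have : (e.extend I).target ∩ (e.extend I).symm ⁻¹' e.sourceᶜ = ∅ := by
    ext z
    simp only [mem_inter_iff, mem_preimage, mem_compl_iff, mem_empty_iff_false, iff_false,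
      not_and, not_not]
    exact fun hz => extend_symm_mem e hz
  rw [this]
  simp

/-- The measures `√(det g) dψ^*𝓛` transform consistently under changes of coordinates. -/
theorem chartVolume_apply_eq (g : RoughMetric I M) {e e' : OpenPartialHomeomorph M H}
    (he : e ∈ IsManifold.maximalAtlas I ∞ M) (he' : e' ∈ IsManifold.maximalAtlas I ∞ M)
    {S : Set M} (hS : MeasurableSet S) (hSe : S ⊆ e.source) (hSe' : S ⊆ e'.source) :
    chartVolume g e' S = chartVolume g e S := by
  rw [chartVolume_apply g e hS, chartVolume_apply g e' hS]
  set τ := I.extendCoordChange e e' with hτ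
  set A := (e.extend I).target ∩ (e.extend I).symm ⁻¹' S with hA
  have hAs : A ⊆ τ.source := by
    rintro z ⟨h1, h2⟩
    refine ⟨h1, ?_⟩
    rw [mem_preimage, OpenPartialHomeomorph.extend_source]
    exact hSe' h2
  have himg : (e'.extend I).target ∩ (e'.extend I).symm ⁻¹' S = τ '' A := by
    ext w
    constructor
    · rintro ⟨h1, h2⟩
      have h3 : (e.extend I).symm (e.extend I ((e'.extend I).symm w)) = (e'.extend I).symm w :=
        e.extend_left_inv (hSe h2)
      refine ⟨e.extend I ((e'.extend I).symm w), ⟨(e.extend I).map_source ?_, ?_⟩, ?_⟩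
      · rw [OpenPartialHomeomorph.extend_source]
        exact hSe h2
      · rw [mem_preimage, h3]
        exact h2
      · change e'.extend I ((e.extend I).symm _) = w
        rw [h3, (e'.extend I).right_inv h1]
    · rintro ⟨z, hz, rfl⟩
      have h1 := hAs hz
      refine ⟨(τ.map_source h1).1, ?_⟩
      have h2 : (e'.extend I).symm (τ z) = (e.extend I).symm z := (e'.extend I).left_inv h1.2
      rw [mem_preimage, h2]
      exact hz.2
  have hderiv : ∀ z ∈ A, HasFDerivWithinAt τ (fderivWithin ℝ τ (range I) z) A z := fun z hz =>
    ((I.contDiffWithinAt_extendCoordChange he he' (hAs hz)).differentiableWithinAt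
      (by simp)).hasFDerivWithinAt.mono
      fun w hw => e.extend_target_subset_range hw.1
  -- Change of variables along `τ`: its Jacobian is exactly the quotient of the Jacobians of the two
  -- inverse charts.
  rw [himg, lintegral_image_eq_lintegral_abs_det_fderiv_mul volume
    (measurableSet_target_inter_preimage e hS) hderiv (τ.injOn.mono hAs)]
  refine setLIntegral_congr_fun (measurableSet_target_inter_preimage e hS) fun z hz => ?_
  have h2 : (e'.extend I).symm (τ z) = (e.extend I).symm z := (e'.extend I).left_inv (hAs hz).2
  rw [← ENNReal.ofReal_mul (abs_nonneg _), sqrt_det_gram_coordVec, sqrt_det_gram_coordVec,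
    symmDeriv_eq_comp he he' (hAs hz), h2, ← hτ]
  congr 1
  have h3 : ((symmDeriv I e' (τ z)).comp (fderivWithin ℝ τ (range I) z)).det =
      (symmDeriv I e' (τ z)).det * (fderivWithin ℝ τ (range I) z).det :=
    LinearMap.det_comp _ _
  rw [h3, abs_mul]
  ring

theorem chartVolume_le_vol (g : RoughMetric I M) {e : OpenPartialHomeomorph M H}
    (he : e ∈ IsManifold.maximalAtlas I ∞ M) : chartVolume g e ≤ vol g :=
  le_iSup₂ (f := fun e _ => chartVolume g e) e he

/-- A supremum of measures is estimated by exhibiting an upper bound. Inside `e.source` every other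
chart measure agrees with that of `e` on the overlap and does not charge the rest, so `chartVolume g
e` plus `vol g` outside `e.source` dominates all of them. -/
theorem vol_restrict_source_le (g : RoughMetric I M) {e : OpenPartialHomeomorph M H}
    (he : e ∈ IsManifold.maximalAtlas I ∞ M) : (vol g).restrict e.source ≤ chartVolume g e := by
  have hm : MeasurableSet e.source := e.open_source.measurableSet
  have h1 : vol g ≤ chartVolume g e + (vol g).restrict e.sourceᶜ := by
    refine iSup₂_le fun e' he' => ?_
    rw [← Measure.restrict_add_restrict_compl (μ := chartVolume g e') hm]
    refine add_le_add (Measure.le_iff.2 fun S hS => ?_)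
      (Measure.restrict_mono le_rfl (chartVolume_le_vol g he'))
    rw [Measure.restrict_apply hS]
    have hm' : MeasurableSet e'.source := e'.open_source.measurableSet
    rw [← measure_inter_add_sdiff (S ∩ e.source) hm']
    have h0 : chartVolume g e' ((S ∩ e.source) \ e'.source) = 0 :=
      measure_mono_null (fun x hx => hx.2) (chartVolume_compl_source g e')
    rw [h0, add_zero, chartVolume_apply_eq g he he' ((hS.inter hm).inter hm')
      (fun x hx => hx.1.2) fun x hx => hx.2]
    exact measure_mono fun x hx => hx.1.1
  calc (vol g).restrict e.source
      ≤ (chartVolume g e + (vol g).restrict e.sourceᶜ).restrict e.source :=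
        Measure.restrict_mono le_rfl h1
    _ = (chartVolume g e).restrict e.source := by
        rw [Measure.restrict_add, Measure.restrict_restrict hm, inter_compl_self,
          Measure.restrict_empty, add_zero]
    _ ≤ _ := Measure.restrict_le_self

end

/-- Lebesgue measure on the range of a chart, transported to `M`. -/
noncomputable def pullLebesgue [MeasurableSpace M]
    (I : ModelWithCorners ℝ (EuclideanSpace ℝ (Fin n)) H)
    (e : OpenPartialHomeomorph M H) : Measure M :=
  (chartLebesgue I e).map (e.extend I).symm

variable [MeasurableSpace M] [BorelSpace M]

theorem pullLebesgue_apply (e : OpenPartialHomeomorph M H) {S : Set M} (hS : MeasurableSet S) :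
    pullLebesgue I e S = volume ((e.extend I).target ∩ (e.extend I).symm ⁻¹' S) := by
  rw [pullLebesgue, Measure.map_apply_of_aemeasurable (aemeasurable_extend_symm e) hS,
    chartLebesgue, Measure.restrict_apply' (measurableSet_target e), inter_comm]

theorem IsAdapted.sqrt_det_mem {g : RoughMetric I M} {e : OpenPartialHomeomorph M H} {c : ℝ}
    (h : IsAdapted g e c) : ∀ᵐ z ∂(chartLebesgue I e),
      (ENNReal.ofReal √(c ^ n))⁻¹ ≤
        ENNReal.ofReal √(gram g ((e.extend I).symm z) (coordVec I e z)).det ∧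
      ENNReal.ofReal √(gram g ((e.extend I).symm z) (coordVec I e z)).det ≤
        ENNReal.ofReal √(c ^ n) := by
  have hc : 0 < √(c ^ n) := Real.sqrt_pos.2 (pow_pos h.pos n)
  filter_upwards [h.det_mem] with z hz
  refine ⟨?_, ENNReal.ofReal_le_ofReal (Real.sqrt_le_sqrt hz.2)⟩
  rw [← ENNReal.ofReal_inv_of_pos hc, ← Real.sqrt_inv]
  exact ENNReal.ofReal_le_ofReal (Real.sqrt_le_sqrt hz.1)

/-- Together with `IsAdapted.vol_restrict_le`, this makes `μ_g` and Lebesgue measure mutually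
comparable in an adapted chart; both directions are the two bounds on `√det`. -/
theorem IsAdapted.pullLebesgue_le {g : RoughMetric I M} {e : OpenPartialHomeomorph M H} {c : ℝ}
    (h : IsAdapted g e c) : pullLebesgue I e ≤ ENNReal.ofReal √(c ^ n) • vol g := by
  have hc : ENNReal.ofReal √(c ^ n) ≠ 0 := by
    rw [ne_eq, ENNReal.ofReal_eq_zero, not_le]
    exact Real.sqrt_pos.2 (pow_pos h.pos n)
  refine Measure.le_iff.2 fun S hS => ?_
  rw [Measure.smul_apply]
  refine le_trans ?_ (smul_le_smul_of_nonneg_left (chartVolume_le_vol g h.mem S) zero_le)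
  rw [ smul_eq_mul, pullLebesgue_apply e hS, chartVolume_apply g e hS]
  set A := (e.extend I).target ∩ (e.extend I).symm ⁻¹' S with hA
  have h1 : (ENNReal.ofReal √(c ^ n))⁻¹ * volume A ≤
      ∫⁻ z in A, ENNReal.ofReal √(gram g ((e.extend I).symm z) (coordVec I e z)).det := by
    rw [← setLIntegral_const]
    refine lintegral_mono_ae ?_
    have := ae_mono (Measure.restrict_mono (μ := volume) (inter_subset_left : A ⊆ _) le_rfl)
      h.sqrt_det_mem
    filter_upwards [this] with z hz using hz.1
  calc volume A = ENNReal.ofReal √(c ^ n) * ((ENNReal.ofReal √(c ^ n))⁻¹ * volume A) := by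
        rw [← mul_assoc, ENNReal.mul_inv_cancel hc ENNReal.ofReal_ne_top, one_mul]
    _ ≤ _ := by gcongr

theorem IsAdapted.vol_restrict_le {g : RoughMetric I M} {e : OpenPartialHomeomorph M H} {c : ℝ}
    (h : IsAdapted g e c) :
    (vol g).restrict e.source ≤ ENNReal.ofReal √(c ^ n) • pullLebesgue I e := by
  refine (vol_restrict_source_le g h.mem).trans (Measure.le_iff.2 fun S hS => ?_)
  rw [Measure.smul_apply, smul_eq_mul, pullLebesgue_apply e hS, chartVolume_apply g e hS,
    ← setLIntegral_const]
  refine lintegral_mono_ae ?_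
  have := ae_mono (Measure.restrict_mono (μ := volume)
    (inter_subset_left : (e.extend I).target ∩ (e.extend I).symm ⁻¹' S ⊆ _) le_rfl) h.sqrt_det_mem
  filter_upwards [this] with z hz using hz.2

theorem IsAdapted.lintegral_chart_le {g : RoughMetric I M} {e : OpenPartialHomeomorph M H} {c : ℝ}
    (h : IsAdapted g e c) {F : M → ℝ≥0∞} (hF : AEMeasurable F (vol g)) :
    ∫⁻ z, F ((e.extend I).symm z) ∂(chartLebesgue I e) ≤
      ENNReal.ofReal √(c ^ n) * ∫⁻ x, F x ∂(vol g) := by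
  -- Domination by a multiple of `μ_g` carries null sets over, so almost everywhere measurability
  -- survives the change of measure.
  have hF' : AEMeasurable F (pullLebesgue I e) :=
    (hF.smul_measure _).mono_measure h.pullLebesgue_le
  rw [← lintegral_map' hF' (aemeasurable_extend_symm e), ← smul_eq_mul, ← lintegral_smul_measure]
  exact lintegral_mono' h.pullLebesgue_le le_rfl

theorem IsAdapted.lintegral_source_le {g : RoughMetric I M} {e : OpenPartialHomeomorph M H} {c : ℝ}
    (h : IsAdapted g e c) {F : M → ℝ≥0∞} (hF : AEMeasurable F (vol g)) :
    ∫⁻ x in e.source, F x ∂(vol g) ≤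
      ENNReal.ofReal √(c ^ n) * ∫⁻ z, F ((e.extend I).symm z) ∂(chartLebesgue I e) := by
  have hF' : AEMeasurable F (pullLebesgue I e) :=
    (hF.smul_measure _).mono_measure h.pullLebesgue_le
  rw [← lintegral_map' hF' (aemeasurable_extend_symm e), ← smul_eq_mul, ← lintegral_smul_measure]
  exact lintegral_mono' h.vol_restrict_le le_rfl

theorem IsAdapted.chartLebesgue_univ_lt_top {g : RoughMetric I M} {e : OpenPartialHomeomorph M H}
    {c : ℝ} (h : IsAdapted g e c) : chartLebesgue I e univ < ⊤ := by
  rw [chartLebesgue, Measure.restrict_apply_univ]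
  exact h.bounded.measure_lt_top

/-- Finitely many adapted charts cover `M`. -/
theorem exists_finite_adapted [CompactSpace M] (g : RoughMetric I M) :
    ∃ (N : ℕ) (e : Fin N → OpenPartialHomeomorph M H) (c : Fin N → ℝ),
      (∀ a, IsAdapted g (e a) (c a)) ∧ ⋃ a, (e a).source = univ := by
  choose e c hx h using exists_isAdapted g
  obtain ⟨t, ht⟩ := isCompact_univ.elim_finite_subcover (fun x => (e x).source)
    (fun x => (e x).open_source) (fun x _ => mem_iUnion.2 ⟨x, hx x⟩)
  refine ⟨t.card, fun a => e (t.equivFin.symm a), fun a => c (t.equivFin.symm a),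
    fun a => h _, eq_univ_of_forall fun y => ?_⟩
  obtain ⟨x, hxt, hy⟩ := mem_iUnion₂.1 (ht (mem_univ y))
  refine mem_iUnion.2 ⟨t.equivFin ⟨x, hxt⟩, ?_⟩
  simpa using hy

theorem lintegral_le_sum_source {N : ℕ} {e : Fin N → OpenPartialHomeomorph M H}
    (hcov : ⋃ a, (e a).source = univ) (μ : Measure M) (F : M → ℝ≥0∞) :
    ∫⁻ x, F x ∂μ ≤ ∑ a, ∫⁻ x in (e a).source, F x ∂μ := by
  rw [← setLIntegral_univ, ← hcov, ← tsum_fintype (L := .unconditional _)]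
  exact lintegral_iUnion_le _ _

instance isFiniteMeasure_vol [CompactSpace M] (g : RoughMetric I M) : IsFiniteMeasure (vol g) := by
  obtain ⟨N, e, c, h, hcov⟩ := exists_finite_adapted g
  refine ⟨?_⟩
  rw [← lintegral_one]
  refine (lintegral_le_sum_source hcov _ _).trans_lt (ENNReal.sum_lt_top.2 fun a _ => ?_)
  refine ((h a).lintegral_source_le aemeasurable_const).trans_lt ?_
  rw [lintegral_one]
  exact ENNReal.mul_lt_top ENNReal.ofReal_lt_top (h a).chartLebesgue_univ_lt_top

end ChartMeasure

/-! ### Completeness of the space of square-integrable covector fields -/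

section Complete

variable {n : ℕ} {H : Type*} [TopologicalSpace H]
  {I : ModelWithCorners ℝ (EuclideanSpace ℝ (Fin n)) H}
  {M : Type*} [TopologicalSpace M] [ChartedSpace H M]

/-- `|θ|²_g`, as an extended nonnegative function. -/
noncomputable def sqNorm (g : RoughMetric I M) (θ : ∀ x : M, TangentSpace I x →L[ℝ] ℂ) (x : M) :
    ℝ≥0∞ :=
  ENNReal.ofReal (cometric g x (θ x) (θ x)).re

variable [IsManifold I ∞ M] [MeasurableSpace M] [BorelSpace M]

theorem IsAdapted.sum_enorm_sq_le {g : RoughMetric I M} {e : OpenPartialHomeomorph M H} {c : ℝ}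
    (h : IsAdapted g e c) : ∀ᵐ z ∂(chartLebesgue I e),
      ∀ θ : ∀ x : M, TangentSpace I x →L[ℝ] ℂ,
        ∑ i, ‖θ ((e.extend I).symm z) (coordVec I e z i)‖ₑ ^ 2 ≤
          ENNReal.ofReal c * sqNorm g θ ((e.extend I).symm z) ∧
        sqNorm g θ ((e.extend I).symm z) ≤
          ENNReal.ofReal c * ∑ i, ‖θ ((e.extend I).symm z) (coordVec I e z i)‖ₑ ^ 2 := by
  filter_upwards [h.dualForm_comparable] with z hz θ
  have hsum : ∑ i, ‖θ ((e.extend I).symm z) (coordVec I e z i)‖ₑ ^ 2 =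
      ENNReal.ofReal (∑ i, ‖θ ((e.extend I).symm z) (coordVec I e z i)‖ ^ 2) := by
    rw [ENNReal.ofReal_sum_of_nonneg fun _ _ => sq_nonneg _]
    refine Finset.sum_congr rfl fun i _ => ?_
    rw [ENNReal.ofReal_pow (norm_nonneg _), ofReal_norm]
  obtain ⟨h1, h2⟩ := hz (θ ((e.extend I).symm z))
  rw [hsum, sqNorm, ← ENNReal.ofReal_mul h.pos.le, ← ENNReal.ofReal_mul h.pos.le]
  exact ⟨ENNReal.ofReal_le_ofReal ((inv_mul_le_iff₀ h.pos).1 h1), ENNReal.ofReal_le_ofReal h2⟩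

variable [CompactSpace M]

theorem aemeasurable_sqNorm (g : RoughMetric I M) {θ : ∀ x : M, TangentSpace I x →L[ℝ] ℂ}
    (hθ : MeasurableCovectorField I θ) : AEMeasurable (sqNorm g θ) (vol g) :=
  (Complex.measurable_re.comp_aemeasurable
    (aestronglyMeasurable_cometric g hθ hθ).aemeasurable).ennreal_ofReal

theorem IsAdapted.lintegral_sum_enorm_sq_le {g : RoughMetric I M} {e : OpenPartialHomeomorph M H}
    {c : ℝ} (h : IsAdapted g e c) {θ : ∀ x : M, TangentSpace I x →L[ℝ] ℂ}
    (hθ : MeasurableCovectorField I θ) :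
    ∫⁻ z, ∑ i, ‖θ ((e.extend I).symm z) (coordVec I e z i)‖ₑ ^ 2 ∂(chartLebesgue I e) ≤
      ENNReal.ofReal c * ENNReal.ofReal √(c ^ n) * ∫⁻ x, sqNorm g θ x ∂(vol g) := by
  calc _ ≤ ∫⁻ z, ENNReal.ofReal c * sqNorm g θ ((e.extend I).symm z) ∂(chartLebesgue I e) := by
        refine lintegral_mono_ae ?_
        filter_upwards [h.sum_enorm_sq_le] with z hz using (hz θ).1
    _ ≤ _ := by
        rw [lintegral_const_mul' _ _ ENNReal.ofReal_ne_top, mul_assoc]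
        gcongr
        exact h.lintegral_chart_le (aemeasurable_sqNorm g hθ)

theorem L2Cotangent.enorm_mk_sq (g : RoughMetric I M) {θ : ∀ x : M, TangentSpace I x →L[ℝ] ℂ}
    (hθ : SqIntegrable g θ) :
    ‖L2Cotangent.mk g θ hθ‖ₑ ^ 2 = ∫⁻ x, sqNorm g θ x ∂(vol g) := by
  have h1 : ‖L2Cotangent.mk g θ hθ‖ ^ 2 = ∫ x, (cometric g x (θ x) (θ x)).re ∂(vol g) := by
    rw [@norm_sq_eq_re_inner ℂ, L2Cotangent.inner_mk]
    exact (integral_re (hθ.integrable hθ)).symm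
  rw [← ofReal_norm, ← ENNReal.ofReal_pow (norm_nonneg _), h1,
    ofReal_integral_eq_lintegral_ofReal hθ.integrable_self]
  · rfl
  · filter_upwards [ae_posDef g] with x hx using cometric_self_nonneg g x hx _

theorem L2Cotangent.exists_mk (g : RoughMetric I M) (u : L2Cotangent g) :
    ∃ (θ : ∀ x : M, TangentSpace I x →L[ℝ] ℂ) (hθ : SqIntegrable g θ),
      L2Cotangent.mk g θ hθ = u := by
  obtain ⟨θ, rfl⟩ := SeparationQuotient.surjective_mk u
  exact ⟨θ.1, θ.2, rfl⟩

theorem SqIntegrable.sub {g : RoughMetric I M}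
    {θ η : ∀ x : M, TangentSpace I x →L[ℝ] ℂ} (hθ : SqIntegrable g θ) (hη : SqIntegrable g η) :
    SqIntegrable g (θ - η) :=
  (sqIntegrableFields g).sub_mem hθ hη

theorem L2Cotangent.mk_sub (g : RoughMetric I M)
    {θ η : ∀ x : M, TangentSpace I x →L[ℝ] ℂ} (hθ : SqIntegrable g θ) (hη : SqIntegrable g η) :
    L2Cotangent.mk g (θ - η) (hθ.sub hη) = L2Cotangent.mk g θ hθ - L2Cotangent.mk g η hη :=
  rfl

theorem eLpNorm_two_sq {α F : Type*} [MeasurableSpace α] [NormedAddCommGroup F] (f : α → F)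
    (μ : Measure α) : eLpNorm f 2 μ ^ 2 = ∫⁻ x, ‖f x‖ₑ ^ 2 ∂μ := by
  have := eLpNorm_nnreal_pow_eq_lintegral (f := f) (μ := μ) (p := 2) two_ne_zero
  simpa using this

theorem IsAdapted.eLpNorm_component_le {g : RoughMetric I M} {e : OpenPartialHomeomorph M H} {c : ℝ}
    (h : IsAdapted g e c) {θ : ∀ x : M, TangentSpace I x →L[ℝ] ℂ}
    (hθ : SqIntegrable g θ) (i : Fin n) :
    eLpNorm (fun z => θ ((e.extend I).symm z) (coordVec I e z i)) 2 (chartLebesgue I e) ≤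
      ENNReal.ofReal √(c * √(c ^ n)) * ‖L2Cotangent.mk g θ hθ‖ₑ := by
  rw [← ENNReal.pow_le_pow_left_iff two_ne_zero, eLpNorm_two_sq, mul_pow, L2Cotangent.enorm_mk_sq,
    ← ENNReal.ofReal_pow (Real.sqrt_nonneg _), Real.sq_sqrt (mul_nonneg h.pos.le (Real.sqrt_nonneg _)),
    ENNReal.ofReal_mul h.pos.le]
  refine le_trans (lintegral_mono fun z => ?_) (h.lintegral_sum_enorm_sq_le hθ.1)
  exact Finset.single_le_sum (f := fun i => ‖θ ((e.extend I).symm z) (coordVec I e z i)‖ₑ ^ 2)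
    (fun _ _ => zero_le) (Finset.mem_univ i)

/-- The coordinate vectors span the tangent space, so convergence on them is convergence on every
vector, to `∑ lᵢ dψᵢ`. -/
theorem exists_tendsto_of_tendsto_coordVec {e : OpenPartialHomeomorph M H}
    (he : e ∈ IsManifold.maximalAtlas I ∞ M) {z : EuclideanSpace ℝ (Fin n)}
    (hz : z ∈ (e.extend I).target) {α : ℕ → TangentSpace I ((e.extend I).symm z) →L[ℝ] ℂ}
    {l : Fin n → ℂ} (hl : ∀ i, Tendsto (fun k => α k (coordVec I e z i)) atTop (𝓝 (l i))) :
    ∃ L : TangentSpace I ((e.extend I).symm z) →L[ℝ] ℂ,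
      ∀ u, Tendsto (fun k => α k u) atTop (𝓝 (L u)) := by
  set D := coordDeriv I e ((e.extend I).symm z) with hD
  refine ⟨∑ i, ((EuclideanSpace.proj i).comp D).smulRight (l i), fun u => ?_⟩
  have hu : u = ∑ i, (D u) i • coordVec I e z i := by
    refine coordDeriv_injective he hz ?_
    rw [← sum_smul_coordVec e z (D u)]
    exact (coordDeriv_comp he hz (D u)).symm
  have hα : ∀ k, α k u = ∑ i, (D u) i • α k (coordVec I e z i) := by
    intro k
    conv_lhs => rw [hu]
    simp only [map_sum, map_smul]
  simp only [hα, _root_.sum_apply, ContinuousLinearMap.smulRight_apply]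
  have key : ∀ a : Fin n → ℝ, ∀ β : ℕ → Fin n → ℂ, (∀ i, Tendsto (fun k => β k i) atTop (𝓝 (l i))) →
      Tendsto (fun k => ∑ i, a i • β k i) atTop (𝓝 (∑ i, a i • l i)) := fun a β hβ =>
    tendsto_finsetSum _ fun i _ => (hβ i).const_smul (a i)
  exact key (fun i => (D u) i) _ hl

theorem tendsto_cometric {g : RoughMetric I M} {x : M} {α : ℕ → TangentSpace I x →L[ℝ] ℂ}
    {L : TangentSpace I x →L[ℝ] ℂ} (h : ∀ u, Tendsto (fun k => α k u) atTop (𝓝 (L u))) :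
    Tendsto (fun k => cometric g x (α k) (α k)) atTop (𝓝 (cometric g x L L)) := by
  simp only [cometric, dualForm]
  refine tendsto_finsetSum _ fun i _ => tendsto_finsetSum _ fun j _ => ?_
  exact ((h _).const_mul _).mul ((Complex.continuous_conj.tendsto _).comp (h _))

/-- Riesz–Fischer for covector fields. For a rapidly Cauchy sequence the components converge almost
everywhere in each adapted chart. Pointwise convergence of covectors does not refer to a chart, so
the limit field is defined on `M` without gluing, and Fatou's lemma gives convergence in norm. -/
instance completeSpace_L2Cotangent (g : RoughMetric I M) : CompleteSpace (L2Cotangent g) := by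
  refine Metric.complete_of_convergent_controlled_sequences (fun k => (1 / 2 : ℝ) ^ k)
    (fun k => by positivity) fun u hu => ?_
  choose θ hθ hθu using fun k => L2Cotangent.exists_mk g (u k)
  have hdist : ∀ N k l, N ≤ k → N ≤ l →
      ‖L2Cotangent.mk g (θ k - θ l) ((hθ k).sub (hθ l))‖ₑ ≤ ENNReal.ofReal ((1 / 2) ^ N) := by
    intro N k l hk hl
    rw [L2Cotangent.mk_sub g (hθ k) (hθ l), hθu, hθu, ← ofReal_norm, ← dist_eq_norm]
    exact ENNReal.ofReal_le_ofReal (hu N k l hk hl).le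
  set P : M → Prop := fun x => ∃ L : TangentSpace I x →L[ℝ] ℂ,
    ∀ v, Tendsto (fun k => θ k x v) atTop (𝓝 (L v)) with hP
  have hconv : ∀ x, ∃ e ∈ IsManifold.maximalAtlas I ∞ M, x ∈ e.source ∧
      ∀ᵐ z ∂(chartLebesgue I e), P ((e.extend I).symm z) := by
    intro x
    obtain ⟨e, c, hx, h⟩ := exists_isAdapted g x
    refine ⟨e, h.mem, hx, ?_⟩
    have hcomp : ∀ i, ∀ᵐ z ∂(chartLebesgue I e), ∃ l : ℂ,
        Tendsto (fun k => θ k ((e.extend I).symm z) (coordVec I e z i)) atTop (𝓝 l) := by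
      intro i
      refine Lp.ae_tendsto_of_cauchy_eLpNorm (p := 2)
        -- The summand `1` makes strict the bound that `hdist` gives only as `≤`; the geometric
        -- factor keeps the sequence summable.
        (B := fun N => ENNReal.ofReal ((√(c * √(c ^ n)) + 1) * (1 / 2) ^ N))
        (fun k => ((hθ k).1 e h.mem i).aestronglyMeasurable) one_le_two ?_ ?_
      · have hs : Summable fun N : ℕ => (√(c * √(c ^ n)) + 1) * (1 / 2 : ℝ) ^ N :=
          summable_geometric_two.mul_left _
        exact hs.tsum_ofReal_ne_top
      · intro N k l hk hl
        refine lt_of_le_of_lt ((h.eLpNorm_component_le ((hθ k).sub (hθ l)) i).trans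
          (mul_le_mul_right (hdist N k l hk hl) _)) ?_
        rw [← ENNReal.ofReal_mul (Real.sqrt_nonneg _)]
        refine (ENNReal.ofReal_lt_ofReal_iff (by positivity)).2 ?_
        gcongr
        linarith
    have h3 : ∀ᵐ z ∂(chartLebesgue I e), z ∈ (e.extend I).target :=
      ae_restrict_mem (measurableSet_target e)
    filter_upwards [ae_all_iff.2 hcomp, h3] with z hz hzt
    choose l hl using hz
    exact exists_tendsto_of_tendsto_coordVec h.mem hzt hl
  classical
  set θ' : ∀ x : M, TangentSpace I x →L[ℝ] ℂ := fun x =>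
    if h : P x then h.choose else 0 with hθ'
  have hlim : ∀ x, P x →
      ∀ v, Tendsto (fun k => θ k x v) atTop (𝓝 (θ' x v)) := by
    intro x hx
    simp only [hθ', dif_pos hx]
    exact hx.choose_spec
  have hmeas : MeasurableCovectorField I θ' := by
    intro e he i
    -- Convergence is known only in adapted charts, while measurability is asked in every chart of
    -- the maximal atlas; a single exceptional set that is null in all of them bridges the gap.
    obtain ⟨T, -, hTP, hT⟩ := exists_null_superset hconv
    refine aemeasurable_of_tendsto_metrizable_ae atTop (fun k => (hθ k).1 e he i) ?_
    filter_upwards [hT e he] with z hz using hlim _ (hTP _ hz) _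
  have hae : ∀ᵐ x ∂(vol g), ∀ v, Tendsto (fun k => θ k x v) atTop (𝓝 (θ' x v)) := by
    filter_upwards [ae_vol_of_charts g hconv] with x hx using hlim x hx
  have hbound : ∀ N, ∫⁻ x, sqNorm g (θ N - θ') x ∂(vol g) ≤ ENNReal.ofReal ((1 / 2) ^ N) ^ 2 := by
    intro N
    -- Fatou's lemma along `k → ∞` with `N` fixed.
    calc ∫⁻ x, sqNorm g (θ N - θ') x ∂(vol g)
        = ∫⁻ x, liminf (fun k => sqNorm g (θ N - θ k) x) atTop ∂(vol g) := by
          refine lintegral_congr_ae ?_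
          filter_upwards [hae] with x hx
          refine (Tendsto.liminf_eq ?_).symm
          refine (ENNReal.continuous_ofReal.tendsto _).comp
            ((Complex.continuous_re.tendsto _).comp (tendsto_cometric fun v => ?_))
          exact (hx v).const_sub _
      _ ≤ liminf (fun k => ∫⁻ x, sqNorm g (θ N - θ k) x ∂(vol g)) atTop :=
          lintegral_liminf_le' fun k => aemeasurable_sqNorm g ((hθ N).sub (hθ k)).1
      _ ≤ _ := by
          refine liminf_le_of_frequently_le' (Eventually.frequently ?_)
          filter_upwards [eventually_ge_atTop N] with k hk
          rw [← L2Cotangent.enorm_mk_sq g ((hθ N).sub (hθ k))]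
          gcongr
          exact hdist N N k le_rfl hk
  have hsub : ∀ N, SqIntegrable g (θ N - θ') := fun N =>
    ⟨fun e he i => ((hθ N).1 e he i).sub (hmeas e he i), (hbound N).trans_lt (by finiteness)⟩
  have hsq : SqIntegrable g θ' := by
    have := (hθ 0).sub (hsub 0)
    rwa [sub_sub_cancel] at this
  refine ⟨L2Cotangent.mk g θ' hsq, ?_⟩
  rw [tendsto_iff_norm_sub_tendsto_zero]
  refine squeeze_zero (fun _ => norm_nonneg _) (fun N => ?_)
    (tendsto_pow_atTop_nhds_zero_of_lt_one (by norm_num : (0 : ℝ) ≤ 1 / 2) (by norm_num))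
  rw [← hθu, ← L2Cotangent.mk_sub]
  have h1 := hbound N
  rw [← L2Cotangent.enorm_mk_sq g (hsub N), ENNReal.pow_le_pow_left_iff two_ne_zero,
    ← ofReal_norm, ENNReal.ofReal_le_ofReal_iff (by positivity)] at h1
  exact h1

end Complete

/-! ### Smooth functions in charts -/

section SmoothFunctions

variable {n : ℕ} {H : Type*} [TopologicalSpace H]
  {I : ModelWithCorners ℝ (EuclideanSpace ℝ (Fin n)) H}
  {M : Type*} [TopologicalSpace M] [ChartedSpace H M]

/-- The derivative of the coordinate representation `φ ∘ ψ⁻¹` of `φ`. -/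
noncomputable def chartDeriv (I : ModelWithCorners ℝ (EuclideanSpace ℝ (Fin n)) H)
    (e : OpenPartialHomeomorph M H) (φ : M → ℂ) (z : EuclideanSpace ℝ (Fin n)) :
    EuclideanSpace ℝ (Fin n) →L[ℝ] ℂ :=
  ContinuousLinearMap.comp
    (differential I φ ((e.extend I).symm z) : EuclideanSpace ℝ (Fin n) →L[ℝ] ℂ) (symmDeriv I e z)

theorem chartDeriv_single (e : OpenPartialHomeomorph M H) (φ : M → ℂ)
    (z : EuclideanSpace ℝ (Fin n)) (i : Fin n) :
    chartDeriv I e φ z (EuclideanSpace.single i (1 : ℝ)) =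
      differential I φ ((e.extend I).symm z) (coordVec I e z i) :=
  rfl

variable [IsManifold I ∞ M]

theorem extend_target_mem_nhdsWithin_range (e : OpenPartialHomeomorph M H)
    {z : EuclideanSpace ℝ (Fin n)} (hz : z ∈ (e.extend I).target) :
    (e.extend I).target ∈ 𝓝[range I] z := by
  have := e.extend_target_mem_nhdsWithin (I := I) (extend_symm_mem e hz)
  rwa [(e.extend I).right_inv hz] at this

theorem uniqueDiffOn_extend_target (e : OpenPartialHomeomorph M H) :
    UniqueDiffOn ℝ (e.extend I).target := fun z hz =>
  (I.uniqueDiffOn z (e.extend_target_subset_range hz)).mono_nhds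
    (nhdsWithin_le_iff.2 (extend_target_mem_nhdsWithin_range e hz))

theorem hasFDerivWithinAt_chartDeriv {e : OpenPartialHomeomorph M H}
    (he : e ∈ IsManifold.maximalAtlas I ∞ M) {φ : M → ℂ} (hφ : ContMDiff I 𝓘(ℝ, ℂ) ∞ φ)
    {z : EuclideanSpace ℝ (Fin n)} (hz : z ∈ (e.extend I).target) :
    HasFDerivWithinAt (φ ∘ (e.extend I).symm) (chartDeriv I e φ z) (e.extend I).target z := by
  have h1 := ((hφ ((e.extend I).symm z)).mdifferentiableAt (by simp)).hasMFDerivAt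
  have h2 := (mdifferentiableWithinAt_extend_symm he hz).hasMFDerivWithinAt
  have h3 := (h1.comp_hasMFDerivWithinAt z h2).hasFDerivWithinAt
  exact h3.mono e.extend_target_subset_range

theorem continuousOn_chartDeriv {e : OpenPartialHomeomorph M H}
    (he : e ∈ IsManifold.maximalAtlas I ∞ M) {φ : M → ℂ} (hφ : ContMDiff I 𝓘(ℝ, ℂ) ∞ φ) :
    ContinuousOn (chartDeriv I e φ) (e.extend I).target := by
  have h1 : ContDiffOn ℝ ∞ (φ ∘ (e.extend I).symm) (e.extend I).target := by
    have := hφ.comp_contMDiffOn (contMDiffOn_extend_symm he)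
    rw [← OpenPartialHomeomorph.extend_target'] at this
    exact this.contDiffOn
  refine (h1.continuousOn_fderivWithin (uniqueDiffOn_extend_target e) (by simp)).congr
    fun z hz => ?_
  exact ((hasFDerivWithinAt_chartDeriv he hφ hz).fderivWithin
    (uniqueDiffOn_extend_target e z hz)).symm

theorem measurableCovectorField_differential {φ : M → ℂ} (hφ : ContMDiff I 𝓘(ℝ, ℂ) ∞ φ) :
    MeasurableCovectorField I (differential I φ) := fun e he i =>
  ((continuousOn_chartDeriv he hφ).clm_apply
    (continuousOn_const (c := EuclideanSpace.single i (1 : ℝ)))).aemeasurable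
    (measurableSet_target e)

/-- The operator norm of a functional is at most the Euclidean norm of its components, by
Cauchy–Schwarz. -/
theorem enorm_chartDeriv_sq_le (e : OpenPartialHomeomorph M H) (φ : M → ℂ)
    (z : EuclideanSpace ℝ (Fin n)) :
    ‖chartDeriv I e φ z‖ₑ ^ 2 ≤
      ∑ i, ‖differential I φ ((e.extend I).symm z) (coordVec I e z i)‖ₑ ^ 2 := by
  set s : ℝ := ∑ i, ‖differential I φ ((e.extend I).symm z) (coordVec I e z i)‖ ^ 2 with hs
  have hsum : ∑ i, ‖differential I φ ((e.extend I).symm z) (coordVec I e z i)‖ₑ ^ 2 =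
      ENNReal.ofReal s := by
    rw [hs, ENNReal.ofReal_sum_of_nonneg fun _ _ => sq_nonneg _]
    refine Finset.sum_congr rfl fun i _ => ?_
    rw [ENNReal.ofReal_pow (norm_nonneg _), ofReal_norm]
  have hs0 : 0 ≤ s := Finset.sum_nonneg fun _ _ => sq_nonneg _
  rw [hsum, ← ofReal_norm, ← ENNReal.ofReal_pow (norm_nonneg _)]
  refine ENNReal.ofReal_le_ofReal ?_
  rw [← Real.le_sqrt (norm_nonneg _) hs0]
  refine ContinuousLinearMap.opNorm_le_bound _ (Real.sqrt_nonneg _) fun v => ?_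
  have hv : chartDeriv I e φ z v =
      ∑ i, v i • differential I φ ((e.extend I).symm z) (coordVec I e z i) := by
    have h : v = ∑ i, v i • EuclideanSpace.single i (1 : ℝ) := by
      have := (EuclideanSpace.basisFun (Fin n) ℝ).sum_repr v
      simpa using this.symm
    conv_lhs => rw [h]
    simp only [map_sum, map_smul, chartDeriv_single]
  rw [hv, hs, mul_comm, EuclideanSpace.norm_eq]
  refine (norm_sum_le _ _).trans ?_
  simp only [norm_smul]
  exact Real.sum_mul_le_sqrt_mul_sqrt _ _ _

theorem enorm_differential_coordVec_le (e : OpenPartialHomeomorph M H) (φ : M → ℂ)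
    (z : EuclideanSpace ℝ (Fin n)) (i : Fin n) :
    ‖differential I φ ((e.extend I).symm z) (coordVec I e z i)‖ₑ ≤ ‖chartDeriv I e φ z‖ₑ := by
  rw [← chartDeriv_single]
  refine (ContinuousLinearMap.le_opENorm _ _).trans_eq ?_
  rw [← ofReal_norm (EuclideanSpace.single i (1 : ℝ))]
  simp

variable [CompactSpace M] [MeasurableSpace M] [BorelSpace M]

/-- Near each point the coordinate components of `dφ` are bounded by continuity, `|dφ|_g` is
comparable to them, and the measure is finite; compactness of `M` makes this global. -/
theorem sqIntegrable_differential (g : RoughMetric I M) {φ : M → ℂ}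
    (hφ : ContMDiff I 𝓘(ℝ, ℂ) ∞ φ) : SqIntegrable g (differential I φ) := by
  refine ⟨measurableCovectorField_differential hφ, ?_⟩
  change ∫⁻ x, sqNorm g (differential I φ) x ∂(vol g) < ⊤
  rw [← setLIntegral_univ]
  refine isCompact_univ.induction_on
    (p := fun s => ∫⁻ x in s, sqNorm g (differential I φ) x ∂(vol g) < ⊤) ?_ ?_ ?_ ?_
  · simp
  · exact fun s t hst ht => (lintegral_mono_set hst).trans_lt ht
  · exact fun s t hs ht => (lintegral_union_le _ s t).trans_lt (ENNReal.add_lt_top.2 ⟨hs, ht⟩)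
  · intro x _
    obtain ⟨e, c, hx, h⟩ := exists_isAdapted g x
    set z₀ := e.extend I x with hz₀
    have hz₀t : z₀ ∈ (e.extend I).target := (e.extend I).map_source
      (by rwa [OpenPartialHomeomorph.extend_source])
    set B : ℝ := ‖chartDeriv I e φ z₀‖ + 1 with hB
    have h1 := ((continuousOn_chartDeriv h.mem hφ).norm z₀ hz₀t).eventually
      (gt_mem_nhds (lt_add_one _))
    obtain ⟨O, hO, hzO, hOB⟩ := mem_nhdsWithin.1 h1
    set U : Set M := e.source ∩ e.extend I ⁻¹' O with hU
    have hUo : IsOpen U := e.isOpen_extend_preimage hO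
    refine ⟨U, nhdsWithin_le_nhds (hUo.mem_nhds ⟨hx, hzO⟩), ?_⟩
    have hm := (aemeasurable_sqNorm g (measurableCovectorField_differential hφ)).indicator
      hUo.measurableSet
    have hle : ∫⁻ x in U, sqNorm g (differential I φ) x ∂(vol g) ≤
        ∫⁻ x in e.source, U.indicator (sqNorm g (differential I φ)) x ∂(vol g) := by
      rw [← lintegral_indicator hUo.measurableSet, ← lintegral_indicator
        e.open_source.measurableSet, indicator_indicator, inter_eq_right.2 inter_subset_left]
    refine (hle.trans (h.lintegral_source_le hm)).trans_lt
      (ENNReal.mul_lt_top ENNReal.ofReal_lt_top ?_)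
    have h3 : ∀ᵐ z ∂(chartLebesgue I e), z ∈ (e.extend I).target :=
      ae_restrict_mem (measurableSet_target e)
    have hbd : ∫⁻ z, U.indicator (sqNorm g (differential I φ)) ((e.extend I).symm z)
        ∂(chartLebesgue I e) ≤ ∫⁻ _, ENNReal.ofReal c * ∑ _i : Fin n, ENNReal.ofReal B ^ 2
          ∂(chartLebesgue I e) := by
      refine lintegral_mono_ae ?_
      filter_upwards [h.sum_enorm_sq_le, h3] with z hz hzt
      by_cases hzU : (e.extend I).symm z ∈ U
      · rw [indicator_of_mem hzU]
        refine (hz (differential I φ)).2.trans ?_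
        have hzO : z ∈ O := by
          have : e.extend I ((e.extend I).symm z) ∈ O := hzU.2
          rwa [(e.extend I).right_inv hzt] at this
        gcongr with i
        refine (enorm_differential_coordVec_le e φ z i).trans ?_
        rw [← ofReal_norm]
        exact ENNReal.ofReal_le_ofReal (hOB ⟨hzO, hzt⟩).le
      · rw [indicator_of_notMem hzU]
        exact zero_le
    refine hbd.trans_lt ?_
    rw [lintegral_const]
    refine ENNReal.mul_lt_top ?_ h.chartLebesgue_univ_lt_top
    simp
    finiteness

end SmoothFunctions

/-! ### Closability of the differential -/

section Closable

theorem enorm_integral_smul_le {α : Type*} [MeasurableSpace α] {μ : Measure α} {χ : α → ℝ}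
    {f : α → ℂ} (hχ : AEStronglyMeasurable χ μ) (hf : AEStronglyMeasurable f μ) :
    ‖∫ x, χ x • f x ∂μ‖ₑ ≤ eLpNorm χ 2 μ * eLpNorm f 2 μ := by
  have h := eLpNorm_smul_le_mul_eLpNorm (p := 2) (q := 2) (r := 1) hf hχ
  rw [eLpNorm_one_eq_lintegral_enorm] at h
  exact (enorm_integral_le_lintegral_enorm _).trans h

variable {n : ℕ} {H : Type*} [TopologicalSpace H]
  {I : ModelWithCorners ℝ (EuclideanSpace ℝ (Fin n)) H}
  {M : Type*} [TopologicalSpace M] [ChartedSpace H M] [IsManifold I ∞ M]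

/-- Integration by parts in a chart. -/
theorem integral_chart_smul_differential {e : OpenPartialHomeomorph M H}
    (he : e ∈ IsManifold.maximalAtlas I ∞ M) {φ : M → ℂ} (hφ : ContMDiff I 𝓘(ℝ, ℂ) ∞ φ)
    {χ : EuclideanSpace ℝ (Fin n) → ℝ} (hχ : ContDiff ℝ ∞ χ) (hc : HasCompactSupport χ)
    (hs : tsupport χ ⊆ interior (e.extend I).target) (i : Fin n) :
    ∫ z, χ z • differential I φ ((e.extend I).symm z) (coordVec I e z i) ∂(chartLebesgue I e) =
      -∫ z, fderiv ℝ χ z (EuclideanSpace.single i (1 : ℝ)) • φ ((e.extend I).symm z)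
        ∂(chartLebesgue I e) := by
  set v : EuclideanSpace ℝ (Fin n) := EuclideanSpace.single i (1 : ℝ) with hv
  set f : EuclideanSpace ℝ (Fin n) → ℂ := φ ∘ (e.extend I).symm with hf
  have hst : tsupport χ ⊆ (e.extend I).target := hs.trans interior_subset
  have hsχ : ∀ z ∉ (e.extend I).target, χ z = 0 := fun z hz =>
    image_eq_zero_of_notMem_tsupport fun h => hz (hst h)
  have hsχ' : ∀ z ∉ (e.extend I).target, fderiv ℝ χ z = 0 := fun z hz =>
    image_eq_zero_of_notMem_tsupport fun h => hz (hst (tsupport_fderiv_subset ℝ h))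
  have hd : ∀ z ∈ interior (e.extend I).target, HasFDerivAt f (chartDeriv I e φ z) z :=
    fun z hz => (hasFDerivWithinAt_chartDeriv he hφ (interior_subset hz)).hasFDerivAt
      (mem_interior_iff_mem_nhds.1 hz)
  have hfc : ContinuousOn f (tsupport χ) := fun z hz =>
    (hd z (hs hz)).continuousAt.continuousWithinAt
  have hdc : ContinuousOn (fun z => fderiv ℝ f z v) (tsupport χ) := by
    have : ContinuousOn (fun z => chartDeriv I e φ z v) (tsupport χ) :=
      ((continuousOn_chartDeriv he hφ).mono hst).clm_apply continuousOn_const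
    exact this.congr fun z hz => by rw [(hd z (hs hz)).fderiv]
  have hint : ∀ (a : EuclideanSpace ℝ (Fin n) → ℝ) (b : EuclideanSpace ℝ (Fin n) → ℂ),
      Continuous a → tsupport a ⊆ tsupport χ → ContinuousOn b (tsupport χ) →
      Integrable (fun z => a z • b z) := by
    intro a b ha hsa hb
    have h1 : IntegrableOn (fun z => a z • b z) (tsupport χ) :=
      (ha.continuousOn.smul hb).integrableOn_compact hc
    refine (integrableOn_iff_integrable_of_support_subset fun z hz => ?_).1 h1
    by_contra hz'
    refine hz ?_
    have : a z = 0 := image_eq_zero_of_notMem_tsupport fun h => hz' (hsa h)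
    simp [this]
  have hχ'c : Continuous fun z => fderiv ℝ χ z v :=
    (hχ.continuous_fderiv (by simp)).clm_apply continuous_const
  -- The coordinate representation `f` is known to be differentiable only in the interior of the
  -- chart image. That suffices, since `tsupport χ` lies there, and no boundary term appears.
  have hparts := integral_smul_fderiv_eq_neg_fderiv_smul_of_integrable (μ := volume) (f := χ)
    (g := f) (v := v)
    (hint _ _ hχ'c ((closure_mono (fun z hz => by
      rw [Function.mem_support] at hz ⊢
      intro h0
      exact hz (by rw [h0]; rfl))).trans (tsupport_fderiv_subset ℝ)) hfc)
    (hint _ _ hχ.continuous subset_rfl hdc) (hint _ _ hχ.continuous subset_rfl hfc)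
    (fun z _ => (hχ.differentiable (by simp)) z) (fun z hz => (hd z (hs hz)).differentiableAt)
  have h1 : ∫ z, χ z • differential I φ ((e.extend I).symm z) (coordVec I e z i)
      ∂(chartLebesgue I e) = ∫ z, χ z • fderiv ℝ f z v := by
    rw [chartLebesgue, setIntegral_eq_integral_of_forall_compl_eq_zero
      (fun z hz => by rw [hsχ z hz, zero_smul])]
    refine integral_congr_ae (ae_of_all _ fun z => ?_)
    by_cases hz : z ∈ tsupport χ
    · simp only
      rw [(hd z (hs hz)).fderiv, hv, chartDeriv_single]
    · simp only
      rw [image_eq_zero_of_notMem_tsupport hz, zero_smul, zero_smul]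
  have h2 : ∫ z, fderiv ℝ χ z v • φ ((e.extend I).symm z) ∂(chartLebesgue I e) =
      ∫ z, fderiv ℝ χ z v • f z := by
    rw [chartLebesgue, setIntegral_eq_integral_of_forall_compl_eq_zero
      (fun z hz => by rw [hsχ' z hz]; simp)]
    rfl
  rw [h1, h2, hparts]

variable [CompactSpace M] [MeasurableSpace M] [BorelSpace M]

theorem IsAdapted.eLpNorm_comp_symm_le {g : RoughMetric I M} {e : OpenPartialHomeomorph M H} {c : ℝ}
    (h : IsAdapted g e c) {f : M → ℂ} (hf : AEStronglyMeasurable f (vol g)) :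
    eLpNorm (fun z => f ((e.extend I).symm z)) 2 (chartLebesgue I e) ≤
      ENNReal.ofReal √√(c ^ n) * eLpNorm f 2 (vol g) := by
  rw [← ENNReal.pow_le_pow_left_iff two_ne_zero, mul_pow, eLpNorm_two_sq, eLpNorm_two_sq,
    ← ENNReal.ofReal_pow (Real.sqrt_nonneg _), Real.sq_sqrt (Real.sqrt_nonneg _)]
  exact h.lintegral_chart_le (hf.aemeasurable.enorm.pow_const 2)

/-- The heart of closability. Let `φ k → 0` and `dφ k → θ` in `L²`. Integration by parts moves the
derivative to `χ`, and `∫ ∂ᵢχ φ k → 0`. The pairing uses Lebesgue measure, which contains no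
coefficient of `g`; comparability serves only to bound the errors by the two `L²` norms. -/
theorem IsAdapted.integral_smul_eq_zero {g : RoughMetric I M} {e : OpenPartialHomeomorph M H}
    {c : ℝ} (h : IsAdapted g e c) {θ : ∀ x : M, TangentSpace I x →L[ℝ] ℂ}
    (hθ : SqIntegrable g θ)
    (hcl : ((0 : L2 g), L2Cotangent.mk g θ hθ) ∈ closure (smoothGraph g univ : Set _))
    {χ : EuclideanSpace ℝ (Fin n) → ℝ} (hχ : ContDiff ℝ ∞ χ) (hc : HasCompactSupport χ)
    (hs : tsupport χ ⊆ interior (e.extend I).target) (i : Fin n) :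
    ∫ z, χ z • θ ((e.extend I).symm z) (coordVec I e z i) ∂(chartLebesgue I e) = 0 := by
  obtain ⟨w, hw, hlim⟩ := mem_closure_iff_seq_limit.1 hcl
  choose φ hφ _ hφ1 hφ2 hφ3 using hw
  set v : EuclideanSpace ℝ (Fin n) := EuclideanSpace.single i (1 : ℝ) with hv
  set χ' : EuclideanSpace ℝ (Fin n) → ℝ := fun z => fderiv ℝ χ z v with hχ'
  have hχ'c : Continuous χ' := (hχ.continuous_fderiv (by simp)).clm_apply continuous_const
  have hχ's : HasCompactSupport χ' := hc.fderiv_apply ℝ v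
  have hmem : MemLp χ 2 (chartLebesgue I e) :=
    (hχ.continuous.memLp_of_hasCompactSupport (p := 2) (μ := volume) hc).mono_measure
      Measure.restrict_le_self
  have hmem' : MemLp χ' 2 (chartLebesgue I e) :=
    (hχ'c.memLp_of_hasCompactSupport (p := 2) (μ := volume) hχ's).mono_measure
      Measure.restrict_le_self
  have hfin := h.chartLebesgue_univ_lt_top
  have : IsFiniteMeasure (chartLebesgue I e) := ⟨hfin⟩
  have hmθ : ∀ {η : ∀ x : M, TangentSpace I x →L[ℝ] ℂ}, SqIntegrable g η →
      MemLp (fun z => η ((e.extend I).symm z) (coordVec I e z i)) 2 (chartLebesgue I e) :=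
    fun {η} hη => ⟨(hη.1 e h.mem i).aestronglyMeasurable,
      (h.eLpNorm_component_le hη i).trans_lt (by finiteness)⟩
  have hmφ : ∀ k, AEStronglyMeasurable (fun z => φ k ((e.extend I).symm z)) (chartLebesgue I e) :=
    fun k => ((hφ k).continuous.comp_continuousOn (e.continuousOn_extend_symm
      (I := I))).aestronglyMeasurable (measurableSet_target e)
  have hbound : ∀ k, ‖∫ z, χ z • θ ((e.extend I).symm z) (coordVec I e z i)
      ∂(chartLebesgue I e)‖ₑ ≤
      eLpNorm χ 2 (chartLebesgue I e) *
        (ENNReal.ofReal √(c * √(c ^ n)) * ‖L2Cotangent.mk g θ hθ - (w k).2‖ₑ) +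
      eLpNorm χ' 2 (chartLebesgue I e) * (ENNReal.ofReal √√(c ^ n) * ‖(w k).1‖ₑ) := by
    intro k
    have hint : ∀ {η : ∀ x : M, TangentSpace I x →L[ℝ] ℂ}, SqIntegrable g η → Integrable
        (fun z => χ z • η ((e.extend I).symm z) (coordVec I e z i)) (chartLebesgue I e) :=
      fun {η} hη => memLp_one_iff_integrable.1 ((hmθ hη).smul hmem)
    have heq : ∫ z, χ z • θ ((e.extend I).symm z) (coordVec I e z i) ∂(chartLebesgue I e) =
        (∫ z, χ z • (θ - differential I (φ k)) ((e.extend I).symm z) (coordVec I e z i)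
          ∂(chartLebesgue I e)) - ∫ z, χ' z • φ k ((e.extend I).symm z) ∂(chartLebesgue I e) := by
      have h1 : _ = -∫ z, χ' z • φ k ((e.extend I).symm z) ∂(chartLebesgue I e) :=
        integral_chart_smul_differential h.mem (hφ k) hχ hc hs i
      have h2 := integral_sub (hint hθ) (hint (hφ2 k))
      rw [h1, sub_neg_eq_add] at h2
      rw [eq_sub_iff_add_eq, ← h2]
      exact integral_congr_ae (ae_of_all _ fun z => (smul_sub _ _ _).symm)
    rw [heq]
    refine enorm_sub_le.trans (add_le_add ?_ ?_)
    · refine (enorm_integral_smul_le hmem.1 (hmθ (hθ.sub (hφ2 k))).1).trans ?_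
      gcongr
      rw [hφ3]
      exact h.eLpNorm_component_le (hθ.sub (hφ2 k)) i
    · refine (enorm_integral_smul_le hmem'.1 (hmφ k)).trans ?_
      gcongr
      rw [Lp.enorm_def, eLpNorm_congr_ae (hφ1 k)]
      exact h.eLpNorm_comp_symm_le (hφ k).continuous.aestronglyMeasurable
  have hlim0 : Tendsto (fun k => eLpNorm χ 2 (chartLebesgue I e) *
        (ENNReal.ofReal √(c * √(c ^ n)) * ‖L2Cotangent.mk g θ hθ - (w k).2‖ₑ) +
      eLpNorm χ' 2 (chartLebesgue I e) * (ENNReal.ofReal √√(c ^ n) * ‖(w k).1‖ₑ)) atTop (𝓝 0) := by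
    have h1 : Tendsto (fun k => ‖L2Cotangent.mk g θ hθ - (w k).2‖ₑ) atTop (𝓝 0) := by
      have := (((continuous_snd.tendsto _).comp hlim).const_sub (L2Cotangent.mk g θ hθ)).enorm
      simpa using this
    have h2 : Tendsto (fun k => ‖(w k).1‖ₑ) atTop (𝓝 0) := by
      have := ((continuous_fst.tendsto _).comp hlim).enorm
      simpa using this
    have h3 := ENNReal.Tendsto.const_mul (ENNReal.Tendsto.const_mul h1
      (Or.inr (ENNReal.ofReal_ne_top (r := √(c * √(c ^ n)))))) (Or.inr hmem.2.ne)
    have h4 := ENNReal.Tendsto.const_mul (ENNReal.Tendsto.const_mul h2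
      (Or.inr (ENNReal.ofReal_ne_top (r := √√(c ^ n))))) (Or.inr hmem'.2.ne)
    simpa using h3.add h4
  have := ge_of_tendsto' hlim0 hbound
  simpa using this

theorem IsAdapted.component_ae_eq_zero {g : RoughMetric I M} {e : OpenPartialHomeomorph M H}
    {c : ℝ} (h : IsAdapted g e c) {θ : ∀ x : M, TangentSpace I x →L[ℝ] ℂ}
    (hθ : SqIntegrable g θ)
    (hcl : ((0 : L2 g), L2Cotangent.mk g θ hθ) ∈ closure (smoothGraph g univ : Set _))
    (i : Fin n) :
    ∀ᵐ z ∂(chartLebesgue I e), θ ((e.extend I).symm z) (coordVec I e z i) = 0 := by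
  have : IsFiniteMeasure (chartLebesgue I e) := ⟨h.chartLebesgue_univ_lt_top⟩
  have hint : Integrable (fun z => θ ((e.extend I).symm z) (coordVec I e z i))
      (chartLebesgue I e) := by
    refine MemLp.integrable one_le_two ⟨(hθ.1 e h.mem i).aestronglyMeasurable,
      (h.eLpNorm_component_le hθ i).trans_lt (by finiteness)⟩
  have hint' : IntegrableOn (fun z => θ ((e.extend I).symm z) (coordVec I e z i))
      (e.extend I).target := hint
  -- The fundamental lemma of the calculus of variations covers the interior of the chart image.
  -- What remains lies in the frontier of a convex set, which is a null set.
  have h0 := (isOpen_interior (s := (e.extend I).target)).ae_eq_zero_of_integral_contDiff_smul_eq_zero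
    (hint'.mono_set interior_subset).locallyIntegrableOn (fun χ hχ hc hs => by
      rw [← h.integral_smul_eq_zero hθ hcl hχ hc hs i, chartLebesgue,
        setIntegral_eq_integral_of_forall_compl_eq_zero]
      intro z hz
      rw [image_eq_zero_of_notMem_tsupport fun h => hz (interior_subset (hs h)), zero_smul])
  have hfr : ∀ᵐ z ∂(volume : Measure (EuclideanSpace ℝ (Fin n))),
      z ∉ frontier (e.extend I).target := by
    rw [ae_iff]
    simpa using h.convex.addHaar_frontier volume
  rw [chartLebesgue, ae_restrict_iff' (measurableSet_target e)]
  filter_upwards [h0, hfr] with z hz hzf hzt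
  refine hz ?_
  by_contra hzi
  exact hzf ⟨subset_closure hzt, hzi⟩

/-- This is the closability of the differential: a limit of pairs `(φ k, dφ k)` with `φ k → 0` has
vanishing components in adapted charts, hence `|θ|_g = 0` almost everywhere. -/
theorem snd_eq_zero_of_mem_closure_smoothGraph (g : RoughMetric I M) {u : L2Cotangent g}
    (hu : ((0 : L2 g), u) ∈ closure (smoothGraph g univ : Set _)) : u = 0 := by
  obtain ⟨θ, hθ, rfl⟩ := L2Cotangent.exists_mk g u
  have h0 : ∀ᵐ x ∂(vol g), sqNorm g θ x = 0 := by
    refine ae_vol_of_charts g fun x => ?_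
    obtain ⟨e, c, hx, h⟩ := exists_isAdapted g x
    refine ⟨e, h.mem, hx, ?_⟩
    filter_upwards [h.sum_enorm_sq_le, ae_all_iff.2 (h.component_ae_eq_zero hθ hu)] with z hz hz0
    refine le_antisymm ((hz θ).2.trans_eq ?_) zero_le
    simp only [hz0, enorm_zero, ne_eq, OfNat.ofNat_ne_zero, not_false_eq_true, zero_pow,
      Finset.sum_const_zero, mul_zero]
  have h1 := L2Cotangent.enorm_mk_sq g hθ
  rw [lintegral_congr_ae h0, lintegral_zero] at h1
  simpa using h1

end Closable

/-! ### Density of `H¹₀(M)` -/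

section Density

variable {n : ℕ} {H : Type*} [TopologicalSpace H]
  {I : ModelWithCorners ℝ (EuclideanSpace ℝ (Fin n)) H}
  {M : Type*} [TopologicalSpace M] [ChartedSpace H M] [IsManifold I ∞ M]
  [CompactSpace M] [MeasurableSpace M] [BorelSpace M]

/-- The boundary is a null set. -/
theorem ae_mem_interior (g : RoughMetric I M) : ∀ᵐ x ∂(vol g), x ∈ I.interior M := by
  refine ae_vol_of_charts g fun x => ⟨chartAt H x, IsManifold.chart_mem_maximalAtlas x,
    mem_chart_source H x, ?_⟩
  set e := chartAt H x
  -- The frontier of the convex set `range I` is null. At an interior point of `range I` the chart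
  -- image is a full neighbourhood, so the corresponding point is interior in `M`.
  have hfr : ∀ᵐ z ∂(volume : Measure (EuclideanSpace ℝ (Fin n))), z ∉ frontier (range I) := by
    rw [ae_iff]
    simpa using I.convex_range.addHaar_frontier volume
  rw [chartLebesgue, ae_restrict_iff' (measurableSet_target e)]
  filter_upwards [hfr] with z hz hzt
  have hzr := e.extend_target_subset_range hzt
  have hzi : z ∈ interior (range I) := by
    by_contra h
    exact hz ⟨subset_closure hzr, h⟩
  have h1 : (e.extend I).target ∈ 𝓝 z := by
    have := extend_target_mem_nhdsWithin_range e hzt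
    rwa [nhdsWithin_eq_nhds.2 (mem_interior_iff_mem_nhds.1 hzi)] at this
  have : IsManifold I 1 M := IsManifold.of_le (n := ∞) (by simp)
  have hiff := ModelWithCorners.isInteriorPoint_iff_of_mem_atlas (I := I) (n := 1) (by simp)
    (chart_mem_atlas H x) (extend_symm_mem e hzt)
  refine hiff.2 ?_
  rw [(e.extend I).right_inv hzt]
  exact mem_interior_iff_mem_nhds.2 h1

theorem memLp_of_contMDiff (g : RoughMetric I M) {φ : M → ℂ} (hφ : ContMDiff I 𝓘(ℝ, ℂ) ∞ φ) :
    MemLp φ 2 (vol g) := by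
  obtain ⟨C, hC⟩ := isCompact_univ.exists_bound_of_continuousOn hφ.continuous.continuousOn
  exact MemLp.of_bound hφ.continuous.aestronglyMeasurable C (ae_of_all _ fun x => hC x (mem_univ x))

theorem toLp_mem_H10 (g : RoughMetric I M) {φ : M → ℂ} (hφ : ContMDiff I 𝓘(ℝ, ℂ) ∞ φ)
    (hs : tsupport φ ⊆ I.interior M) : (memLp_of_contMDiff g hφ).toLp φ ∈ H10 g := by
  refine (LinearPMap.le_closure (gradCompact g)).1 ?_
  rw [gradCompact, Submodule.toLinearPMap_domain]
  exact ⟨((memLp_of_contMDiff g hφ).toLp φ,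
    L2Cotangent.mk g (differential I φ) (sqIntegrable_differential g hφ)),
    ⟨φ, hφ, hs, MemLp.coeFn_toLp (memLp_of_contMDiff g hφ), sqIntegrable_differential g hφ, rfl⟩,
    rfl⟩

/-- A function orthogonal to `H¹₀(M)` integrates to zero against all real test functions supported
in the interior, so it vanishes almost everywhere there, and the boundary is a null set. -/
theorem dense_H10 [T2Space M] (g : RoughMetric I M) : Dense (H10 g : Set (L2 g)) := by
  rw [Submodule.dense_iff_topologicalClosure_eq_top, Submodule.topologicalClosure_eq_top_iff,
    Submodule.eq_bot_iff]
  intro f hf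
  have : IsManifold I 1 M := IsManifold.of_le (n := ∞) (by simp)
  have hio : IsOpen (I.interior M) := ModelWithCorners.isOpen_interior (n := 1) (by simp)
  have hfi : Integrable f (vol g) := (Lp.memLp f).integrable one_le_two
  have h0 := hio.ae_eq_zero_of_integral_contMDiff_smul_eq_zero I (μ := vol g) (f := f)
    (hfi.locallyIntegrable.locallyIntegrableOn _) fun χ hχ _ hs => by
      have hφ : ContMDiff I 𝓘(ℝ, ℂ) ∞ fun x => (χ x : ℂ) :=
        Complex.ofRealCLM.contDiff.contMDiff.comp hχ
      have hs' : tsupport (fun x => (χ x : ℂ)) ⊆ I.interior M := by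
        refine (closure_mono fun x hx => ?_).trans hs
        simpa using hx
      have h1 := (Submodule.mem_orthogonal _ _).1 hf _ (toLp_mem_H10 g hφ hs')
      rw [L2.inner_def] at h1
      rw [← h1]
      refine integral_congr_ae ?_
      filter_upwards [(memLp_of_contMDiff g hφ).coeFn_toLp] with x hx
      rw [hx]
      simp [mul_comm]
  rw [Lp.eq_zero_iff_ae_eq_zero]
  filter_upwards [h0, ae_mem_interior g] with x hx hxi using hx hxi

end Density

/-! ### Poincaré inequality on a coordinate cell -/

section Cell

variable {n : ℕ} {H : Type*} [TopologicalSpace H]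
  {I : ModelWithCorners ℝ (EuclideanSpace ℝ (Fin n)) H}
  {M : Type*} [TopologicalSpace M] [ChartedSpace H M] [IsManifold I ∞ M]
  [CompactSpace M] [MeasurableSpace M] [BorelSpace M]

/-- The subset of a chart domain whose coordinates lie in `Q`. -/
def chartCell (I : ModelWithCorners ℝ (EuclideanSpace ℝ (Fin n)) H)
    (e : OpenPartialHomeomorph M H) (Q : Set (EuclideanSpace ℝ (Fin n))) : Set M :=
  e.source ∩ e.extend I ⁻¹' Q

theorem measurableSet_chartCell (e : OpenPartialHomeomorph M H)
    {Q : Set (EuclideanSpace ℝ (Fin n))} (hQ : MeasurableSet Q) :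
    MeasurableSet (chartCell I e Q) := by
  have h1 : ContinuousOn (e.extend I) e.source := by
    simpa only [OpenPartialHomeomorph.extend_source] using e.continuousOn_extend (I := I)
  have h2 := h1.domRestrict.measurable hQ
  have h3 := (MeasurableEmbedding.subtype_coe e.open_source.measurableSet).measurableSet_image' h2
  convert! h3 using 1
  ext y
  simp [chartCell, and_comm]

theorem symm_mem_chartCell_iff (e : OpenPartialHomeomorph M H)
    {Q : Set (EuclideanSpace ℝ (Fin n))} {z : EuclideanSpace ℝ (Fin n)}
    (hz : z ∈ (e.extend I).target) : (e.extend I).symm z ∈ chartCell I e Q ↔ z ∈ Q := by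
  rw [chartCell, mem_inter_iff, mem_preimage, (e.extend I).right_inv hz]
  exact and_iff_right (extend_symm_mem e hz)

theorem pullLebesgue_restrict_chartCell (e : OpenPartialHomeomorph M H)
    {Q : Set (EuclideanSpace ℝ (Fin n))} (hQm : MeasurableSet Q) (hQ : Q ⊆ (e.extend I).target) :
    (pullLebesgue I e).restrict (chartCell I e Q) = (volume.restrict Q).map (e.extend I).symm := by
  ext S hS
  rw [Measure.restrict_apply hS, pullLebesgue_apply e (hS.inter (measurableSet_chartCell e hQm)),
    Measure.map_apply_of_aemeasurable
      ((aemeasurable_extend_symm e).mono_measure (Measure.restrict_mono hQ le_rfl)) hS,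
    Measure.restrict_apply' hQm]
  congr 1
  ext z
  constructor
  · rintro ⟨h1, h2, h3⟩
    exact ⟨h2, (symm_mem_chartCell_iff e h1).1 h3⟩
  · rintro ⟨h1, h2⟩
    exact ⟨hQ h2, h1, (symm_mem_chartCell_iff e (hQ h2)).2 h2⟩

variable {g : RoughMetric I M} {e : OpenPartialHomeomorph M H} {c : ℝ}
  {Q : Set (EuclideanSpace ℝ (Fin n))}

/-- This direction needs only the inequality `lintegral_map_le`, valid for every `F`. It can
therefore be applied to the inner integral in a double integral without checking measurability. -/
theorem IsAdapted.lintegral_chartCell_le (h : IsAdapted g e c) (hQm : MeasurableSet Q)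
    (hQ : Q ⊆ (e.extend I).target) (F : M → ℝ≥0∞) :
    ∫⁻ x in chartCell I e Q, F x ∂(vol g) ≤
      ENNReal.ofReal √(c ^ n) * ∫⁻ z in Q, F ((e.extend I).symm z) := by
  have h1 : (vol g).restrict (chartCell I e Q) ≤
      ENNReal.ofReal √(c ^ n) • (volume.restrict Q).map (e.extend I).symm := by
    rw [← pullLebesgue_restrict_chartCell e hQm hQ, ← Measure.restrict_smul]
    have := Measure.restrict_mono (s := chartCell I e Q) le_rfl h.vol_restrict_le
    have hqe : chartCell I e Q ∩ e.source = chartCell I e Q := inter_eq_left.2 inter_subset_left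
    rwa [Measure.restrict_restrict (measurableSet_chartCell e hQm), hqe] at this
  refine (lintegral_mono' h1 le_rfl).trans ?_
  rw [lintegral_smul_measure, smul_eq_mul]
  gcongr
  exact lintegral_map_le _ _

theorem IsAdapted.lintegral_cell_le (h : IsAdapted g e c) (hQm : MeasurableSet Q)
    (hQ : Q ⊆ (e.extend I).target) {F : M → ℝ≥0∞} (hF : AEMeasurable F (vol g)) :
    ∫⁻ z in Q, F ((e.extend I).symm z) ≤
      ENNReal.ofReal √(c ^ n) * ∫⁻ x in chartCell I e Q, F x ∂(vol g) := by
  have hq := measurableSet_chartCell (I := I) e hQm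
  have h1 := h.lintegral_chart_le (hF.indicator hq)
  rw [lintegral_indicator hq] at h1
  refine le_trans ?_ h1
  refine le_trans (setLIntegral_mono_ae' hQm (g := fun z =>
    (chartCell I e Q).indicator F ((e.extend I).symm z)) (ae_of_all _ fun z hz => ?_))
    (lintegral_mono' (Measure.restrict_mono hQ le_rfl) le_rfl)
  rw [indicator_of_mem ((symm_mem_chartCell_iff e (hQ hz)).2 hz)]

theorem IsAdapted.volume_cell_le (h : IsAdapted g e c) (hQm : MeasurableSet Q)
    (hQ : Q ⊆ (e.extend I).target) :
    volume Q ≤ ENNReal.ofReal √(c ^ n) * vol g (chartCell I e Q) := by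
  simpa using h.lintegral_cell_le hQm hQ (F := fun _ => 1) aemeasurable_const

theorem IsAdapted.lintegral_chartDeriv_le (h : IsAdapted g e c) (hQm : MeasurableSet Q)
    (hQ : Q ⊆ (e.extend I).target) {φ : M → ℂ} (hφ : ContMDiff I 𝓘(ℝ, ℂ) ∞ φ) :
    ∫⁻ z in Q, ‖chartDeriv I e φ z‖ₑ ^ 2 ≤ ENNReal.ofReal c * (ENNReal.ofReal √(c ^ n) *
      ∫⁻ x in chartCell I e Q, sqNorm g (differential I φ) x ∂(vol g)) := by
  calc _ ≤ ∫⁻ z in Q, ENNReal.ofReal c * sqNorm g (differential I φ) ((e.extend I).symm z) := by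
        refine lintegral_mono_ae ?_
        have := ae_mono (Measure.restrict_mono (μ := volume) hQ le_rfl) h.sum_enorm_sq_le
        filter_upwards [this] with z hz
        exact (enorm_chartDeriv_sq_le e φ z).trans (hz (differential I φ)).1
    _ ≤ _ := by
        rw [lintegral_const_mul' _ _ ENNReal.ofReal_ne_top]
        gcongr
        exact h.lintegral_cell_le hQm hQ
          (aemeasurable_sqNorm g (measurableCovectorField_differential hφ))

/-- The constant in `IsAdapted.poincare`. -/
noncomputable def poincareConst (n : ℕ) (c : ℝ) : ℝ≥0∞ :=
  2 * (2 ^ n * (ENNReal.ofReal c * ENNReal.ofReal √(c ^ n) ^ 4))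

theorem poincareConst_ne_top (n : ℕ) (c : ℝ) : poincareConst n c ≠ ⊤ := by
  unfold poincareConst
  finiteness

/-- The Euclidean oscillation estimate on `Q`, transported to `M` and inserted in the variance
bound. Of the four factors `√(c ^ n)` in `poincareConst`, two come from the double integral, one
from the volume of `Q` and one from the Dirichlet integral; `c` comes from the scalar product on
covectors, `2 ^ n` from the Euclidean estimate and `2` from the variance bound. -/
theorem IsAdapted.poincare (h : IsAdapted g e c) (hQm : MeasurableSet Q)
    (hQ : Q ⊆ (e.extend I).target) (hQc : Convex ℝ Q) {d : ℝ≥0∞}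
    (hd : ∀ x ∈ Q, ∀ y ∈ Q, ‖y - x‖ₑ ≤ d) {φ : M → ℂ} (hφ : ContMDiff I 𝓘(ℝ, ℂ) ∞ φ) :
    ∫⁻ x in chartCell I e Q, ‖φ x‖ₑ ^ 2 ∂(vol g) ≤
      ENNReal.ofReal (2 * ((vol g).real (chartCell I e Q))⁻¹) *
        ‖∫ x in chartCell I e Q, φ x ∂(vol g)‖ₑ ^ 2 +
      poincareConst n c * d ^ 2 *
        ∫⁻ x in chartCell I e Q, sqNorm g (differential I φ) x ∂(vol g) := by
  set q := chartCell I e Q with hq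
  set A := ENNReal.ofReal √(c ^ n) with hA
  set S := ∫⁻ x in q, sqNorm g (differential I φ) x ∂(vol g) with hS
  -- On a null cell the left side vanishes; otherwise the mass of the cell can be cancelled.
  rcases eq_or_ne (vol g q) 0 with h0 | h0
  · rw [setLIntegral_measure_zero _ _ h0]
    exact zero_le
  have hD : ∫⁻ x in q, ∫⁻ y in q, ‖φ y - φ x‖ₑ ^ 2 ∂(vol g) ∂(vol g) ≤
      vol g q * (2 ^ n * (ENNReal.ofReal c * A ^ 4) * d ^ 2 * S) := by
    calc _ ≤ A * ∫⁻ z in Q, ∫⁻ y in q, ‖φ y - φ ((e.extend I).symm z)‖ₑ ^ 2 ∂(vol g) :=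
          h.lintegral_chartCell_le hQm hQ _
      _ ≤ A * ∫⁻ z in Q, A * ∫⁻ w in Q,
            ‖(φ ∘ (e.extend I).symm) w - (φ ∘ (e.extend I).symm) z‖ₑ ^ 2 := by
          gcongr with z
          exact h.lintegral_chartCell_le hQm hQ fun y => ‖φ y - φ ((e.extend I).symm z)‖ₑ ^ 2
      _ = A * (A * ∫⁻ z in Q, ∫⁻ w in Q,
            ‖(φ ∘ (e.extend I).symm) w - (φ ∘ (e.extend I).symm) z‖ₑ ^ 2) := by
          rw [lintegral_const_mul' _ _ ENNReal.ofReal_ne_top]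
      _ ≤ A * (A * (d ^ 2 * (2 ^ n * (A * vol g q) *
            (ENNReal.ofReal c * (A * S))))) := by
          gcongr
          refine (lintegral_lintegral_enorm_sub_sq_le volume hQc hQm hd
            (fun x hx => (hasFDerivWithinAt_chartDeriv h.mem hφ (hQ hx)).mono hQ)
            ((continuousOn_chartDeriv h.mem hφ).mono hQ)).trans ?_
          rw [finrank_euclideanSpace_fin]
          gcongr
          · exact h.volume_cell_le hQm hQ
          · exact h.lintegral_chartDeriv_le hQm hQ hφ
      _ = _ := by ring
  have hint : Integrable φ ((vol g).restrict q) :=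
    ((memLp_of_contMDiff g hφ).integrable one_le_two).restrict
  have h1 := measure_mul_lintegral_enorm_sq_le hint
  rw [Measure.restrict_apply_univ] at h1
  rw [← ENNReal.mul_le_mul_iff_right h0 (measure_ne_top _ _)]
  refine h1.trans ?_
  rw [mul_add, mul_add]
  refine add_le_add ?_ ((mul_le_mul_right hD 2).trans_eq ?_)
  · rw [ENNReal.ofReal_mul zero_le_two, ENNReal.ofReal_inv_of_pos
        (show 0 < (vol g).real q from ENNReal.toReal_pos h0 (measure_ne_top _ _)),
      ofReal_measureReal, mul_assoc, mul_left_comm,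
      ← mul_assoc (vol g q), ENNReal.mul_inv_cancel h0 (measure_ne_top _ _), one_mul]
    simp
  · unfold poincareConst
    ring

end Cell

/-! ### Rellich's inequality -/

section Grid

variable {n : ℕ}

/-- The cube of side `r` in the grid `(rℤ)ⁿ` with lower corner `r k`. -/
def gridCell (r : ℝ) (k : Fin n → ℤ) : Set (EuclideanSpace ℝ (Fin n)) :=
  {z | ∀ i, k i * r ≤ z i ∧ z i < (k i + 1) * r}

theorem gridCell_eq_iInter (r : ℝ) (k : Fin n → ℤ) : gridCell r k =
    ⋂ i, (EuclideanSpace.proj (𝕜 := ℝ) i) ⁻¹' Ico (k i * r : ℝ) ((k i + 1) * r) := by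
  ext z
  simp [gridCell]

theorem convex_gridCell (r : ℝ) (k : Fin n → ℤ) : Convex ℝ (gridCell r k) := by
  rw [gridCell_eq_iInter]
  exact convex_iInter fun i =>
    (convex_Ico _ _).linear_preimage (EuclideanSpace.proj (𝕜 := ℝ) i).toLinearMap

theorem measurableSet_gridCell (r : ℝ) (k : Fin n → ℤ) : MeasurableSet (gridCell r k) := by
  rw [gridCell_eq_iInter]
  exact MeasurableSet.iInter fun i =>
    measurableSet_Ico.preimage (EuclideanSpace.proj (𝕜 := ℝ) i).continuous.measurable

/-- The half-open cells are the fibres of the coordinatewise floor, so they cover space and are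
disjoint. -/
theorem mem_gridCell_iff_floor {r : ℝ} (hr : 0 < r) {k : Fin n → ℤ}
    {z : EuclideanSpace ℝ (Fin n)} : z ∈ gridCell r k ↔ (fun i => ⌊z i / r⌋) = k := by
  rw [funext_iff]
  refine forall_congr' fun i => ?_
  rw [Int.floor_eq_iff, le_div_iff₀ hr, div_lt_iff₀ hr]

theorem enorm_sub_le_of_mem_gridCell {r : ℝ} (hr : 0 < r) {k : Fin n → ℤ}
    {x y : EuclideanSpace ℝ (Fin n)} (hx : x ∈ gridCell r k) (hy : y ∈ gridCell r k) :
    ‖y - x‖ₑ ≤ ENNReal.ofReal (√n * r) := by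
  rw [← ofReal_norm]
  refine ENNReal.ofReal_le_ofReal (abs_le_of_sq_le_sq' ?_ (by positivity)).2
  rw [mul_pow, Real.sq_sqrt (Nat.cast_nonneg n), EuclideanSpace.real_norm_sq_eq]
  calc _ ≤ ∑ _i : Fin n, r ^ 2 := by
        refine Finset.sum_le_sum fun i _ => sq_le_sq' ?_ ?_
        · have := hx i; have := hy i; simp only [PiLp.sub_apply]; linarith
        · have := hx i; have := hy i; simp only [PiLp.sub_apply]; linarith
    _ = _ := by simp

theorem exists_finset_gridCell {s : Set (EuclideanSpace ℝ (Fin n))} (hs : Bornology.IsBounded s)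
    {r : ℝ} (hr : 0 < r) : ∃ T : Finset (Fin n → ℤ), ∀ z ∈ s, ∃ k ∈ T, z ∈ gridCell r k := by
  obtain ⟨R, hR⟩ := hs.exists_norm_le
  refine ⟨Fintype.piFinset fun _ => Finset.Icc ⌊-R / r⌋ ⌊R / r⌋, fun z hz =>
    ⟨fun i => ⌊z i / r⌋, ?_, (mem_gridCell_iff_floor hr).2 rfl⟩⟩
  rw [Fintype.mem_piFinset]
  intro i
  have h1 : |z i| ≤ R := (PiLp.norm_apply_le z i).trans (hR z hz)
  rw [Finset.mem_Icc]
  constructor <;> refine Int.floor_le_floor ?_ <;> gcongr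
  · exact (abs_le.1 h1).1
  · exact (abs_le.1 h1).2

theorem exists_pos_mul_sq_le {K : ℝ≥0∞} (hK : K ≠ ⊤) (n : ℕ) {ε : ℝ} (hε : 0 < ε) :
    ∃ r : ℝ, 0 < r ∧ K * ENNReal.ofReal (√n * r) ^ 2 ≤ ENNReal.ofReal ε := by
  have h1 : 0 < n * K.toReal + 1 := by positivity
  -- Solves `K n r² ≤ ε`; the added `1` keeps the denominator positive when `n K = 0`.
  refine ⟨√(ε / (n * K.toReal + 1)), by positivity, ?_⟩
  rw [← ENNReal.ofReal_toReal hK, ← ENNReal.ofReal_pow (by positivity),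
    ← ENNReal.ofReal_mul ENNReal.toReal_nonneg, ENNReal.toReal_ofReal ENNReal.toReal_nonneg]
  refine ENNReal.ofReal_le_ofReal ?_
  rw [mul_pow, Real.sq_sqrt (Nat.cast_nonneg n), Real.sq_sqrt (by positivity),
    ← mul_assoc, mul_div_assoc', div_le_iff₀ h1]
  linarith

end Grid

/-! ### From cells to the whole manifold. -/

section Rellich

variable {n : ℕ} {H : Type*} [TopologicalSpace H]
  {I : ModelWithCorners ℝ (EuclideanSpace ℝ (Fin n)) H}
  {M : Type*} [TopologicalSpace M] [ChartedSpace H M] [IsManifold I ∞ M]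
  [CompactSpace M] [MeasurableSpace M] [BorelSpace M]

/-- The Poincaré inequality summed over the cells of a grid in one chart. -/
theorem IsAdapted.lintegral_source_le_sum {g : RoughMetric I M} {e : OpenPartialHomeomorph M H}
    {c : ℝ} (h : IsAdapted g e c) {r : ℝ} (hr : 0 < r) {T : Finset (Fin n → ℤ)}
    (hT : ∀ z ∈ (e.extend I).target, ∃ k ∈ T, z ∈ gridCell r k) {φ : M → ℂ}
    (hφ : ContMDiff I 𝓘(ℝ, ℂ) ∞ φ) :
    ∫⁻ x in e.source, ‖φ x‖ₑ ^ 2 ∂(vol g) ≤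
      ∑ k : T, ENNReal.ofReal (2 * ((vol g).real
          (chartCell I e ((e.extend I).target ∩ gridCell r k)))⁻¹) *
        ‖∫ x in chartCell I e ((e.extend I).target ∩ gridCell r k), φ x ∂(vol g)‖ₑ ^ 2 +
      poincareConst n c * ENNReal.ofReal (√n * r) ^ 2 *
        ∫⁻ x, sqNorm g (differential I φ) x ∂(vol g) := by
  set Q : T → Set (EuclideanSpace ℝ (Fin n)) := fun k => (e.extend I).target ∩ gridCell r k
  have hQm : ∀ k, MeasurableSet (Q k) := fun k =>
    (measurableSet_target e).inter (measurableSet_gridCell r _)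
  have hsub : e.source ⊆ ⋃ k, chartCell I e (Q k) := fun x hx => by
    have hx' : e.extend I x ∈ (e.extend I).target :=
      (e.extend I).map_source (by rwa [OpenPartialHomeomorph.extend_source])
    obtain ⟨k, hk, hxk⟩ := hT _ hx'
    exact mem_iUnion.2 ⟨⟨k, hk⟩, hx, hx', hxk⟩
  -- Disjointness bounds the sum of the Dirichlet integrals over the cells by the total one. So the
  -- gradient constant does not involve the number of cells, which grows as `r` shrinks.
  have hdisj : Pairwise (Function.onFun Disjoint fun k => chartCell I e (Q k)) := by
    intro k l hkl
    refine disjoint_left.2 fun x hx hx' => hkl (Subtype.ext ?_)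
    exact ((mem_gridCell_iff_floor hr).1 hx.2.2).symm.trans ((mem_gridCell_iff_floor hr).1 hx'.2.2)
  calc ∫⁻ x in e.source, ‖φ x‖ₑ ^ 2 ∂(vol g)
      ≤ ∫⁻ x in ⋃ k, chartCell I e (Q k), ‖φ x‖ₑ ^ 2 ∂(vol g) := lintegral_mono_set hsub
    _ ≤ ∑ k, ∫⁻ x in chartCell I e (Q k), ‖φ x‖ₑ ^ 2 ∂(vol g) := by
        rw [← tsum_fintype (L := .unconditional _)]
        exact lintegral_iUnion_le _ _
    _ ≤ ∑ k, (ENNReal.ofReal (2 * ((vol g).real (chartCell I e (Q k)))⁻¹) *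
          ‖∫ x in chartCell I e (Q k), φ x ∂(vol g)‖ₑ ^ 2 +
        poincareConst n c * ENNReal.ofReal (√n * r) ^ 2 *
          ∫⁻ x in chartCell I e (Q k), sqNorm g (differential I φ) x ∂(vol g)) := by
        gcongr with k
        exact h.poincare (hQm k) inter_subset_left (h.convex.inter (convex_gridCell r _))
          (fun x hx y hy => enorm_sub_le_of_mem_gridCell hr hx.2 hy.2) hφ
    _ ≤ _ := by
        rw [Finset.sum_add_distrib, ← Finset.mul_sum]
        gcongr
        rw [← tsum_fintype (L := .unconditional _),
          ← lintegral_iUnion (fun k => measurableSet_chartCell e (hQm k)) hdisj]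
        exact setLIntegral_le_lintegral _ _

/-- Rellich's inequality on the smooth functions. -/
theorem exists_rellich_smooth (g : RoughMetric I M) {ε : ℝ} (hε : 0 < ε) :
    ∃ (ι : Type) (_ : Fintype ι) (p : ι → L2 g), ∀ w ∈ smoothGraph g univ,
      ‖w.1‖ ^ 2 ≤ ε * ‖w.2‖ ^ 2 + ∑ q, ‖(inner ℂ (p q) w.1 : ℂ)‖ ^ 2 := by
  obtain ⟨N, e, c, h, hcov⟩ := exists_finite_adapted g
  -- The charts may overlap, and each contributes at most the full Dirichlet integral, so their
  -- constants add up.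
  obtain ⟨r, hr, hrε⟩ := exists_pos_mul_sq_le (K := ∑ a, poincareConst n (c a))
    (ENNReal.sum_ne_top.2 fun a _ => poincareConst_ne_top _ _) n hε
  choose T hT using fun a => exists_finset_gridCell (h a).bounded hr
  set q : (Σ a, T a) → Set M := fun k =>
    chartCell I (e k.1) (((e k.1).extend I).target ∩ gridCell r k.2) with hq
  have hqm : ∀ k, MeasurableSet (q k) := fun k =>
    measurableSet_chartCell _ ((measurableSet_target _).inter (measurableSet_gridCell r _))
  -- The indicators are scaled so that the squared pairing with `φ` is exactly the mean value term
  -- of `IsAdapted.poincare`.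
  refine ⟨Σ a, T a, inferInstance, fun k => ((√(2 * ((vol g).real (q k))⁻¹) : ℝ) : ℂ) •
    indicatorConstLp 2 (hqm k) (measure_ne_top _ _) (1 : ℂ), ?_⟩
  rintro w ⟨φ, hφ, -, hw1, hsq, hw2⟩
  have hin : ∀ k, ‖(inner ℂ (((√(2 * ((vol g).real (q k))⁻¹) : ℝ) : ℂ) •
      indicatorConstLp 2 (hqm k) (measure_ne_top _ _) (1 : ℂ)) w.1 : ℂ)‖ₑ ^ 2 =
      ENNReal.ofReal (2 * ((vol g).real (q k))⁻¹) * ‖∫ x in q k, φ x ∂(vol g)‖ₑ ^ 2 := by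
    intro k
    have h0 : 0 ≤ 2 * ((vol g).real (q k))⁻¹ := by positivity
    rw [inner_smul_left, L2.inner_indicatorConstLp_one, enorm_mul, mul_pow, Complex.conj_ofReal,
      integral_congr_ae (ae_restrict_of_ae hw1)]
    congr 1
    rw [← ofReal_norm, Complex.norm_real, Real.norm_of_nonneg (Real.sqrt_nonneg _),
      ← ENNReal.ofReal_pow (Real.sqrt_nonneg _), Real.sq_sqrt h0]
  have key : ‖w.1‖ₑ ^ 2 ≤ ENNReal.ofReal ε * ‖w.2‖ₑ ^ 2 + ∑ k,
      ‖(inner ℂ (((√(2 * ((vol g).real (q k))⁻¹) : ℝ) : ℂ) •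
      indicatorConstLp 2 (hqm k) (measure_ne_top _ _) (1 : ℂ)) w.1 : ℂ)‖ₑ ^ 2 := by
    simp only [hin]
    rw [hw2, L2Cotangent.enorm_mk_sq, Lp.enorm_def, eLpNorm_congr_ae hw1, eLpNorm_two_sq,
      Fintype.sum_sigma, add_comm]
    refine (lintegral_le_sum_source hcov _ _).trans ((Finset.sum_le_sum fun a _ =>
      (h a).lintegral_source_le_sum hr (hT a) hφ).trans ?_)
    rw [Finset.sum_add_distrib, ← Finset.sum_mul, ← Finset.sum_mul]
    gcongr
  have hfin : ENNReal.ofReal ε * ‖w.2‖ₑ ^ 2 + ∑ k,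
      ‖(inner ℂ (((√(2 * ((vol g).real (q k))⁻¹) : ℝ) : ℂ) •
      indicatorConstLp 2 (hqm k) (measure_ne_top _ _) (1 : ℂ)) w.1 : ℂ)‖ₑ ^ 2 =
      ENNReal.ofReal (ε * ‖w.2‖ ^ 2 + ∑ k,
      ‖(inner ℂ (((√(2 * ((vol g).real (q k))⁻¹) : ℝ) : ℂ) •
      indicatorConstLp 2 (hqm k) (measure_ne_top _ _) (1 : ℂ)) w.1 : ℂ)‖ ^ 2) := by
    rw [ENNReal.ofReal_add (by positivity) (by positivity), ENNReal.ofReal_mul hε.le,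
      ENNReal.ofReal_sum_of_nonneg fun _ _ => by positivity]
    simp only [ENNReal.ofReal_pow (norm_nonneg _), ofReal_norm]
  rw [hfin, ← ofReal_norm, ← ENNReal.ofReal_pow (norm_nonneg _)] at key
  exact (ENNReal.ofReal_le_ofReal_iff (by positivity)).1 key

/-- Rellich's inequality on `H¹(M)`. -/
theorem exists_rellich (g : RoughMetric I M) {ε : ℝ} (hε : 0 < ε) :
    ∃ (ι : Type) (_ : Fintype ι) (p : ι → L2 g), ∀ w ∈ closure (smoothGraph g univ : Set (L2 g × L2Cotangent g)),
      ‖w.1‖ ^ 2 ≤ ε * ‖w.2‖ ^ 2 + ∑ q, ‖(inner ℂ (p q) w.1 : ℂ)‖ ^ 2 := by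
  obtain ⟨ι, hι, p, hp⟩ := exists_rellich_smooth g hε
  refine ⟨ι, hι, p, fun w hw => ?_⟩
  have hcl : IsClosed {w : L2 g × L2Cotangent g |
      ‖w.1‖ ^ 2 ≤ ε * ‖w.2‖ ^ 2 + ∑ q, ‖(inner ℂ (p q) w.1 : ℂ)‖ ^ 2} :=
    isClosed_le (by fun_prop) (by fun_prop)
  exact hcl.closure_subset_iff.2 (fun w hw => mem_ofPred_eq ▸ hp w hw) hw

end Rellich

/-! ### The form domain as a Hilbert space -/

section FormDomain

variable {n : ℕ} {H : Type*} [TopologicalSpace H]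
  {I : ModelWithCorners ℝ (EuclideanSpace ℝ (Fin n)) H}
  {M : Type*} [TopologicalSpace M] [ChartedSpace H M] [IsManifold I ∞ M]
  [CompactSpace M] [MeasurableSpace M] [BorelSpace M]

theorem graph_gradSmooth (g : RoughMetric I M) : (gradSmooth g).graph = smoothGraph g univ := by
  refine Submodule.toLinearPMap_graph_eq _ ?_
  rintro ⟨u, θ⟩ hw rfl
  exact snd_eq_zero_of_mem_closure_smoothGraph g (subset_closure hw)

theorem isClosable_gradSmooth (g : RoughMetric I M) : (gradSmooth g).IsClosable := by
  refine ⟨(smoothGraph g univ).topologicalClosure.toLinearPMap, ?_⟩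
  rw [graph_gradSmooth, Submodule.toLinearPMap_graph_eq]
  rintro ⟨u, θ⟩ hw rfl
  exact snd_eq_zero_of_mem_closure_smoothGraph g hw

/-- Thanks to closability the graph of `∇` is the closure of the smooth graph, which is where
`exists_rellich` holds. -/
theorem graph_grad (g : RoughMetric I M) :
    (grad g).graph = (smoothGraph g univ).topologicalClosure := by
  rw [grad, ← (isClosable_gradSmooth g).graph_closure_eq_closure_graph, graph_gradSmooth]

theorem isClosed_graph_grad (g : RoughMetric I M) :
    IsClosed ((grad g).graph : Set (L2 g × L2Cotangent g)) := by
  rw [graph_grad]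
  exact Submodule.isClosed_topologicalClosure _

/-- The graph `{(u, ∇u) : u ∈ W}`, with the norm of `H¹(M)`. -/
noncomputable def formGraph (g : RoughMetric I M) (B : AdmissibleBC g) :
    Submodule ℂ (WithLp 2 (L2 g × L2Cotangent g)) :=
  B.W.comap (WithLp.fstL 2 ℂ (L2 g) (L2Cotangent g)).toLinearMap ⊓
    (grad g).graph.comap (WithLp.linearEquiv 2 ℂ (L2 g × L2Cotangent g)).toLinearMap

theorem mem_formGraph_iff {g : RoughMetric I M} {B : AdmissibleBC g}
    {p : WithLp 2 (L2 g × L2Cotangent g)} :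
    p ∈ formGraph g B ↔ p.fst ∈ B.W ∧ (p.fst, p.snd) ∈ (grad g).graph :=
  Iff.rfl

theorem grad_eq_of_mem_graph {g : RoughMetric I M} {u : L2 g} {θ : L2Cotangent g}
    (h : (u, θ) ∈ (grad g).graph) (hu : u ∈ (grad g).domain) : grad g ⟨u, hu⟩ = θ := by
  obtain ⟨y, hy, hθ⟩ := (LinearPMap.mem_graph_iff _).1 h
  have hyu : y = ⟨u, hu⟩ := Subtype.ext hy
  exact hyu ▸ hθ

theorem h1Norm_sub_of_mem_graph {g : RoughMetric I M} {u v : L2 g} {θ η : L2Cotangent g}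
    (hu : (u, θ) ∈ (grad g).graph) (hv : (v, η) ∈ (grad g).graph) (hu' : u ∈ H1 g)
    (hv' : v ∈ H1 g) :
    h1Norm g (⟨u, hu'⟩ - ⟨v, hv'⟩) = √(‖u - v‖ ^ 2 + ‖θ - η‖ ^ 2) := by
  have h : grad g (⟨u, hu'⟩ - ⟨v, hv'⟩ : H1 g) = θ - η :=
    ((grad g).map_sub ⟨u, hu'⟩ ⟨v, hv'⟩).trans
      (congrArg₂ (· - ·) (grad_eq_of_mem_graph hu hu') (grad_eq_of_mem_graph hv hv'))
  rw [h1Norm, h]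
  rfl

/-- The `WithLp 2` norm of `(u, ∇u)` is `h1Norm`. A limit of elements stays in the closed graph of
`∇`, and its first component then stays in `W` by the closedness in `AdmissibleBC`. -/
theorem isClosed_formGraph (g : RoughMetric I M) (B : AdmissibleBC g) :
    IsClosed (formGraph g B : Set (WithLp 2 (L2 g × L2Cotangent g))) := by
  refine IsSeqClosed.isClosed fun x y hx hxy => ?_
  have hx' := fun k => mem_formGraph_iff.1 (hx k)
  have hgr : (y.fst, y.snd) ∈ (grad g).graph :=
    ((isClosed_graph_grad g).preimage (WithLp.prod_continuous_ofLp 2 _ _)).mem_of_tendsto hxy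
      (Eventually.of_forall fun k => (hx' k).2)
  have hdom : ∀ {p : WithLp 2 (L2 g × L2Cotangent g)}, (p.fst, p.snd) ∈ (grad g).graph →
      p.fst ∈ H1 g := fun hp => LinearPMap.mem_domain_of_mem_graph hp
  refine ⟨B.closed (fun k => ⟨(x k).fst, hdom (hx' k).2⟩) ⟨y.fst, hdom hgr⟩ (fun k => (hx' k).1) ?_,
    hgr⟩
  refine (tendsto_iff_norm_sub_tendsto_zero.1 hxy).congr fun k => ?_
  rw [WithLp.prod_norm_eq_of_L2, h1Norm_sub_of_mem_graph (hx' k).2 hgr]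
  rfl

instance completeSpace_formGraph (g : RoughMetric I M) (B : AdmissibleBC g) :
    CompleteSpace (formGraph g B) :=
  (isClosed_formGraph g B).completeSpace_coe

/-- The embedding of `W` into `L²(M, μ_g)`. -/
noncomputable def formEmbedding (g : RoughMetric I M) (B : AdmissibleBC g) :
    formGraph g B →L[ℂ] L2 g :=
  (WithLp.fstL 2 ℂ (L2 g) (L2Cotangent g)).comp (formGraph g B).subtypeL

theorem exists_formEmbedding_eq {g : RoughMetric I M} (B : AdmissibleBC g) (u : B.W) :
    ∃ v : formGraph g B, formEmbedding g B v = u ∧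
      v.1.snd = grad g ⟨u, B.le_H1 u.2⟩ :=
  ⟨⟨WithLp.toLp 2 ((u : L2 g), grad g ⟨u, B.le_H1 u.2⟩), mem_formGraph_iff.2
    ⟨u.2, (grad g).mem_graph ⟨u, B.le_H1 u.2⟩⟩⟩, rfl, rfl⟩

theorem isCompactOperator_formEmbedding (g : RoughMetric I M) (B : AdmissibleBC g) :
    IsCompactOperator (formEmbedding g B) := by
  refine isCompactOperator_of_norm_sq_le _ fun ε hε => ?_
  obtain ⟨ι, hι, p, hp⟩ := exists_rellich g hε
  refine ⟨ι, hι, p, fun v => ?_⟩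
  have hv : (v.1.fst, v.1.snd) ∈ closure (smoothGraph g univ : Set (L2 g × L2Cotangent g)) := by
    have := (mem_formGraph_iff.1 v.2).2
    rw [graph_grad] at this
    exact this
  refine (hp _ hv).trans ?_
  have h2 : ‖v‖ ^ 2 = ‖v.1.fst‖ ^ 2 + ‖v.1.snd‖ ^ 2 := WithLp.prod_norm_sq_eq_of_L2 v.1
  rw [h2]
  gcongr
  · exact le_add_of_nonneg_left (sq_nonneg _)
  · exact le_rfl

theorem denseRange_formEmbedding [T2Space M] (g : RoughMetric I M) (B : AdmissibleBC g) :
    DenseRange (formEmbedding g B) := by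
  refine (dense_H10 g).mono fun u hu => ?_
  obtain ⟨v, hv, -⟩ := exists_formEmbedding_eq B ⟨u, B.H10_le hu⟩
  exact ⟨v, hv⟩

/-- The scalar product of `H¹(M)` is that of `L²` plus the Dirichlet form, so adding `(w.1, v)` to
the defining identity of the Laplacian replaces the form by this product and `w.2` by `w.2 + w.1`.
-/
theorem mem_laplacianGraph_iff {g : RoughMetric I M} (B : AdmissibleBC g) (w : L2 g × L2 g) :
    w ∈ laplacianGraph g B ↔ ∃ v, formEmbedding g B v = w.1 ∧
      ∀ v', (inner ℂ v' v : ℂ) = inner ℂ (formEmbedding g B v') (w.2 + w.1) := by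
  have hin : ∀ v v' : formGraph g B, (inner ℂ v' v : ℂ) =
      inner ℂ (formEmbedding g B v') (formEmbedding g B v) + inner ℂ v'.1.snd v.1.snd :=
    fun v v' => rfl
  have hgrad : ∀ (v : formGraph g B) (h : formEmbedding g B v ∈ (grad g).domain),
      grad g ⟨formEmbedding g B v, h⟩ = v.1.snd := fun v h =>
    grad_eq_of_mem_graph (mem_formGraph_iff.1 v.2).2 h
  constructor
  · rintro ⟨hW, hw⟩
    obtain ⟨v, hv, hv2⟩ := exists_formEmbedding_eq B ⟨w.1, hW⟩
    refine ⟨v, hv, fun v' => ?_⟩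
    have hv' : formEmbedding g B v' ∈ B.W := (mem_formGraph_iff.1 v'.2).1
    have h1 : (inner ℂ v'.1.snd v.1.snd : ℂ) = inner ℂ (formEmbedding g B v') w.2 := by
      rw [hv2, ← hgrad v' (B.le_H1 hv')]
      exact hw ⟨formEmbedding g B v', hv'⟩
    rw [hin, h1, hv, inner_add_right, add_comm]
  · rintro ⟨v, hv, hw⟩
    have hW : w.1 ∈ B.W := hv ▸ (mem_formGraph_iff.1 v.2).1
    refine ⟨hW, fun u => ?_⟩
    obtain ⟨v', hv', hv2'⟩ := exists_formEmbedding_eq B u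
    have h1 := hw v'
    have h2 : grad g ⟨w.1, B.le_H1 hW⟩ = v.1.snd :=
      grad_eq_of_mem_graph (hv ▸ (mem_formGraph_iff.1 v.2).2) _
    rw [hin, hv, hv', inner_add_right, add_comm, add_right_cancel_iff] at h1
    rw [dirichletForm, h2, ← hv2', h1]

/-- The spectral properties of the Laplacian on a compact manifold with corners. -/
theorem laplacian_spectral [T2Space M] (g : RoughMetric I M) (B : AdmissibleBC g) :
    IsSelfAdjoint (laplacian g B) ∧ HasPurelyDiscreteSpectrum (laplacian g B) ∧
    (∀ ζ : ℂ, ¬ AccPt ζ (𝓟 (unboundedSpectrum (laplacian g B)))) ∧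
    ∀ ζ : ℂ, FiniteDimensional ℂ (unboundedEigenspace (laplacian g B) ζ) :=
  spectral_of_compact_form (isCompactOperator_formEmbedding g B) (denseRange_formEmbedding g B)
    (mem_laplacianGraph_iff B)

end FormDomain

end RoughLaplacian

/-- Manifolds with boundary are those modelled on the half-space; charts into its interior give the
case of empty boundary. -/
theorem mainTheorem6 (n : ℕ) [NeZero n] (hn : 2 ≤ n)
    (M : Type*) [TopologicalSpace M] [T2Space M] [CompactSpace M]
    [ChartedSpace (EuclideanHalfSpace n) M] [IsManifold (𝓡∂ n) ∞ M]
    [MeasurableSpace M] [BorelSpace M]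
    (g : RoughLaplacian.RoughMetric (𝓡∂ n) M) (B : RoughLaplacian.AdmissibleBC g) :
    IsSelfAdjoint (RoughLaplacian.laplacian g B) ∧
    RoughLaplacian.HasPurelyDiscreteSpectrum (RoughLaplacian.laplacian g B) ∧
    (∀ ζ : ℂ, ¬ AccPt ζ (𝓟 (RoughLaplacian.unboundedSpectrum (RoughLaplacian.laplacian g B)))) ∧
    ∀ ζ : ℂ, FiniteDimensional ℂ
      (RoughLaplacian.unboundedEigenspace (RoughLaplacian.laplacian g B) ζ) :=
  RoughLaplacian.laplacian_spectral g B
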